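/- Let $\mathcal G\rightrightarrows M$ be a Hausdorff, second countable Lie groupoid with source $\mathbf s$, target $\mathbf t$ and compact Hausdorff unit manifold $M$, whose fibres $\mathcal G_x=\mathbf s^{-1}(x)$ are connected (for example a Lauter–Nistor groupoid). Let $\mathcal A=\ker d\mathbf s|_M$ be its Lie algebroid with a smooth metric $g_{\mathcal A}$. By right translation $g_{\mathcal A}$ induces a Riemannian metric on each $\mathcal G_x$, with distance $d$ and volume measure $\mu_x$. Assume that $\mathcal G$ is of sub-exponential growth: for every $\delta>0$ there is a constant $C$ with $\int_{\mathcal G_x}e^{-\delta d(x,a)}\,d\mu_x(a)\le C$ for all $x\in M$. Let $E\to M$ be a Hermitian complex vector bundle of finite rank with an $\mathcal A$-connection. *Kernels.* A kernel is a section $\kappa$ of $\mathbf t^{-1}E\otimes\mathbf s^{-1}E'$, that is, $\kappa(a)\in\mathrm{Hom}(E_{\mathbf s(a)},E_{\mathbf t(a)})$. Put $$\|\kappa\|_1=\sup_{x\in M}\max\Big\{\int_{\mathcal G_x}|\kappa(a)|\,d\mu_x(a),\ \int_{\mathcal G_x}|\kappa(a^{-1})|\,d\mu_x(a)\Big\}.$$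 The space $\Psi^{-\infty}_\mu(\mathcal G,E)$ of smooth compactly supported kernels has the convolution $f_1\circ f_2(a)=\int_{\mathcal G_{\mathbf s(a)}}f_1(ab^{-1})f_2(b)\,d\mu_{\mathbf s(a)}(b)$ and the involution $f^*(a)=f(a^{-1})^*$. Its full norm is $\|f\|=\sup_\rho\|\rho(f)\|$, where $\rho$ ranges over the $*$-representations of this algebra on Hilbert spaces with $\|\rho(f)\|\le\|f\|_1$ for all $f$, and $\mathfrak C^*(\mathcal G,E)$ is its completion for the full norm. *The $\varepsilon$-calculus.* Let $\tilde{\mathcal G}=\{(a,b)\in\mathcal G\times\mathcal G:\mathbf s(a)=\mathbf s(b)\}$. For $\varepsilon>0$, $\Psi^{-\infty}_\varepsilon(\mathcal G,E)$ is the set of smooth kernels $\kappa$ for which there is $\varepsilon'>\varepsilon$ such that every iterated covariant derivative of $(a,b)\mapsto\kappa(ab^{-1})\in\mathrm{Hom}(E_{\mathbf t(b)},E_{\mathbf t(a)})$ along right invariant vector fields of the $\mathbf s$-fibres in the variables $a$ and $b$, for the right invariant connection induced by the $\mathcal A$-connection, is bounded by $C\,e^{-\varepsilon' d(a,b)}$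 on $\tilde{\mathcal G}$. Here $C$ depends on the derivative only. **Proposition.** For every $\varepsilon>0$, $$\Psi^{-\infty}_\varepsilon(\mathcal G,E)\subseteq\mathfrak C^*(\mathcal G,E).$$ Precisely, there is an injective map $J:\Psi^{-\infty}_\varepsilon(\mathcal G,E)\to\mathfrak C^*(\mathcal G,E)$ such that for every $\kappa\in\Psi^{-\infty}_\varepsilon(\mathcal G,E)$: 1. for every $\eta>0$ there is $f\in\Psi^{-\infty}_\mu(\mathcal G,E)$ with $\|\kappa-f\|_1<\eta$ and $\|J(\kappa)-f\|<\eta$ (which determines $J(\kappa)$, and gives $J(f)=f$ for every $f\in\Psi^{-\infty}_\varepsilon\cap\Psi^{-\infty}_\mu$); 2. $J(\kappa)$ acts in every regular representation as the operator with reduced kernel $\kappa$: for all $x\in M$ and all smooth compactly supported sections $w$ of $\mathbf t^{-1}E$, if $f\in\Psi^{-\infty}_\mu(\mathcal G,E)$ tends to $J(\kappa)$ in the full norm, then $\int_{\mathcal G_{x}}f(ab^{-1})w(b)\,d\mu_x(b)$ tends to $\int_{\mathcal G_{x}}\kappa(ab^{-1})w(b)\,d\mu_x(b)$ in $L^2(\mathcal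 G_x,\mathbf t^{-1}E)$ as a function of $a$. -/

import Mathlib

open Set Filter Topology MeasureTheory Bundle
open scoped Manifold ContDiff ENNReal

universe u v

noncomputable section

/-! ### Lie groupoids -/

/-- A Lie groupoid `G ⇉ M` with `dim M = m` and `dim G = m + n` (so that the `s`-fibres and the Lie
algebroid have rank `n`). The product `mul a b` is meaningful only when `s a = t b`; its values
at other pairs are irrelevant. -/
structure LieGroupoid (m n : ℕ) (G M : Type u)
    [TopologicalSpace G] [ChartedSpace (EuclideanSpace ℝ (Fin (m + n))) G]
    [TopologicalSpace M] [ChartedSpace (EuclideanSpace ℝ (Fin m)) M] where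
  /-- source -/
  s : G → M
  /-- target -/
  t : G → M
  /-- unit inclusion -/
  unit : M → G
  /-- inversion -/
  inv : G → G
  /-- multiplication -/
  mul : G → G → G
  s_unit : ∀ x, s (unit x) = x
  t_unit : ∀ x, t (unit x) = x
  s_mul : ∀ a b, s a = t b → s (mul a b) = s b
  t_mul : ∀ a b, s a = t b → t (mul a b) = t a
  mul_assoc : ∀ a b c, s a = t b → s b = t c → mul (mul a b) c = mul a (mul b c)
  mul_unit : ∀ a, mul a (unit (s a)) = a
  unit_mul : ∀ a, mul (unit (t a)) a = a
  s_inv : ∀ a, s (inv a) = t a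
  t_inv : ∀ a, t (inv a) = s a
  mul_inv : ∀ a, mul a (inv a) = unit (t a)
  inv_mul : ∀ a, mul (inv a) a = unit (s a)
  smooth_s : ContMDiff (𝓡 (m + n)) (𝓡 m) ∞ s
  smooth_t : ContMDiff (𝓡 (m + n)) (𝓡 m) ∞ t
  smooth_unit : ContMDiff (𝓡 m) (𝓡 (m + n)) ∞ unit
  smooth_inv : ContMDiff (𝓡 (m + n)) (𝓡 (m + n)) ∞ inv
  smooth_mul : ContMDiffOn ((𝓡 (m + n)).prod (𝓡 (m + n))) (𝓡 (m + n)) ∞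
    (fun p : G × G => mul p.1 p.2) {p | s p.1 = t p.2}
  submersion_s : ∀ a, Function.Surjective (mfderiv (𝓡 (m + n)) (𝓡 m) s a)
  submersion_t : ∀ a, Function.Surjective (mfderiv (𝓡 (m + n)) (𝓡 m) t a)

namespace LieGroupoid

section Geometry

variable {m n : ℕ} {G M : Type u}
  [TopologicalSpace G] [ChartedSpace (EuclideanSpace ℝ (Fin (m + n))) G]
  [TopologicalSpace M] [ChartedSpace (EuclideanSpace ℝ (Fin m)) M]
  (𝒢 : LieGroupoid m n G M)

/-- The `s`-fibre `G_x = s⁻¹(x)`. -/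
def fiber (x : M) : Set G := {a | 𝒢.s a = x}

/-- `G` is `s`-connected if all its `s`-fibres are connected. -/
def SConnected : Prop := ∀ x, IsConnected (𝒢.fiber x)

/-- A smooth section of the Lie algebroid `A = ker ds|_M`. -/
structure AlgSection [IsManifold (𝓡 (m + n)) ∞ G] where
  /-- the value at `p`, a tangent vector of `G` at the unit over `p` -/
  toFun : ∀ p : M, TangentSpace (𝓡 (m + n)) (𝒢.unit p)
  vertical : ∀ p, mfderiv (𝓡 (m + n)) (𝓡 m) 𝒢.s (𝒢.unit p) (toFun p) = 0
  smooth : ContMDiff (𝓡 m) (𝓡 (m + n)).tangent ∞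
    (fun p => (⟨𝒢.unit p, toFun p⟩ : TangentBundle (𝓡 (m + n)) G))

/-- A smooth Riemannian metric on the manifold `G`. Only its restriction to `A = ker ds|_M`,
a smooth metric `g_A` on the Lie algebroid, is used below; every smooth metric on `A` is
such a restriction. -/
abbrev AmbientMetric (m n : ℕ) (G : Type u)
    [TopologicalSpace G] [ChartedSpace (EuclideanSpace ℝ (Fin (m + n))) G]
    [IsManifold (𝓡 (m + n)) ∞ G] :=
  ContMDiffRiemannianMetric (𝓡 (m + n)) ∞ (EuclideanSpace ℝ (Fin (m + n)))
    (fun a : G => TangentSpace (𝓡 (m + n)) a)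

/-- For a vector `v ∈ ker ds_a`, the vector `dR_{a⁻¹} v ∈ A_{t(a)}`, where
`R_{a⁻¹} : G_{s(a)} → G_{t(a)}`, `c ↦ c a⁻¹`; it is tangent to `G` at the unit `a a⁻¹`. -/
def toAlg (a : G) (v : TangentSpace (𝓡 (m + n)) a) :
    TangentSpace (𝓡 (m + n)) (𝒢.mul a (𝒢.inv a)) :=
  mfderivWithin (𝓡 (m + n)) (𝓡 (m + n)) (fun c => 𝒢.mul c (𝒢.inv a)) (𝒢.fiber (𝒢.s a)) a v

variable [IsManifold (𝓡 (m + n)) ∞ G] (g : AmbientMetric m n G)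

/-- The right invariant Riemannian metric `g_s` on the `s`-fibres determined by `g_A`
(to be evaluated on vectors in `ker ds_a` only). -/
def gS (a : G) (v w : TangentSpace (𝓡 (m + n)) a) : ℝ :=
  g.inner (𝒢.mul a (𝒢.inv a)) (𝒢.toAlg a v) (𝒢.toAlg a w)

/-- Riemannian distance on the `s`-fibre through `a`: infimum of the lengths of the `C¹`
curves from `a` to `b` inside the fibre. -/
def fiberEDist (a b : G) : ℝ≥0∞ :=
  ⨅ (γ : ℝ → G) (_ : ContMDiffOn 𝓘(ℝ, ℝ) (𝓡 (m + n)) 1 γ (Icc 0 1) ∧ γ 0 = a ∧ γ 1 = b ∧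
      ∀ τ ∈ Icc (0 : ℝ) 1, γ τ ∈ 𝒢.fiber (𝒢.s a)),
    ∫⁻ τ in Icc (0 : ℝ) 1, ENNReal.ofReal (Real.sqrt
      (𝒢.gS g (γ τ) (mfderivWithin 𝓘(ℝ, ℝ) (𝓡 (m + n)) γ (Icc 0 1) τ (1 : ℝ))
        (mfderivWithin 𝓘(ℝ, ℝ) (𝓡 (m + n)) γ (Icc 0 1) τ (1 : ℝ))))

/-- The Riemannian distance as a real number (finite when `s a = s b` and `G` is `s`-connected). -/
def fiberDist (a b : G) : ℝ := (𝒢.fiberEDist g a b).toReal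

/-- `ψ : W → G_x` is a local parametrization of the `s`-fibre over `x`: a smooth injective
immersion of an open set `W ⊆ ℝⁿ` into the `n`-dimensional manifold `G_x`. -/
def IsFiberParam (x : M) (W : Set (EuclideanSpace ℝ (Fin n)))
    (ψ : EuclideanSpace ℝ (Fin n) → G) : Prop :=
  IsOpen W ∧ ContMDiffOn (𝓡 n) (𝓡 (m + n)) ∞ ψ W ∧ InjOn ψ W ∧ (∀ y ∈ W, ψ y ∈ 𝒢.fiber x) ∧
    ∀ y ∈ W, Function.Injective (mfderiv (𝓡 n) (𝓡 (m + n)) ψ y)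

/-- The Riemannian volume density `√det(g_s(∂ᵢψ, ∂ⱼψ))` of a parametrization. -/
def volDensity (ψ : EuclideanSpace ℝ (Fin n) → G) (y : EuclideanSpace ℝ (Fin n)) : ℝ :=
  Real.sqrt (Matrix.det (Matrix.of fun i j : Fin n =>
    𝒢.gS g (ψ y) (mfderiv (𝓡 n) (𝓡 (m + n)) ψ y (EuclideanSpace.single i (1 : ℝ)))
      (mfderiv (𝓡 n) (𝓡 (m + n)) ψ y (EuclideanSpace.single j (1 : ℝ)))))

variable [MeasurableSpace G]

/-- The Riemannian volume measure `μ_x` of `G_x`, as a measure on `G` carried by `G_x`. Each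
parametrization `ψ : W → G_x` contributes the restriction of the volume measure to the open set
`ψ(W) ⊆ G_x`; their least upper bound is the volume measure. -/
def vol (x : M) : Measure G :=
  ⨆ (W : Set (EuclideanSpace ℝ (Fin n))) (ψ : EuclideanSpace ℝ (Fin n) → G)
    (_ : 𝒢.IsFiberParam x W ψ),
    ((volume.restrict W).withDensity fun y => ENNReal.ofReal (𝒢.volDensity g ψ y)).map ψ

/-- `G` is of sub-exponential growth. -/
def SubexponentialGrowth : Prop :=
  ∀ ε : ℝ, 0 < ε → ∃ C : ℝ, ∀ x : M,
    ∫⁻ a, ENNReal.ofReal (Real.exp (-ε * 𝒢.fiberDist g (𝒢.unit x) a)) ∂(𝒢.vol g x)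
      ≤ ENNReal.ofReal C

end Geometry

/-! ### Kernels with values in a Hermitian vector bundle -/

section Kernels

variable {m n : ℕ} {G M : Type u}
  [TopologicalSpace G] [ChartedSpace (EuclideanSpace ℝ (Fin (m + n))) G]
  [TopologicalSpace M] [ChartedSpace (EuclideanSpace ℝ (Fin m)) M]
  (𝒢 : LieGroupoid m n G M)
  (E : M → Type u) [∀ x, NormedAddCommGroup (E x)] [∀ x, InnerProductSpace ℂ (E x)]

/-- Sections of `t⁻¹E ⊗ s⁻¹E'` over `G`: the value at `a` is a linear map `E_{s(a)} → E_{t(a)}`. -/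
abbrev Kernel := ∀ a : G, E (𝒢.s a) →L[ℂ] E (𝒢.t a)

variable {𝒢 E}

/-- `κ a` as a map `E_p → E_q`, where `p = s(a)` and `q = t(a)`. -/
def Kernel.at (κ : 𝒢.Kernel E) (a : G) {p q : M} (hp : 𝒢.s a = p) (hq : 𝒢.t a = q) :
    E p →L[ℂ] E q := by
  subst hp hq
  exact κ a

/-- `κ(a b⁻¹) : E_{t(b)} → E_{t(a)}`, for `s(a) = s(b)`. -/
def Kernel.atDiv (κ : 𝒢.Kernel E) (a b : G) (h : 𝒢.s a = 𝒢.s b) :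
    E (𝒢.t b) →L[ℂ] E (𝒢.t a) :=
  κ.at (𝒢.mul a (𝒢.inv b))
    ((𝒢.s_mul _ _ (h.trans (𝒢.t_inv b).symm)).trans (𝒢.s_inv b))
    (𝒢.t_mul _ _ (h.trans (𝒢.t_inv b).symm))

/-- `κ(a⁻¹) : E_{t(a)} → E_{s(a)}`. -/
def Kernel.atInv (κ : 𝒢.Kernel E) (a : G) : E (𝒢.t a) →L[ℂ] E (𝒢.s a) :=
  κ.at (𝒢.inv a) (𝒢.s_inv a) (𝒢.t_inv a)

/-- `f` is the adjoint kernel of `κ`: `f(a) = κ(a⁻¹)^*`. -/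
def Kernel.IsAdjoint (f κ : 𝒢.Kernel E) : Prop :=
  ∀ (a : G) (v : E (𝒢.s a)) (w : E (𝒢.t a)), inner ℂ w (f a v) = inner ℂ (κ.atInv a w) v

section Integration

variable [IsManifold (𝓡 (m + n)) ∞ G] (g : AmbientMetric m n G) [MeasurableSpace G]

open Classical in
/-- The convolution `f₁ ∘ f₂ (a) = ∫_{G_{s(a)}} f₁(a b⁻¹) f₂(b) dμ_{s(a)}(b)`. -/
def Kernel.conv (f₁ f₂ : 𝒢.Kernel E) : 𝒢.Kernel E := fun a =>
  ∫ b, (if h : 𝒢.s a = 𝒢.s b then (f₁.atDiv a b h) ∘L (f₂.at b h.symm rfl) else 0)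
    ∂(𝒢.vol g (𝒢.s a))

open Classical in
/-- The operator with reduced kernel `κ`, acting on a section `w` of `t⁻¹E`:
`(κ w)(a) = ∫_{G_{s(a)}} κ(a b⁻¹) w(b) dμ_{s(a)}(b)`. -/
def Kernel.apply (κ : 𝒢.Kernel E) (w : ∀ b : G, E (𝒢.t b)) (a : G) : E (𝒢.t a) :=
  ∫ b, (if h : 𝒢.s a = 𝒢.s b then κ.atDiv a b h (w b) else 0) ∂(𝒢.vol g (𝒢.s a))

/-- The `1`-norm `sup_x max (∫_{G_x} |κ(a)| dμ_x, ∫_{G_x} |κ(a⁻¹)| dμ_x)`. -/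
def Kernel.l1Norm (κ : 𝒢.Kernel E) : ℝ≥0∞ :=
  ⨆ x : M, max (∫⁻ a, ‖κ a‖ₑ ∂(𝒢.vol g x)) (∫⁻ a, ‖κ.atInv a‖ₑ ∂(𝒢.vol g x))

end Integration

variable (F : Type v) [NormedAddCommGroup F] [NormedSpace ℂ F]
  [TopologicalSpace (TotalSpace F E)] [FiberBundle F E] [VectorBundle ℂ F E]

/-- `κ` is a smooth section: near every `a₀` its expression in local trivializations of `E`
around `s(a₀)` and `t(a₀)` is a smooth function. -/
def Kernel.Smooth (κ : 𝒢.Kernel E) : Prop :=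
  ∀ a₀ : G, ContMDiffAt (𝓡 (m + n)) 𝓘(ℝ, F →L[ℂ] F) ∞
    (fun a => ContinuousLinearMap.inCoordinates F E F E (𝒢.s a₀) (𝒢.s a) (𝒢.t a₀) (𝒢.t a) (κ a)) a₀

variable (𝒢 E) in
/-- The space `Γ_c^∞(t⁻¹E ⊗ s⁻¹E')` of smooth compactly supported kernels, i.e. of reduced kernels
of elements of `Ψ_μ^{-∞}(G, E)`. -/
def CptKernel : Submodule ℂ (𝒢.Kernel E) where
  carrier := {κ | κ.Smooth F ∧ IsCompact (closure {a | κ a ≠ 0})}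
  zero_mem' := by
    refine ⟨fun a₀ => ?_, by simp⟩
    simp only [ContinuousLinearMap.inCoordinates, Pi.zero_apply, ContinuousLinearMap.zero_comp,
      ContinuousLinearMap.comp_zero]
    exact contMDiffAt_const
  add_mem' := by
    rintro κ₁ κ₂ ⟨h₁, c₁⟩ ⟨h₂, c₂⟩
    refine ⟨fun a₀ => ?_, ?_⟩
    · simp only [ContinuousLinearMap.inCoordinates, Pi.add_apply, ContinuousLinearMap.add_comp,
        ContinuousLinearMap.comp_add]
      exact (h₁ a₀).add (h₂ a₀)
    · refine (c₁.union c₂).of_isClosed_subset isClosed_closure ?_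
      rw [← closure_union]
      refine closure_mono fun a ha => ?_
      by_contra hc
      simp only [mem_union, mem_ofPred_eq, not_or, not_not] at hc
      exact ha (by simp [hc.1, hc.2])
  smul_mem' := by
    rintro z κ ⟨h, c⟩
    refine ⟨fun a₀ => ?_, ?_⟩
    · simp only [ContinuousLinearMap.inCoordinates, Pi.smul_apply, ContinuousLinearMap.smul_comp,
        ContinuousLinearMap.comp_smul]
      exact ((contDiff_const_smul (𝕜 := ℝ) (F := F →L[ℂ] F) (n := ∞) z).contMDiff.contMDiffAt).comp
        a₀ (h a₀)
    · refine c.of_isClosed_subset isClosed_closure (closure_mono fun a ha hz => ha ?_)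
      simp [hz]

end Kernels

/-! ### The groupoid C*-algebra -/

section CStar

variable {m n : ℕ} {G M : Type u}
  [TopologicalSpace G] [ChartedSpace (EuclideanSpace ℝ (Fin (m + n))) G]
  [TopologicalSpace M] [ChartedSpace (EuclideanSpace ℝ (Fin m)) M]
  [IsManifold (𝓡 (m + n)) ∞ G] [MeasurableSpace G]
  (𝒢 : LieGroupoid m n G M) (g : AmbientMetric m n G)
  (F : Type v) [NormedAddCommGroup F] [NormedSpace ℂ F]
  (E : M → Type u) [∀ x, NormedAddCommGroup (E x)] [∀ x, InnerProductSpace ℂ (E x)]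
  [TopologicalSpace (TotalSpace F E)] [FiberBundle F E] [VectorBundle ℂ F E]

/-- A bounded `*`-representation of the convolution algebra `Γ_c^∞(t⁻¹E ⊗ s⁻¹E')` on a Hilbert
space which is contractive for the `1`-norm. -/
structure StarRep where
  /-- the Hilbert space -/
  H : Type u
  [instNACG : NormedAddCommGroup H]
  [instIPS : InnerProductSpace ℂ H]
  [instComplete : CompleteSpace H]
  /-- the representation -/
  rep : CptKernel 𝒢 E F →ₗ[ℂ] (H →L[ℂ] H)
  map_conv : ∀ f₁ f₂ f : CptKernel 𝒢 E F,
    f.1 = Kernel.conv g f₁.1 f₂.1 →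
      rep f = rep f₁ ∘L rep f₂
  map_star : ∀ f κ : CptKernel 𝒢 E F,
    Kernel.IsAdjoint f.1 κ.1 →
      rep f = ContinuousLinearMap.adjoint (rep κ)
  norm_le : ∀ f : CptKernel 𝒢 E F, ‖rep f‖ₑ ≤ Kernel.l1Norm g f.1

attribute [instance] StarRep.instNACG StarRep.instIPS StarRep.instComplete

/-- Families of operators indexed by all representations. -/
abbrev OpFamily := ∀ ρ : StarRep 𝒢 g F E, ρ.H →L[ℂ] ρ.H

variable {𝒢 g F E}

/-- The full norm: the supremum of the operator norms over all representations. -/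
def fullNorm (c : OpFamily 𝒢 g F E) : ℝ≥0∞ := ⨆ ρ, ‖c ρ‖ₑ

variable (𝒢 g F E)

/-- The compactly supported kernel `f` as the family `(ρ(f))_ρ`. Thus `fullNorm (ofCpt f)` is
the full norm `sup_ρ ‖ρ(f)‖` of `f`. -/
def ofCpt (f : CptKernel 𝒢 E F) : OpFamily 𝒢 g F E := fun ρ => ρ.rep f

/-- The groupoid C*-algebra `C*(G, E)`: the completion of `Γ_c^∞(t⁻¹E ⊗ s⁻¹E')` for the full norm,
realized as the norm closure of its image in the product of all representations. -/
def groupoidCStar : Set (OpFamily 𝒢 g F E) :=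
  {c | ∀ η : ℝ≥0∞, 0 < η → ∃ f : CptKernel 𝒢 E F, fullNorm (c - ofCpt 𝒢 g F E f) < η}

variable {𝒢 g F E}

/-- `c` is the class of the kernel `κ`: arbitrarily good approximations of `κ` in the `1`-norm
by smooth compactly supported kernels are good approximations of `c` in the full norm. -/
def IsClassOf (κ : 𝒢.Kernel E) (c : OpFamily 𝒢 g F E) : Prop :=
  ∀ η : ℝ≥0∞, 0 < η → ∃ f : CptKernel 𝒢 E F,
    Kernel.l1Norm g (κ - f.1) < η ∧ fullNorm (c - ofCpt 𝒢 g F E f) < η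

/-- In each regular representation, on the `L²`-sections of `t⁻¹E` over `G_x`, the element `c`
acts as the operator with reduced kernel `κ`: if `f` tends to `c` in the full norm then
`f w → κ w` in `L²(G_x, t⁻¹E)`, for all smooth compactly supported sections `w` of `t⁻¹E`. -/
def ActsBy (c : OpFamily 𝒢 g F E) (κ : 𝒢.Kernel E) : Prop :=
  ∀ (x : M) (w : ∀ b : G, E (𝒢.t b)),
    ContMDiff (𝓡 (m + n)) ((𝓡 m).prod 𝓘(ℝ, F)) ∞
      (fun b => (⟨𝒢.t b, w b⟩ : TotalSpace F E)) →
    IsCompact (closure {b | w b ≠ 0}) →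
    ∀ η : ℝ≥0∞, 0 < η → ∃ δ : ℝ≥0∞, 0 < δ ∧ ∀ f : CptKernel 𝒢 E F,
      fullNorm (c - ofCpt 𝒢 g F E f) < δ →
        ∫⁻ a, ‖Kernel.apply g f.1 w a - Kernel.apply g κ w a‖ₑ ^ 2 ∂(𝒢.vol g x) < η

end CStar

/-! ### Exponentially decaying kernels -/

section Decay

variable {m n : ℕ} {G M : Type u}
  [TopologicalSpace G] [ChartedSpace (EuclideanSpace ℝ (Fin (m + n))) G]
  [TopologicalSpace M] [ChartedSpace (EuclideanSpace ℝ (Fin m)) M]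
  [IsManifold (𝓡 (m + n)) ∞ G]
  (𝒢 : LieGroupoid m n G M) (g : AmbientMetric m n G)
  (F : Type v) [NormedAddCommGroup F] [NormedSpace ℂ F]
  (E : M → Type u) [∀ x, NormedAddCommGroup (E x)] [∀ x, InnerProductSpace ℂ (E x)]
  [TopologicalSpace (TotalSpace F E)] [FiberBundle F E]

variable {E} in
/-- A (not necessarily continuous) section of `E` is smooth near `p`. -/
def SmoothSecAt (m : ℕ) [ChartedSpace (EuclideanSpace ℝ (Fin m)) M] (σ : ∀ q : M, E q) (p : M) : Prop :=
  ContMDiffAt (𝓡 m) ((𝓡 m).prod 𝓘(ℝ, F)) ∞ (fun q => TotalSpace.mk' F q (σ q)) p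

/-- The Hermitian inner products on the fibres of `E` depend smoothly on the base point. -/
def SmoothHermitian (m : ℕ) [ChartedSpace (EuclideanSpace ℝ (Fin m)) M] : Prop :=
  ∀ (σ τ : ∀ q : M, E q) (p : M), SmoothSecAt F m σ p → SmoothSecAt F m τ p →
    ContMDiffAt (𝓡 m) 𝓘(ℝ, ℂ) ∞ (fun q => (inner ℂ (σ q) (τ q) : ℂ)) p

/-- A smooth `A`-connection on `E`, given as an operator on germs of smooth sections:
`nabla σ p v` is `(∇_X σ)(p)` for `X(p) = v`. Only `v ∈ A_p` and sections smooth near `p` matter. -/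
structure AlgConnection where
  /-- the covariant derivative -/
  nabla : (∀ q : M, E q) → ∀ p : M, TangentSpace (𝓡 (m + n)) (𝒢.unit p) → E p
  map_add_vec : ∀ σ p, SmoothSecAt F m σ p → ∀ v w,
    mfderiv (𝓡 (m + n)) (𝓡 m) 𝒢.s (𝒢.unit p) v = 0 →
    mfderiv (𝓡 (m + n)) (𝓡 m) 𝒢.s (𝒢.unit p) w = 0 →
    nabla σ p (v + w) = nabla σ p v + nabla σ p w
  map_smul_vec : ∀ σ p, SmoothSecAt F m σ p → ∀ (r : ℝ) (v),
    mfderiv (𝓡 (m + n)) (𝓡 m) 𝒢.s (𝒢.unit p) v = 0 → nabla σ p (r • v) = r • nabla σ p v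
  map_add : ∀ σ₁ σ₂ p, SmoothSecAt F m σ₁ p → SmoothSecAt F m σ₂ p → ∀ v,
    mfderiv (𝓡 (m + n)) (𝓡 m) 𝒢.s (𝒢.unit p) v = 0 →
    nabla (σ₁ + σ₂) p v = nabla σ₁ p v + nabla σ₂ p v
  leibniz : ∀ (f : M → ℂ) σ p, ContMDiffAt (𝓡 m) 𝓘(ℝ, ℂ) ∞ f p → SmoothSecAt F m σ p → ∀ v,
    mfderiv (𝓡 (m + n)) (𝓡 m) 𝒢.s (𝒢.unit p) v = 0 →
    nabla (fun q => f q • σ q) p v = f p • nabla σ p v +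
      (show ℂ from mfderiv (𝓡 m) 𝓘(ℝ, ℂ) f p
        (show TangentSpace (𝓡 m) p from mfderiv (𝓡 (m + n)) (𝓡 m) 𝒢.t (𝒢.unit p) v)) • σ p
  smooth : ∀ (X : 𝒢.AlgSection) σ p, SmoothSecAt F m σ p →
    SmoothSecAt F m (fun q => nabla σ q (X.toFun q)) p

/-- Two-point kernels: the value at `(a, b)` is a map `E_{t(b)} → E_{t(a)}`. Only the pairs with
`s(a) = s(b)`, that is, the points of `G̃`, matter. -/
abbrev TwoPoint := ∀ a b : G, E (𝒢.t b) → E (𝒢.t a)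

variable {𝒢 E}

open Classical in
/-- The pull-back `(a, b) ↦ κ(a b⁻¹)` of a kernel to `G̃`. -/
def Kernel.lift (κ : 𝒢.Kernel E) : 𝒢.TwoPoint E := fun a b v =>
  if h : 𝒢.s a = 𝒢.s b then κ.atDiv a b h v else 0

variable {F} [VectorBundle ℂ F E] (D : AlgConnection 𝒢 F E)

/-- Covariant derivative of a two-point kernel along `(X^R, 0)`, for the connection on
`t⁻¹E → G_x` which is right invariant and satisfies `∇_{X^R}(t⁻¹σ) = t⁻¹(∇_X σ)`.
With `K(·, b) v = ∑ᵢ kᵢ t⁻¹eᵢ` in a local frame it is `∑ᵢ (X^R kᵢ) t⁻¹eᵢ + kᵢ t⁻¹(∇_X eᵢ)`; here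
`(X^R k)(a)` is the derivative of `c ↦ k(c a)` along `X(t(a))` at the unit over `t(a)`. -/
def AlgConnection.derivR (X : 𝒢.AlgSection) (K : 𝒢.TwoPoint E) : 𝒢.TwoPoint E := fun a b v =>
  let e := trivializationAt F E (𝒢.t a)
  e.symmL ℂ (𝒢.t a)
    (mfderivWithin (𝓡 (m + n)) 𝓘(ℝ, F)
      (fun c => e.continuousLinearMapAt ℂ (𝒢.t (𝒢.mul c a)) (K (𝒢.mul c a) b v))
      (𝒢.fiber (𝒢.t a)) (𝒢.unit (𝒢.t a)) (X.toFun (𝒢.t a)) : F) +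
  D.nabla (fun q => e.symmL ℂ q (e.continuousLinearMapAt ℂ (𝒢.t a) (K a b v)))
    (𝒢.t a) (X.toFun (𝒢.t a))

/-- Covariant derivative of a two-point kernel along `(0, X^R)`, for the dual connection in the
second variable: `(∇K) e = X^R(K e) - K (∇_X e)`, with `e` a local section of `t⁻¹E` through `v`
which is constant in a local trivialization of `E`. -/
def AlgConnection.derivL (X : 𝒢.AlgSection) (K : 𝒢.TwoPoint E) : 𝒢.TwoPoint E := fun a b v =>
  let e := trivializationAt F E (𝒢.t b)
  let v₀ : F := e.continuousLinearMapAt ℂ (𝒢.t b) v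
  let w : E (𝒢.t a) := mfderivWithin (𝓡 (m + n)) 𝓘(ℝ, E (𝒢.t a))
    (fun c => K a (𝒢.mul c b) (e.symmL ℂ (𝒢.t (𝒢.mul c b)) v₀))
    (𝒢.fiber (𝒢.t b)) (𝒢.unit (𝒢.t b)) (X.toFun (𝒢.t b))
  w - K a b (D.nabla (fun q => e.symmL ℂ q v₀) (𝒢.t b) (X.toFun (𝒢.t b)))

/-- Iterated covariant derivatives along `(X₁, i₁), …, (X_k, i_k)`, where `iⱼ` tells whether the
`j`-th derivative is taken in the first (`true`) or in the second (`false`) variable. -/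
def AlgConnection.iterDeriv :
    List (𝒢.AlgSection × Bool) → 𝒢.TwoPoint E → 𝒢.TwoPoint E
  | [], K => K
  | (X, true) :: l, K => D.derivR X (AlgConnection.iterDeriv l K)
  | (X, false) :: l, K => D.derivL X (AlgConnection.iterDeriv l K)

/-- The `ε`-calculus `Ψ_ε^{-∞}(G, E)` of order `-∞`, as a set of reduced kernels: smooth kernels `κ`
such that, for some `ε' > ε`, all covariant derivatives of `(a, b) ↦ κ(a b⁻¹)` on `G̃` are
`O(exp(-ε' d(a, b)))`. -/
def PsiEps (ε : ℝ) : Set (𝒢.Kernel E) :=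
  {κ | κ.Smooth F ∧ ∃ ε' : ℝ, ε < ε' ∧ ∀ l : List (𝒢.AlgSection × Bool), ∃ C : ℝ,
    ∀ a b : G, 𝒢.s a = 𝒢.s b → ∀ v : E (𝒢.t b),
      Real.exp (ε' * 𝒢.fiberDist g a b) * ‖D.iterDeriv l (Kernel.lift κ) a b v‖ ≤ C * ‖v‖}

end Decay

end LieGroupoid

end

/-! A kernel κ in the ε-calculus decays like exp(-δ d) with some δ > ε > 0, and sub-exponential
growth makes such kernels approximable in the 1-norm by compactly supported ones. Every admissible
representation is contractive for the 1-norm, so the approximations converge in every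
representation. The limits form the class of κ.

Approximation (`Kernel.DecayBound.exists_l1Norm_sub_lt`). Taking a or b to be a unit in the bound on
κ(ab⁻¹) gives decay of κ(a) and κ(a⁻¹) in the distance of a from the unit of its fibre. Multiply κ
by a bump function equal to 1 on the ball of radius R. The remainder is at most C exp(-δR/2)
exp(-δd/2); the last factor has uniformly bounded integrals, so the 1-norm of the remainder tends to
0 as R grows.

This needs balls around the units to be relatively compact (`exists_isCompact_ball`). Take a
compactly supported function h equal to 1 on the compact set of units; its fibrewise gradient is
bounded. A curve leaving a unit needs a definite length before h drops to 1/2. At that moment, right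
translation brings the current point back to a unit without changing lengths, and the argument
restarts. A point at distance less than R is thus a product of boundedly many elements of supp h. It
also needs the distance to be finite and locally bounded (`unitJoined`): points nearby in a chart
are joined with bounded speed, and a clopen argument spreads this over each connected fibre.

Completion (`exists_opFamily_fullNorm_sub_le`). If fₖ tends to κ in the 1-norm, then ρ(fₖ) is Cauchy
for every ρ, and its limit c(ρ) satisfies ‖c(ρ) - ρ(f)‖ ≤ ‖κ - f‖₁ for every compactly supported f,
uniformly in ρ. This gives membership in the C*-algebra and the first property of J.

Regular representations. Volumes are right invariant (`map_qdiv_vol`), so the two integrals in the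
1-norm are the column and row bounds of the kernel κ(ab⁻¹) on each fibre (`isSchurKernel`). The
Schur test makes it a bounded operator on L², with norm at most ‖κ‖₁, and Fubini makes this a
*-representation on compactly supported kernels. A measurable orthonormal frame of E identifies
sections with vector-valued functions. Since κ is itself a 1-norm limit, its class acts by the
operator with kernel κ (`eq_regOp_of_fullNorm_sub_le`), which gives the second property.

Injectivity (`eq_zero_of_regOp_eq_zero`). The regular representations already see κ: if κ(a₀) ≠ 0,
the operator applied to a section concentrated near the unit over s(a₀) is nonzero near a₀, because
κ is continuous and open sets meeting a fibre have positive volume. -/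

noncomputable section

namespace LieGroupoid

/-! ### Groupoid algebra. -/

section Basic

variable {m n : ℕ} {G M : Type u}
  [TopologicalSpace G] [ChartedSpace (EuclideanSpace ℝ (Fin (m + n))) G]
  [TopologicalSpace M] [ChartedSpace (EuclideanSpace ℝ (Fin m)) M]
  (𝒢 : LieGroupoid m n G M)

lemma continuous_s : Continuous 𝒢.s := 𝒢.smooth_s.continuous

lemma continuous_t : Continuous 𝒢.t := 𝒢.smooth_t.continuous

lemma continuous_unit : Continuous 𝒢.unit := 𝒢.smooth_unit.continuous

lemma continuous_inv : Continuous 𝒢.inv := 𝒢.smooth_inv.continuous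

lemma continuousOn_mul :
    ContinuousOn (fun p : G × G => 𝒢.mul p.1 p.2) {p | 𝒢.s p.1 = 𝒢.t p.2} :=
  𝒢.smooth_mul.continuousOn

variable {𝒢}

lemma mul_mul_inv {a b : G} (h : 𝒢.s a = 𝒢.t b) : 𝒢.mul (𝒢.mul a b) (𝒢.inv b) = a := by
  rw [𝒢.mul_assoc _ _ _ h (𝒢.t_inv b).symm, 𝒢.mul_inv, ← h, 𝒢.mul_unit]

lemma mul_inv_mul {a b : G} (h : 𝒢.s a = 𝒢.s b) : 𝒢.mul (𝒢.mul a (𝒢.inv b)) b = a := by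
  rw [𝒢.mul_assoc _ _ _ (h.trans (𝒢.t_inv b).symm) (𝒢.s_inv b), 𝒢.inv_mul, ← h, 𝒢.mul_unit]

lemma eq_inv_of_mul_eq_unit {a b : G} (h : 𝒢.s a = 𝒢.t b) (hab : 𝒢.mul a b = 𝒢.unit (𝒢.t a)) :
    b = 𝒢.inv a := by
  have h1 := 𝒢.mul_assoc (𝒢.inv a) a b (𝒢.s_inv a) h
  have hs : 𝒢.s (𝒢.inv a) = 𝒢.t a := 𝒢.s_inv a
  rw [𝒢.inv_mul, hab, h, 𝒢.unit_mul, ← hs, 𝒢.mul_unit] at h1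
  exact h1

lemma inv_inv (a : G) : 𝒢.inv (𝒢.inv a) = a :=
  (eq_inv_of_mul_eq_unit (𝒢.s_inv a) (by rw [𝒢.inv_mul, 𝒢.t_inv])).symm

lemma inv_unit (x : M) : 𝒢.inv (𝒢.unit x) = 𝒢.unit x := by
  refine (eq_inv_of_mul_eq_unit (by rw [𝒢.s_unit, 𝒢.t_unit]) ?_).symm
  have := 𝒢.mul_unit (𝒢.unit x)
  rw [𝒢.s_unit] at this
  rw [this, 𝒢.t_unit]

lemma inv_mul_rev {a b : G} (h : 𝒢.s a = 𝒢.t b) :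
    𝒢.inv (𝒢.mul a b) = 𝒢.mul (𝒢.inv b) (𝒢.inv a) := by
  have h1 : 𝒢.s (𝒢.mul a b) = 𝒢.t (𝒢.inv b) := by rw [𝒢.s_mul _ _ h, 𝒢.t_inv]
  have h2 : 𝒢.s (𝒢.inv b) = 𝒢.t (𝒢.inv a) := by rw [𝒢.s_inv, 𝒢.t_inv, h]
  refine (eq_inv_of_mul_eq_unit (by rw [𝒢.t_mul _ _ h2, h1]) ?_).symm
  rw [← 𝒢.mul_assoc _ _ _ h1 h2, mul_mul_inv h, 𝒢.mul_inv, 𝒢.t_mul _ _ h]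

lemma s_div {a b : G} (h : 𝒢.s a = 𝒢.s b) : 𝒢.s (𝒢.mul a (𝒢.inv b)) = 𝒢.t b :=
  (𝒢.s_mul _ _ (h.trans (𝒢.t_inv b).symm)).trans (𝒢.s_inv b)

lemma t_div {a b : G} (h : 𝒢.s a = 𝒢.s b) : 𝒢.t (𝒢.mul a (𝒢.inv b)) = 𝒢.t a :=
  𝒢.t_mul _ _ (h.trans (𝒢.t_inv b).symm)

lemma inv_div {a b : G} (h : 𝒢.s a = 𝒢.s b) :
    𝒢.inv (𝒢.mul a (𝒢.inv b)) = 𝒢.mul b (𝒢.inv a) := by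
  rw [inv_mul_rev (h.trans (𝒢.t_inv b).symm), inv_inv]

lemma div_mul_div {a b c : G} (h : 𝒢.s a = 𝒢.s b) (h' : 𝒢.s b = 𝒢.s c) :
    𝒢.mul (𝒢.mul a (𝒢.inv b)) (𝒢.mul b (𝒢.inv c)) = 𝒢.mul a (𝒢.inv c) := by
  rw [← 𝒢.mul_assoc _ b _ (s_div h) (h'.trans (𝒢.t_inv c).symm), mul_inv_mul h]

lemma div_unit (a : G) : 𝒢.mul a (𝒢.inv (𝒢.unit (𝒢.s a))) = a := by
  rw [inv_unit, 𝒢.mul_unit]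

/-- Right translation cancels in quotients. -/
lemma mul_div_mul {a b c : G} (h : 𝒢.s a = 𝒢.t c) (h' : 𝒢.s b = 𝒢.t c) :
    𝒢.mul (𝒢.mul a c) (𝒢.inv (𝒢.mul b c)) = 𝒢.mul a (𝒢.inv b) := by
  have h2 : 𝒢.s (𝒢.inv c) = 𝒢.t (𝒢.inv b) := by rw [𝒢.s_inv, 𝒢.t_inv, h']
  rw [inv_mul_rev h', ← 𝒢.mul_assoc _ _ _ (by rw [𝒢.s_mul _ _ h, 𝒢.t_inv]) h2, mul_mul_inv h]

variable (𝒢)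

lemma isClosed_fiber [T2Space M] (x : M) : IsClosed (𝒢.fiber x) :=
  isClosed_eq 𝒢.continuous_s continuous_const

lemma isClosed_composable [T2Space M] : IsClosed {p : G × G | 𝒢.s p.1 = 𝒢.t p.2} :=
  isClosed_eq (𝒢.continuous_s.comp continuous_fst) (𝒢.continuous_t.comp continuous_snd)

/-- Right translation by `b` is smooth on the fibre over `t(b)`. -/
lemma contMDiffOn_mul_right (b : G) :
    ContMDiffOn (𝓡 (m + n)) (𝓡 (m + n)) ∞ (fun c => 𝒢.mul c b) (𝒢.fiber (𝒢.t b)) :=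
  𝒢.smooth_mul.comp (t := {p | 𝒢.s p.1 = 𝒢.t p.2})
    (contMDiff_id.prodMk contMDiff_const).contMDiffOn (fun _ hc => hc)

end Basic

/-! ### Charts in which the source map is a projection. -/

section Box

variable {m n : ℕ} {G M : Type u}
  [TopologicalSpace G] [ChartedSpace (EuclideanSpace ℝ (Fin (m + n))) G]
  [TopologicalSpace M] [ChartedSpace (EuclideanSpace ℝ (Fin m)) M]
  (𝒢 : LieGroupoid m n G M)

/-- A chart of `G` around `a₀` with values in `ℝᵐ × ℝⁿ` in which the source map is the first
projection. -/
structure SourceBox (a₀ : G) where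
  /-- the chart -/
  e : OpenPartialHomeomorph G (EuclideanSpace ℝ (Fin m) × EuclideanSpace ℝ (Fin n))
  mem : a₀ ∈ e.source
  smooth : ContMDiffOn (𝓡 (m + n)) 𝓘(ℝ, EuclideanSpace ℝ (Fin m) × EuclideanSpace ℝ (Fin n)) ∞
    e e.source
  smooth_symm : ContMDiffOn 𝓘(ℝ, EuclideanSpace ℝ (Fin m) × EuclideanSpace ℝ (Fin n))
    (𝓡 (m + n)) ∞ e.symm e.target
  s_mem : ∀ a ∈ e.source, 𝒢.s a ∈ (chartAt (EuclideanSpace ℝ (Fin m)) (𝒢.s a₀)).source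
  fst_eq : ∀ a ∈ e.source, (e a).1 = chartAt (EuclideanSpace ℝ (Fin m)) (𝒢.s a₀) (𝒢.s a)

/-- Provides the linear completion needed by the inverse function theorem. `P` projects onto the
kernel of `L` and identifies the kernel with ℝᵏ by rank-nullity; the pair is injective between
spaces of equal dimension. -/
lemma exists_linear_complement {k : ℕ}
    (L : EuclideanSpace ℝ (Fin (m + k)) →L[ℝ] EuclideanSpace ℝ (Fin m))
    (hL : Function.Surjective L) :
    ∃ (P : EuclideanSpace ℝ (Fin (m + k)) →L[ℝ] EuclideanSpace ℝ (Fin k))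
      (Q : EuclideanSpace ℝ (Fin (m + k)) ≃L[ℝ]
        EuclideanSpace ℝ (Fin m) × EuclideanSpace ℝ (Fin k)), (Q : _ →L[ℝ] _) = L.prod P := by
  set K := LinearMap.ker (L : EuclideanSpace ℝ (Fin (m + k)) →ₗ[ℝ] EuclideanSpace ℝ (Fin m))
    with hK
  have hrange : LinearMap.range
      (L : EuclideanSpace ℝ (Fin (m + k)) →ₗ[ℝ] EuclideanSpace ℝ (Fin m)) = ⊤ :=
    LinearMap.range_eq_top.2 hL
  have hdim : Module.finrank ℝ K = Module.finrank ℝ (EuclideanSpace ℝ (Fin k)) := by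
    have h := LinearMap.finrank_range_add_finrank_ker
      (L : EuclideanSpace ℝ (Fin (m + k)) →ₗ[ℝ] EuclideanSpace ℝ (Fin m))
    rw [hrange, finrank_top, ← hK, finrank_euclideanSpace_fin, finrank_euclideanSpace_fin] at h
    rw [finrank_euclideanSpace_fin]
    exact Nat.add_left_cancel h
  obtain ⟨p, hp⟩ := LinearMap.exists_leftInverse_of_injective K.subtype K.ker_subtype
  let ι : K ≃ₗ[ℝ] EuclideanSpace ℝ (Fin k) := LinearEquiv.ofFinrankEq _ _ hdim
  let P : EuclideanSpace ℝ (Fin (m + k)) →L[ℝ] EuclideanSpace ℝ (Fin k) :=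
    LinearMap.toContinuousLinearMap (ι.toLinearMap ∘ₗ p)
  have hinj : Function.Injective ((L.prod P : _ →L[ℝ] _) : EuclideanSpace ℝ (Fin (m + k)) →ₗ[ℝ]
      EuclideanSpace ℝ (Fin m) × EuclideanSpace ℝ (Fin k)) := by
    rw [injective_iff_map_eq_zero]
    intro w hw
    have h1 : L w = 0 := congrArg Prod.fst hw
    have h2 : ι (p w) = 0 := congrArg Prod.snd hw
    have h3 : p w = 0 := by simpa using h2
    have h4 : p (K.subtype ⟨w, h1⟩) = ⟨w, h1⟩ := LinearMap.congr_fun hp ⟨w, h1⟩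
    have h5 : (⟨w, h1⟩ : K) = 0 := h4.symm.trans h3
    exact congrArg Subtype.val h5
  refine ⟨P, (LinearEquiv.ofInjectiveOfFinrankEq _ hinj (by simp)).toContinuousLinearEquiv, ?_⟩
  ext w <;> rfl

variable [IsManifold (𝓡 (m + n)) ∞ G] [IsManifold (𝓡 m) ∞ M]

/-- The normal form of a submersion: complete `s`, read in charts, by linear coordinates on the
kernel of its derivative, and apply the inverse function theorem. -/
theorem nonempty_sourceBox (a₀ : G) : Nonempty (𝒢.SourceBox a₀) := by
  set φ := chartAt (EuclideanSpace ℝ (Fin (m + n))) a₀ with hφ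
  set ξ := chartAt (EuclideanSpace ℝ (Fin m)) (𝒢.s a₀) with hξ
  set S : EuclideanSpace ℝ (Fin (m + n)) → EuclideanSpace ℝ (Fin m) :=
    fun y => ξ (𝒢.s (φ.symm y)) with hS
  set O : Set (EuclideanSpace ℝ (Fin (m + n))) := φ.target ∩ φ.symm ⁻¹' (𝒢.s ⁻¹' ξ.source) with hO
  have hOo : IsOpen O :=
    φ.isOpen_inter_preimage_symm (ξ.open_source.preimage 𝒢.continuous_s)
  have hSs : ContDiffOn ℝ ∞ S O := by
    rw [← contMDiffOn_iff_contDiffOn]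
    refine (contMDiffOn_chart (I := 𝓡 m) (n := ∞) (x := 𝒢.s a₀)).comp ?_ (fun y hy => hy.2)
    exact (𝒢.smooth_s.contMDiffOn (s := univ)).comp
      ((contMDiffOn_chart_symm (I := 𝓡 (m + n)) (n := ∞) (x := a₀)).mono inter_subset_left)
      (fun _ _ => mem_univ _)
  have hy₀ : φ a₀ ∈ O := by
    refine ⟨φ.map_source (mem_chart_source _ _), ?_⟩
    simp only [mem_preimage]
    rw [φ.left_inv (mem_chart_source _ _)]
    exact mem_chart_source _ _
  have hsurj : Function.Surjective (fderiv ℝ S (φ a₀)) := by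
    have h := 𝒢.submersion_s a₀
    have h1 : mfderiv (𝓡 (m + n)) (𝓡 m) 𝒢.s a₀ = fderiv ℝ S (φ a₀) := by
      have h2 : fderivWithin ℝ S (range (𝓡 (m + n))) (φ a₀) = fderiv ℝ S (φ a₀) := by
        rw [ModelWithCorners.range_eq_univ, fderivWithin_univ]
      exact ((𝒢.smooth_s a₀).mdifferentiableAt (by simp)).mfderiv.trans h2
    rwa [h1] at h
  obtain ⟨P, Q, hQ⟩ := exists_linear_complement _ hsurj
  set Φ : EuclideanSpace ℝ (Fin (m + n)) → EuclideanSpace ℝ (Fin m) × EuclideanSpace ℝ (Fin n) :=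
    fun y => (S y, P y) with hΦ
  have hΦs : ContDiffOn ℝ ∞ Φ O := hSs.prodMk P.contDiff.contDiffOn
  have hd : ∀ y ∈ O, HasFDerivAt Φ (fderiv ℝ Φ y) y := fun y hy =>
    ((hΦs.contDiffAt (hOo.mem_nhds hy)).differentiableAt (by simp)).hasFDerivAt
  have hd₀ : HasFDerivAt Φ (Q : _ →L[ℝ] _) (φ a₀) := by
    rw [hQ]
    exact (((hSs.contDiffAt (hOo.mem_nhds hy₀)).differentiableAt (by simp)).hasFDerivAt).prodMk
      P.hasFDerivAt
  have hc : ContinuousOn (fderiv ℝ Φ) O := hΦs.continuousOn_fderiv_of_isOpen hOo (by simp)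
  -- Shrinking to points where the derivative is invertible makes the local inverse smooth on its
  -- whole domain and not only at the image of the centre.
  set O' : Set (EuclideanSpace ℝ (Fin (m + n))) := O ∩ fderiv ℝ Φ ⁻¹'
    (range ((↑) : (EuclideanSpace ℝ (Fin (m + n)) ≃L[ℝ]
      EuclideanSpace ℝ (Fin m) × EuclideanSpace ℝ (Fin n)) → _ →L[ℝ] _)) with hO'
  have hO'o : IsOpen O' := hc.isOpen_inter_preimage hOo (ContinuousLinearEquiv.isOpen)
  have hy₀' : φ a₀ ∈ O' := ⟨hy₀, Q, hd₀.fderiv.symm⟩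
  set e₀ := (hΦs.contDiffAt (hOo.mem_nhds hy₀)).toOpenPartialHomeomorph Φ hd₀ (by simp) with he₀
  have he₀c : ∀ y, e₀ y = Φ y := fun y => rfl
  have hmem₀ : φ a₀ ∈ e₀.source := ContDiffAt.mem_toOpenPartialHomeomorph_source _ _ _
  set e₁ := e₀.restrOpen O' hO'o with he₁
  have hsrc₁ : e₁.source = e₀.source ∩ O' := e₀.restrOpen_source O' hO'o
  have hsym : ContDiffOn ℝ ∞ e₁.symm e₁.target := by
    intro z hz
    have hz' : e₁.symm z ∈ O' := (hsrc₁ ▸ e₁.map_target hz).2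
    obtain ⟨A, hA⟩ := hz'.2
    refine (e₁.contDiffAt_symm (f₀' := A) hz ?_ ?_).contDiffWithinAt
    · rw [hA]; exact hd _ hz'.1
    · exact hΦs.contDiffAt (hOo.mem_nhds hz'.1)
  refine ⟨⟨φ.trans e₁, ?_, ?_, ?_, ?_, ?_⟩⟩
  · rw [OpenPartialHomeomorph.trans_source]
    exact ⟨mem_chart_source _ _, by rw [mem_preimage, hsrc₁]; exact ⟨hmem₀, hy₀'⟩⟩
  · rw [OpenPartialHomeomorph.trans_source]
    have h1 : ContMDiffOn (𝓡 (m + n))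
        𝓘(ℝ, EuclideanSpace ℝ (Fin m) × EuclideanSpace ℝ (Fin n)) ∞ Φ O := hΦs.contMDiffOn
    refine h1.comp ((contMDiffOn_chart (I := 𝓡 (m + n)) (n := ∞) (x := a₀)).mono
      inter_subset_left) ?_
    rintro a ⟨_, ha⟩
    rw [mem_preimage, hsrc₁] at ha
    exact ha.2.1
  · have h1 : ContMDiffOn 𝓘(ℝ, EuclideanSpace ℝ (Fin m) × EuclideanSpace ℝ (Fin n))
        (𝓡 (m + n)) ∞ e₁.symm e₁.target := hsym.contMDiffOn
    refine ((contMDiffOn_chart_symm (I := 𝓡 (m + n)) (n := ∞) (x := a₀))).comp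
      (h1.mono ?_) ?_
    · rw [OpenPartialHomeomorph.trans_target]; exact inter_subset_left
    · rw [OpenPartialHomeomorph.trans_target]; exact inter_subset_right
  · intro a ha
    rw [OpenPartialHomeomorph.trans_source] at ha
    have h2 : φ a ∈ O := (hsrc₁ ▸ ha.2 : φ a ∈ e₀.source ∩ O').2.1
    have h3 := h2.2
    simp only [mem_preimage] at h3
    rwa [φ.left_inv ha.1] at h3
  · intro a ha
    rw [OpenPartialHomeomorph.trans_source] at ha
    change ξ (𝒢.s (φ.symm (φ a))) = _
    rw [φ.left_inv ha.1]

end Box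

/-! ### The right invariant metric on the fibres. -/

section FibreMetric

variable {m n : ℕ} {G M : Type u}
  [TopologicalSpace G] [ChartedSpace (EuclideanSpace ℝ (Fin (m + n))) G]
  [TopologicalSpace M] [ChartedSpace (EuclideanSpace ℝ (Fin m)) M]
  {𝒢 : LieGroupoid m n G M}

lemma mdifferentiableWithinAt_mul_right {a b : G} (h : 𝒢.s a = 𝒢.t b) :
    MDifferentiableWithinAt (𝓡 (m + n)) (𝓡 (m + n)) (fun c => 𝒢.mul c b) (𝒢.fiber (𝒢.s a)) a := by
  rw [h]
  exact (𝒢.contMDiffOn_mul_right b a h).mdifferentiableWithinAt (by simp)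

section Along

variable {V : Type*} [NormedAddCommGroup V] [NormedSpace ℝ V] {ψ : V → G} {S : Set V} {y : V}
  {x : M}

/-- `toAlg` of a velocity vector of a map `ψ` into a fibre is the velocity of `ψ ψ(y)⁻¹`. -/
lemma mfderivWithin_div (hψ : MDifferentiableWithinAt 𝓘(ℝ, V) (𝓡 (m + n)) ψ S y)
    (hS : ∀ z ∈ S, 𝒢.s (ψ z) = x) (hy : y ∈ S) (hu : UniqueDiffWithinAt ℝ S y) (δ : V) :
    mfderivWithin 𝓘(ℝ, V) (𝓡 (m + n)) (fun z => 𝒢.mul (ψ z) (𝒢.inv (ψ y))) S y δ =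
      𝒢.toAlg (ψ y) (mfderivWithin 𝓘(ℝ, V) (𝓡 (m + n)) ψ S y δ) := by
  have h := mfderivWithin_comp (I := 𝓘(ℝ, V)) (I' := 𝓡 (m + n)) (I'' := 𝓡 (m + n)) y
    (g := fun c => 𝒢.mul c (𝒢.inv (ψ y))) (u := 𝒢.fiber (𝒢.s (ψ y)))
    (mdifferentiableWithinAt_mul_right (𝒢.t_inv (ψ y)).symm) hψ
    (fun z hz => (hS z hz).trans (hS y hy).symm) hu.uniqueMDiffWithinAt
  exact DFunLike.congr_fun h δ

/-- `toAlg` is injective on velocity vectors of maps into fibres. -/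
lemma eq_zero_of_toAlg_eq_zero (hψ : MDifferentiableWithinAt 𝓘(ℝ, V) (𝓡 (m + n)) ψ S y)
    (hS : ∀ z ∈ S, 𝒢.s (ψ z) = x) (hy : y ∈ S) (hu : UniqueDiffWithinAt ℝ S y) {δ : V}
    (h0 : 𝒢.toAlg (ψ y) (mfderivWithin 𝓘(ℝ, V) (𝓡 (m + n)) ψ S y δ) = 0) :
    mfderivWithin 𝓘(ℝ, V) (𝓡 (m + n)) ψ S y δ = 0 := by
  have hs : ∀ z ∈ S, 𝒢.s (ψ z) = 𝒢.s (ψ y) := fun z hz => (hS z hz).trans (hS y hy).symm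
  have hcomp : 𝒢.s (𝒢.mul (ψ y) (𝒢.inv (ψ y))) = 𝒢.t (ψ y) := s_div rfl
  have hdiv : MDifferentiableWithinAt 𝓘(ℝ, V) (𝓡 (m + n))
      (fun z => 𝒢.mul (ψ z) (𝒢.inv (ψ y))) S y :=
    MDifferentiableWithinAt.comp y (u := 𝒢.fiber (𝒢.s (ψ y)))
      (g := fun c => 𝒢.mul c (𝒢.inv (ψ y)))
      (mdifferentiableWithinAt_mul_right (𝒢.t_inv (ψ y)).symm) hψ hs
  -- Translating back by `ψ y` recovers `ψ`, so its derivative factors through the vector that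
  -- `toAlg` produces.
  have h := mfderivWithin_comp (I := 𝓘(ℝ, V)) (I' := 𝓡 (m + n)) (I'' := 𝓡 (m + n)) y
    (g := fun c => 𝒢.mul c (ψ y)) (u := 𝒢.fiber (𝒢.s (𝒢.mul (ψ y) (𝒢.inv (ψ y)))))
    (f := fun z => 𝒢.mul (ψ z) (𝒢.inv (ψ y)))
    (mdifferentiableWithinAt_mul_right hcomp) hdiv
    (fun z hz => (s_div (hs z hz)).trans hcomp.symm) hu.uniqueMDiffWithinAt
  have h2 := DFunLike.congr_fun h δ
  have h3 : mfderivWithin 𝓘(ℝ, V) (𝓡 (m + n))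
      (fun z => 𝒢.mul (𝒢.mul (ψ z) (𝒢.inv (ψ y))) (ψ y)) S y =
      mfderivWithin 𝓘(ℝ, V) (𝓡 (m + n)) ψ S y :=
    mfderivWithin_congr_of_mem (fun z hz => mul_inv_mul (hs z hz)) hy
  have h4 := DFunLike.congr_fun h3 δ
  refine h4.symm.trans (h2.trans ?_)
  have h5 := (mfderivWithin_div hψ hS hy hu δ).trans h0
  refine Eq.trans (congrArg (mfderivWithin (𝓡 (m + n)) (𝓡 (m + n)) (fun c => 𝒢.mul c (ψ y))
    (𝒢.fiber (𝒢.s (𝒢.mul (ψ y) (𝒢.inv (ψ y))))) (𝒢.mul (ψ y) (𝒢.inv (ψ y)))) h5) ?_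
  exact map_zero _

variable [IsManifold (𝓡 (m + n)) ∞ G] (g : AmbientMetric m n G)

/-- Moves the metric to a unit. Right invariance then becomes an identity between maps, namely
(ψ(z)b)(ψ(y)b)⁻¹ = ψ(z)ψ(y)⁻¹. -/
lemma gS_eq_inner_div (hψ : MDifferentiableWithinAt 𝓘(ℝ, V) (𝓡 (m + n)) ψ S y)
    (hS : ∀ z ∈ S, 𝒢.s (ψ z) = x) (hy : y ∈ S) (hu : UniqueDiffWithinAt ℝ S y) (δ δ' : V) :
    𝒢.gS g (ψ y) (mfderivWithin 𝓘(ℝ, V) (𝓡 (m + n)) ψ S y δ)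
      (mfderivWithin 𝓘(ℝ, V) (𝓡 (m + n)) ψ S y δ') =
    g.inner (𝒢.mul (ψ y) (𝒢.inv (ψ y)))
      (mfderivWithin 𝓘(ℝ, V) (𝓡 (m + n)) (fun z => 𝒢.mul (ψ z) (𝒢.inv (ψ y))) S y δ)
      (mfderivWithin 𝓘(ℝ, V) (𝓡 (m + n)) (fun z => 𝒢.mul (ψ z) (𝒢.inv (ψ y))) S y δ') := by
  rw [gS, ← mfderivWithin_div hψ hS hy hu, ← mfderivWithin_div hψ hS hy hu]

/-- The two sides live in tangent spaces at points that are only propositionally equal. All tangent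
spaces unfold to the same model space, so the metric is regarded as a family of functions on that
space before rewriting the base point. -/
lemma inner_mfderivWithin_congr {f₁ f₂ : V → G} (h : EqOn f₁ f₂ S) (hy : y ∈ S) (δ δ' : V) :
    g.inner (f₁ y) (mfderivWithin 𝓘(ℝ, V) (𝓡 (m + n)) f₁ S y δ)
      (mfderivWithin 𝓘(ℝ, V) (𝓡 (m + n)) f₁ S y δ') =
    g.inner (f₂ y) (mfderivWithin 𝓘(ℝ, V) (𝓡 (m + n)) f₂ S y δ)
      (mfderivWithin 𝓘(ℝ, V) (𝓡 (m + n)) f₂ S y δ') := by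
  let B : G → EuclideanSpace ℝ (Fin (m + n)) → EuclideanSpace ℝ (Fin (m + n)) → ℝ :=
    fun p v w => g.inner p v w
  have h1 : ∀ δ, (mfderivWithin 𝓘(ℝ, V) (𝓡 (m + n)) f₁ S y δ : EuclideanSpace ℝ (Fin (m + n))) =
      mfderivWithin 𝓘(ℝ, V) (𝓡 (m + n)) f₂ S y δ := fun δ =>
    DFunLike.congr_fun (mfderivWithin_congr_of_mem (I := 𝓘(ℝ, V)) (I' := 𝓡 (m + n))
      (f₁ := f₁) (f := f₂) h hy) δ
  change B (f₁ y) _ _ = B (f₂ y) _ _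
  rw [h hy]
  exact congrArg₂ _ (h1 δ) (h1 δ')

lemma mdifferentiableWithinAt_mul_const (hψ : MDifferentiableWithinAt 𝓘(ℝ, V) (𝓡 (m + n)) ψ S y)
    (hS : ∀ z ∈ S, 𝒢.s (ψ z) = x) (hy : y ∈ S) {b : G} (hb : 𝒢.t b = x) :
    MDifferentiableWithinAt 𝓘(ℝ, V) (𝓡 (m + n)) (fun z => 𝒢.mul (ψ z) b) S y :=
  MDifferentiableWithinAt.comp y (u := 𝒢.fiber (𝒢.s (ψ y))) (g := fun c => 𝒢.mul c b)
    (mdifferentiableWithinAt_mul_right ((hS y hy).trans hb.symm)) hψ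
    (fun z hz => (hS z hz).trans (hS y hy).symm)

/-- The metric `gS` is right invariant. -/
lemma gS_mul_right (hψ : MDifferentiableWithinAt 𝓘(ℝ, V) (𝓡 (m + n)) ψ S y)
    (hS : ∀ z ∈ S, 𝒢.s (ψ z) = x) (hy : y ∈ S) (hu : UniqueDiffWithinAt ℝ S y)
    {b : G} (hb : 𝒢.t b = x) (δ δ' : V) :
    𝒢.gS g (𝒢.mul (ψ y) b) (mfderivWithin 𝓘(ℝ, V) (𝓡 (m + n)) (fun z => 𝒢.mul (ψ z) b) S y δ)
      (mfderivWithin 𝓘(ℝ, V) (𝓡 (m + n)) (fun z => 𝒢.mul (ψ z) b) S y δ') =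
    𝒢.gS g (ψ y) (mfderivWithin 𝓘(ℝ, V) (𝓡 (m + n)) ψ S y δ)
      (mfderivWithin 𝓘(ℝ, V) (𝓡 (m + n)) ψ S y δ') := by
  have h := fun z hz => (hS z hz).trans hb.symm
  refine (gS_eq_inner_div (ψ := fun z => 𝒢.mul (ψ z) b) (x := 𝒢.s b) g
    (mdifferentiableWithinAt_mul_const hψ hS hy hb) (fun z hz => 𝒢.s_mul _ _ (h z hz)) hy hu
    δ δ').trans ?_
  rw [gS_eq_inner_div g hψ hS hy hu]
  exact inner_mfderivWithin_congr g
    (fun z hz => mul_div_mul (h z hz) (h y hy)) hy δ δ'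

lemma gS_pos (hψ : MDifferentiableWithinAt 𝓘(ℝ, V) (𝓡 (m + n)) ψ S y)
    (hS : ∀ z ∈ S, 𝒢.s (ψ z) = x) (hy : y ∈ S) (hu : UniqueDiffWithinAt ℝ S y) {δ : V}
    (h0 : mfderivWithin 𝓘(ℝ, V) (𝓡 (m + n)) ψ S y δ ≠ 0) :
    0 < 𝒢.gS g (ψ y) (mfderivWithin 𝓘(ℝ, V) (𝓡 (m + n)) ψ S y δ)
      (mfderivWithin 𝓘(ℝ, V) (𝓡 (m + n)) ψ S y δ) :=
  g.pos _ _ fun h => h0 (eq_zero_of_toAlg_eq_zero hψ hS hy hu h)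

lemma gS_smul_smul (a : G) (v : TangentSpace (𝓡 (m + n)) a) (r : ℝ) :
    𝒢.gS g a (r • v) (r • v) = r ^ 2 * 𝒢.gS g a v v := by
  have : 𝒢.toAlg a (r • v) = r • 𝒢.toAlg a v := by unfold toAlg; exact map_smul _ r v
  rw [gS, this, map_smul, map_smul, smul_apply, smul_eq_mul, smul_eq_mul, gS]
  ring

end Along

section Continuity

variable [IsManifold (𝓡 (m + n)) ∞ G] (g : AmbientMetric m n G)

/-- The derivative of a smooth family of parametrizations gives continuous sections of the tangent
bundle along the moving base point, and a continuous bundle metric pairs such sections continuously.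
-/
lemma continuousAt_inner_mfderiv {D : Type*} [NormedAddCommGroup D] [NormedSpace ℝ D]
    {P : G → D → G} {a₀ : G}
    (hP : ContMDiffAt ((𝓡 (m + n)).prod 𝓘(ℝ, D)) (𝓡 (m + n)) ∞ (Function.uncurry P) (a₀, 0))
    (δ δ' : D) :
    ContinuousAt (fun a => g.inner (P a 0) (mfderiv 𝓘(ℝ, D) (𝓡 (m + n)) (P a) 0 δ)
      (mfderiv 𝓘(ℝ, D) (𝓡 (m + n)) (P a) 0 δ')) a₀ := by
  let _ : RiemannianBundle (fun a : G => TangentSpace (𝓡 (m + n)) a) := ⟨g.toRiemannianMetric⟩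
  have : IsContinuousRiemannianBundle (EuclideanSpace ℝ (Fin (m + n)))
      (fun a : G => TangentSpace (𝓡 (m + n)) a) :=
    ⟨⟨g.inner, g.contMDiff.continuous, fun _ _ _ => rfl⟩⟩
  have hb : ContinuousAt (fun a => P a 0) a₀ :=
    ContinuousAt.comp (f := fun a : G => (a, (0 : D))) hP.continuousAt
      (continuousAt_id.prodMk continuousAt_const)
  have hm := (ContMDiffAt.mfderiv (J := 𝓡 (m + n)) (m := 0) P (fun _ => (0 : D)) hP
    contMDiffAt_const (by simp)).continuousAt
  have key : ∀ δ : D, ContinuousAt (fun a => (⟨P a 0, mfderiv 𝓘(ℝ, D) (𝓡 (m + n)) (P a) 0 δ⟩ :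
      TotalSpace (EuclideanSpace ℝ (Fin (m + n)))
        (fun a : G => TangentSpace (𝓡 (m + n)) a))) a₀ := by
    intro δ
    exact ContinuousAt.clm_apply_of_inCoordinates (F₁ := D)
      (E₁ := fun x : D => TangentSpace 𝓘(ℝ, D) x)
      (b₁ := fun _ : G => (0 : D)) (b₂ := fun a => P a 0) (v := fun _ => δ)
      (ϕ := fun a => mfderiv 𝓘(ℝ, D) (𝓡 (m + n)) (P a) 0) hm continuousAt_const hb
  exact (key δ).inner_bundle (key δ')

-- Positivity at `a₀` is uniform on the compact unit sphere, with constant 2c; nearby forms differ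
-- from it by less than c in operator norm, which leaves c.
set_option synthInstance.maxHeartbeats 200000 in
lemma quadratic_bounds {X D : Type*} [TopologicalSpace X] [NormedAddCommGroup D] [NormedSpace ℝ D]
    [FiniteDimensional ℝ D] {q : X → D →L[ℝ] D →L[ℝ] ℝ} {a₀ : X} (hq : ContinuousAt q a₀)
    (hpos : ∀ δ, δ ≠ 0 → 0 < q a₀ δ δ) :
    ∃ c C : ℝ, 0 < c ∧ 0 < C ∧ ∀ᶠ a in 𝓝 a₀, ∀ δ, c * ‖δ‖ ^ 2 ≤ q a δ δ ∧
      q a δ δ ≤ C * ‖δ‖ ^ 2 := by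
  obtain ⟨c, hc, hc'⟩ : ∃ c : ℝ, 0 < c ∧ ∀ δ, 2 * c * ‖δ‖ ^ 2 ≤ q a₀ δ δ := by
    have hK : IsCompact (Metric.sphere (0 : D) 1) :=
      haveI := FiniteDimensional.proper_real D; isCompact_sphere 0 1
    have hcont : ContinuousOn (fun δ => q a₀ δ δ) (Metric.sphere (0 : D) 1) := by fun_prop
    rcases (Metric.sphere (0 : D) 1).eq_empty_or_nonempty with h | h
    -- The sphere is empty only when the space is zero.
    · refine ⟨1, one_pos, fun δ => ?_⟩
      by_cases h0 : δ = 0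
      · simp [h0]
      · exfalso
        have : ‖δ‖⁻¹ • δ ∈ Metric.sphere (0 : D) 1 := by
          simp [norm_smul, h0]
        rw [h] at this; exact this
    · obtain ⟨δ₀, hδ₀, hmin⟩ := hK.exists_isMinOn h hcont
      have hp : 0 < q a₀ δ₀ δ₀ := hpos _ (fun h0 => by simp [h0] at hδ₀)
      refine ⟨q a₀ δ₀ δ₀ / 2, by positivity, fun δ => ?_⟩
      by_cases h0 : δ = 0
      · simp [h0]
      · have h1 : ‖δ‖⁻¹ • δ ∈ Metric.sphere (0 : D) 1 := by simp [norm_smul, h0]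
        have h2 : q a₀ δ₀ δ₀ ≤ q a₀ (‖δ‖⁻¹ • δ) (‖δ‖⁻¹ • δ) := hmin h1
        simp only [map_smul, smul_apply, smul_eq_mul] at h2
        have h3 : 0 < ‖δ‖ := norm_pos_iff.2 h0
        have h4 := mul_le_mul_of_nonneg_right h2 (sq_nonneg ‖δ‖)
        have h5 : ‖δ‖⁻¹ * (‖δ‖⁻¹ * q a₀ δ δ) * ‖δ‖ ^ 2 = q a₀ δ δ := by field_simp
        linarith
  let _ : SeminormedAddCommGroup (D →L[ℝ] D →L[ℝ] ℝ) :=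
    ContinuousLinearMap.toSeminormedAddCommGroup
  refine ⟨c, ‖q a₀‖ + c, hc, by positivity, ?_⟩
  filter_upwards [Metric.tendsto_nhds.1 hq c hc] with a ha δ
  rw [dist_eq_norm] at ha
  have h1 : |q a δ δ - q a₀ δ δ| ≤ c * ‖δ‖ ^ 2 := by
    have := (q a - q a₀).le_opNorm₂ δ δ
    simp only [sub_apply, Real.norm_eq_abs] at this
    refine this.trans ?_
    rw [_root_.mul_assoc, ← pow_two]
    exact mul_le_mul_of_nonneg_right ha.le (sq_nonneg _)
  have h2 : q a₀ δ δ ≤ ‖q a₀‖ * ‖δ‖ ^ 2 := by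
    have := (q a₀).le_opNorm₂ δ δ
    rw [_root_.mul_assoc, ← pow_two] at this
    exact (le_abs_self _).trans this
  obtain ⟨h3, h4⟩ := abs_le.1 h1
  have h5 := hc' δ
  constructor <;> nlinarith

end Continuity

/-! ### The fibre metric in box coordinates. -/

section BoxMetric

variable {a₀ : G} (Bx : 𝒢.SourceBox a₀)

namespace SourceBox

/-- The parametrization of the fibre through `a` given by a box. -/
def param (a : G) (δ : EuclideanSpace ℝ (Fin n)) : G := Bx.e.symm (Bx.e a + (0, δ))

/-- Admissible pairs for `param`. -/
def dom : Set (G × EuclideanSpace ℝ (Fin n)) :=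
  {p | p.1 ∈ Bx.e.source ∧ Bx.e p.1 + (0, p.2) ∈ Bx.e.target}

lemma isOpen_dom : IsOpen Bx.dom := by
  have h : ContinuousOn (fun p : G × EuclideanSpace ℝ (Fin n) =>
      Bx.e p.1 + ((0 : EuclideanSpace ℝ (Fin m)), p.2)) (Prod.fst ⁻¹' Bx.e.source) :=
    (Bx.e.continuousOn.comp continuousOn_fst (fun _ h => h)).add
      (continuousOn_const.prodMk continuousOn_snd)
  exact h.isOpen_inter_preimage (Bx.e.open_source.preimage continuous_fst) Bx.e.open_target

lemma mem_dom {a : G} (ha : a ∈ Bx.e.source) : (a, (0 : EuclideanSpace ℝ (Fin n))) ∈ Bx.dom :=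
  ⟨ha, by
    change Bx.e a + 0 ∈ _
    rw [add_zero]; exact Bx.e.map_source ha⟩

lemma param_zero {a : G} (ha : a ∈ Bx.e.source) : Bx.param a 0 = a := by
  change Bx.e.symm (Bx.e a + 0) = a
  rw [add_zero, Bx.e.left_inv ha]

lemma s_eq_iff {a b : G} (ha : a ∈ Bx.e.source) (hb : b ∈ Bx.e.source) :
    𝒢.s a = 𝒢.s b ↔ (Bx.e a).1 = (Bx.e b).1 := by
  rw [Bx.fst_eq a ha, Bx.fst_eq b hb]
  exact ((chartAt (EuclideanSpace ℝ (Fin m)) (𝒢.s a₀)).injOn.eq_iff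
    (Bx.s_mem a ha) (Bx.s_mem b hb)).symm

lemma s_param {p : G × EuclideanSpace ℝ (Fin n)} (hp : p ∈ Bx.dom) :
    𝒢.s (Bx.param p.1 p.2) = 𝒢.s p.1 := by
  refine (Bx.s_eq_iff (Bx.e.map_target hp.2) hp.1).2 ?_
  rw [Bx.e.right_inv hp.2]
  simp

lemma contMDiffOn_param : ContMDiffOn ((𝓡 (m + n)).prod 𝓘(ℝ, EuclideanSpace ℝ (Fin n)))
    (𝓡 (m + n)) ∞ (Function.uncurry Bx.param) Bx.dom := by
  refine Bx.smooth_symm.comp ?_ (fun p hp => hp.2)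
  refine (Bx.smooth.comp contMDiffOn_fst (fun p hp => hp.1)).add ?_
  exact (contMDiffOn_const (c := (0 : EuclideanSpace ℝ (Fin m)))).prodMk_space contMDiffOn_snd

/-- The parametrization `param a`, translated to the unit over `t(a)`. -/
def divParam (a : G) (δ : EuclideanSpace ℝ (Fin n)) : G := 𝒢.mul (Bx.param a δ) (𝒢.inv a)

lemma contMDiffAt_divParam {a : G} (ha : a ∈ Bx.e.source) :
    ContMDiffAt ((𝓡 (m + n)).prod 𝓘(ℝ, EuclideanSpace ℝ (Fin n)))
    (𝓡 (m + n)) ∞ (Function.uncurry Bx.divParam) (a, 0) := by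
  have h : ContMDiffOn ((𝓡 (m + n)).prod 𝓘(ℝ, EuclideanSpace ℝ (Fin n)))
    (𝓡 (m + n)) ∞ (Function.uncurry Bx.divParam) Bx.dom := by
    refine 𝒢.smooth_mul.comp (Bx.contMDiffOn_param.prodMk
      (𝒢.smooth_inv.comp_contMDiffOn contMDiffOn_fst)) (fun p hp => ?_)
    exact (Bx.s_param hp).trans (𝒢.t_inv _).symm
  exact (h _ (Bx.mem_dom ha)).contMDiffAt (Bx.isOpen_dom.mem_nhds (Bx.mem_dom ha))

/-- The slice of `dom` through `a`. -/
def slice (a : G) : Set (EuclideanSpace ℝ (Fin n)) := {δ | (a, δ) ∈ Bx.dom}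

lemma isOpen_slice (a : G) : IsOpen (Bx.slice a) :=
  Bx.isOpen_dom.preimage (Continuous.prodMk_right a)

lemma zero_mem_slice {a : G} (ha : a ∈ Bx.e.source) : 0 ∈ Bx.slice a := Bx.mem_dom ha

lemma contMDiffOn_param_slice (a : G) :
    ContMDiffOn (𝓡 n) (𝓡 (m + n)) ∞ (Bx.param a) (Bx.slice a) :=
  Bx.contMDiffOn_param.comp (contMDiffOn_const.prodMk contMDiffOn_id) (fun _ h => h)

lemma mdifferentiableAt_param {a : G} {δ : EuclideanSpace ℝ (Fin n)} (h : δ ∈ Bx.slice a) :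
    MDifferentiableAt (𝓡 n) (𝓡 (m + n)) (Bx.param a) δ :=
  (((Bx.contMDiffOn_param_slice a) δ h).contMDiffAt
    ((Bx.isOpen_slice a).mem_nhds h)).mdifferentiableAt (by simp)

lemma mdifferentiableAt_symm {z : EuclideanSpace ℝ (Fin m) × EuclideanSpace ℝ (Fin n)}
    (hz : z ∈ Bx.e.target) : MDifferentiableAt
      𝓘(ℝ, EuclideanSpace ℝ (Fin m) × EuclideanSpace ℝ (Fin n)) (𝓡 (m + n)) Bx.e.symm z :=
  ((Bx.smooth_symm z hz).contMDiffAt (Bx.e.open_target.mem_nhds hz)).mdifferentiableAt (by simp)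

lemma mdifferentiableAt_e {a : G} (ha : a ∈ Bx.e.source) : MDifferentiableAt (𝓡 (m + n))
      𝓘(ℝ, EuclideanSpace ℝ (Fin m) × EuclideanSpace ℝ (Fin n)) Bx.e a :=
  ((Bx.smooth a ha).contMDiffAt (Bx.e.open_source.mem_nhds ha)).mdifferentiableAt (by simp)

lemma e_param {a : G} {δ : EuclideanSpace ℝ (Fin n)} (h : δ ∈ Bx.slice a) :
    Bx.e (Bx.param a δ) = Bx.e a + (0, δ) := Bx.e.right_inv h.2

/-- Read in the box, `param a` is the affine map δ ↦ e(a) + (0, δ). -/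
lemma injective_mfderiv_param {a : G} {δ : EuclideanSpace ℝ (Fin n)} (h : δ ∈ Bx.slice a) :
    Function.Injective (mfderiv (𝓡 n) (𝓡 (m + n)) (Bx.param a) δ) := by
  have h1 : HasMFDerivAt (𝓡 n) 𝓘(ℝ, EuclideanSpace ℝ (Fin m) × EuclideanSpace ℝ (Fin n))
      (Bx.e ∘ Bx.param a) δ _ :=
    HasMFDerivAt.comp δ (Bx.mdifferentiableAt_e (Bx.e.map_target h.2)).hasMFDerivAt
      (Bx.mdifferentiableAt_param h).hasMFDerivAt
  have h2 : HasMFDerivAt (𝓡 n) 𝓘(ℝ, EuclideanSpace ℝ (Fin m) × EuclideanSpace ℝ (Fin n))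
      (fun δ => Bx.e a + ((0 : EuclideanSpace ℝ (Fin m)), δ)) δ
      (ContinuousLinearMap.inr ℝ (EuclideanSpace ℝ (Fin m)) (EuclideanSpace ℝ (Fin n))) :=
    HasFDerivAt.hasMFDerivAt (((ContinuousLinearMap.inr ℝ (EuclideanSpace ℝ (Fin m))
      (EuclideanSpace ℝ (Fin n))).hasFDerivAt).const_add (Bx.e a))
  have h3 := h2.congr_of_eventuallyEq (f₁ := Bx.e ∘ Bx.param a)
    (Filter.eventuallyEq_of_mem ((Bx.isOpen_slice a).mem_nhds h) fun δ' h' => Bx.e_param h')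
  have h4 := hasMFDerivAt_unique h1 h3
  rw [injective_iff_map_eq_zero]
  intro w hw
  have h5 := DFunLike.congr_fun h4 w
  have h6 : (mfderiv (𝓡 (m + n)) 𝓘(ℝ, EuclideanSpace ℝ (Fin m) × EuclideanSpace ℝ (Fin n))
      Bx.e (Bx.param a δ)) ((mfderiv (𝓡 n) (𝓡 (m + n)) (Bx.param a) δ) w) = 0 := by
    rw [hw, map_zero]
  exact congrArg Prod.snd (h5.symm.trans h6)


section Form

variable [IsManifold (𝓡 (m + n)) ∞ G] (g : AmbientMetric m n G)

/-- The fibre metric at `a` in the coordinates of a box. -/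
def form (a : G) : EuclideanSpace ℝ (Fin n) →L[ℝ] EuclideanSpace ℝ (Fin n) →L[ℝ] ℝ :=
  ContinuousLinearMap.bilinearComp (E := EuclideanSpace ℝ (Fin (m + n)))
    (F := EuclideanSpace ℝ (Fin (m + n)))
    (show EuclideanSpace ℝ (Fin (m + n)) →L[ℝ] EuclideanSpace ℝ (Fin (m + n)) →L[ℝ] ℝ from
      g.inner (Bx.divParam a 0))
    (show EuclideanSpace ℝ (Fin n) →L[ℝ] EuclideanSpace ℝ (Fin (m + n)) from
      mfderiv (𝓡 n) (𝓡 (m + n)) (Bx.divParam a) 0)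
    (show EuclideanSpace ℝ (Fin n) →L[ℝ] EuclideanSpace ℝ (Fin (m + n)) from
      mfderiv (𝓡 n) (𝓡 (m + n)) (Bx.divParam a) 0)

lemma continuousAt_form {a : G} (ha : a ∈ Bx.e.source) : ContinuousAt (Bx.form g) a := by
  rw [continuousAt_clm_apply]
  intro δ
  rw [continuousAt_clm_apply]
  intro δ'
  exact continuousAt_inner_mfderiv g (Bx.contMDiffAt_divParam ha) δ δ'

lemma form_eq {a : G} (ha : a ∈ Bx.e.source) (δ δ' : EuclideanSpace ℝ (Fin n)) :
    Bx.form g a δ δ' = 𝒢.gS g (Bx.param a 0) (mfderiv (𝓡 n) (𝓡 (m + n)) (Bx.param a) 0 δ)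
      (mfderiv (𝓡 n) (𝓡 (m + n)) (Bx.param a) 0 δ') := by
  have h0 := Bx.zero_mem_slice ha
  have ho := Bx.isOpen_slice a
  have h1 := gS_eq_inner_div (ψ := Bx.param a) (S := Bx.slice a) (y := 0) (x := 𝒢.s a) g
    (Bx.mdifferentiableAt_param h0).mdifferentiableWithinAt
    (fun z hz => Bx.s_param (p := (a, z)) hz) h0 (ho.uniqueDiffWithinAt h0) δ δ'
  have h2 := inner_mfderivWithin_congr (f₁ := Bx.divParam a)
    (f₂ := fun z => 𝒢.mul (Bx.param a z) (𝒢.inv (Bx.param a 0))) (S := Bx.slice a) g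
    (fun z _ => by rw [Bx.param_zero ha]; rfl) h0 δ δ'
  rw [mfderivWithin_of_isOpen ho h0] at h1 h2
  exact h2.trans h1.symm

lemma form_pos {a : G} (ha : a ∈ Bx.e.source) (δ : EuclideanSpace ℝ (Fin n)) (hδ : δ ≠ 0) :
    0 < Bx.form g a δ δ := by
  have h0 := Bx.zero_mem_slice ha
  have ho := Bx.isOpen_slice a
  have h1 := gS_pos (ψ := Bx.param a) (S := Bx.slice a) (y := 0) (x := 𝒢.s a) (δ := δ) g
    (Bx.mdifferentiableAt_param h0).mdifferentiableWithinAt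
    (fun z hz => Bx.s_param (p := (a, z)) hz) h0 (ho.uniqueDiffWithinAt h0)
  rw [mfderivWithin_of_isOpen ho h0] at h1
  rw [Bx.form_eq g ha]
  exact h1 fun h => hδ (Bx.injective_mfderiv_param h0 (h.trans (map_zero _).symm))

lemma form_bounds {a : G} (ha : a ∈ Bx.e.source) : ∃ c C : ℝ, 0 < c ∧ 0 < C ∧
    ∀ᶠ b in 𝓝 a, ∀ δ, c * ‖δ‖ ^ 2 ≤ Bx.form g b δ δ ∧ Bx.form g b δ δ ≤ C * ‖δ‖ ^ 2 :=
  quadratic_bounds (Bx.continuousAt_form g ha) (Bx.form_pos g ha)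

variable [IsManifold (𝓡 m) ∞ M]

/-- The first coordinate of a box is a chart of `M` composed with `s`, hence blind to vertical
vectors. -/
lemma fst_mfderiv_e {a : G} (ha : a ∈ Bx.e.source) (v : TangentSpace (𝓡 (m + n)) a)
    (hv : mfderiv (𝓡 (m + n)) (𝓡 m) 𝒢.s a v = 0) :
    (mfderiv (𝓡 (m + n)) 𝓘(ℝ, EuclideanSpace ℝ (Fin m) × EuclideanSpace ℝ (Fin n)) Bx.e a v :
      EuclideanSpace ℝ (Fin m) × EuclideanSpace ℝ (Fin n)).1 = 0 := by
  have h1 : HasMFDerivAt (𝓡 (m + n)) (𝓡 m) (Prod.fst ∘ Bx.e) a _ :=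
    HasMFDerivAt.comp (I' := 𝓘(ℝ, EuclideanSpace ℝ (Fin m) × EuclideanSpace ℝ (Fin n))) a
      (HasFDerivAt.hasMFDerivAt (ContinuousLinearMap.fst ℝ (EuclideanSpace ℝ (Fin m))
        (EuclideanSpace ℝ (Fin n))).hasFDerivAt) (Bx.mdifferentiableAt_e ha).hasMFDerivAt
  have hx : MDifferentiableAt (𝓡 m) (𝓡 m) (chartAt (EuclideanSpace ℝ (Fin m)) (𝒢.s a₀)) (𝒢.s a) :=
    mdifferentiableAt_atlas (chart_mem_atlas _ _) (Bx.s_mem a ha)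
  have h2 : HasMFDerivAt (𝓡 (m + n)) (𝓡 m)
      (chartAt (EuclideanSpace ℝ (Fin m)) (𝒢.s a₀) ∘ 𝒢.s) a _ :=
    HasMFDerivAt.comp a hx.hasMFDerivAt ((𝒢.smooth_s a).mdifferentiableAt (by simp)).hasMFDerivAt
  have h3 := h2.congr_of_eventuallyEq (f₁ := Prod.fst ∘ Bx.e)
    (Filter.eventuallyEq_of_mem (Bx.e.open_source.mem_nhds ha) fun b hb => Bx.fst_eq b hb)
  have h4 := DFunLike.congr_fun (hasMFDerivAt_unique h1 h3) v
  refine h4.trans ?_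
  refine (congrArg (mfderiv (𝓡 m) (𝓡 m) (chartAt (EuclideanSpace ℝ (Fin m)) (𝒢.s a₀)) (𝒢.s a))
    hv).trans ?_
  exact map_zero _

lemma mfderiv_symm_mfderiv_e {a : G} (ha : a ∈ Bx.e.source) (v : TangentSpace (𝓡 (m + n)) a) :
    mfderiv 𝓘(ℝ, EuclideanSpace ℝ (Fin m) × EuclideanSpace ℝ (Fin n)) (𝓡 (m + n)) Bx.e.symm
      (Bx.e a) (mfderiv (𝓡 (m + n))
        𝓘(ℝ, EuclideanSpace ℝ (Fin m) × EuclideanSpace ℝ (Fin n)) Bx.e a v) = v := by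
  have h1 := HasMFDerivAt.comp (g := Bx.e.symm) (f := Bx.e) a
    (Bx.mdifferentiableAt_symm (Bx.e.map_source ha)).hasMFDerivAt
    (Bx.mdifferentiableAt_e ha).hasMFDerivAt
  have h2 := (hasMFDerivAt_id (I := 𝓡 (m + n)) a).congr_of_eventuallyEq (f₁ := Bx.e.symm ∘ Bx.e)
    (Filter.eventuallyEq_of_mem (Bx.e.open_source.mem_nhds ha) fun b hb => Bx.e.left_inv hb)
  exact DFunLike.congr_fun (hasMFDerivAt_unique h1 h2) v

lemma mfderiv_param {a : G} (ha : a ∈ Bx.e.source) (w : EuclideanSpace ℝ (Fin n)) :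
    (mfderiv (𝓡 n) (𝓡 (m + n)) (Bx.param a) 0 w : EuclideanSpace ℝ (Fin (m + n))) =
    mfderiv 𝓘(ℝ, EuclideanSpace ℝ (Fin m) × EuclideanSpace ℝ (Fin n)) (𝓡 (m + n)) Bx.e.symm
      (Bx.e a) ((0 : EuclideanSpace ℝ (Fin m)), w) := by
  have h2 : HasMFDerivAt (𝓡 n) 𝓘(ℝ, EuclideanSpace ℝ (Fin m) × EuclideanSpace ℝ (Fin n))
      (fun δ => Bx.e a + ((0 : EuclideanSpace ℝ (Fin m)), δ)) 0
      (ContinuousLinearMap.inr ℝ (EuclideanSpace ℝ (Fin m)) (EuclideanSpace ℝ (Fin n))) :=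
    HasFDerivAt.hasMFDerivAt (((ContinuousLinearMap.inr ℝ (EuclideanSpace ℝ (Fin m))
      (EuclideanSpace ℝ (Fin n))).hasFDerivAt).const_add (Bx.e a))
  have h0 : Bx.e a + ((0 : EuclideanSpace ℝ (Fin m)), (0 : EuclideanSpace ℝ (Fin n))) = Bx.e a :=
    add_zero _
  have h1 := (Bx.mdifferentiableAt_symm (Bx.e.map_source ha)).hasMFDerivAt
  rw [← h0] at h1
  have h3 := (HasMFDerivAt.comp (0 : EuclideanSpace ℝ (Fin n)) (g := Bx.e.symm)
    (f := fun δ => Bx.e a + ((0 : EuclideanSpace ℝ (Fin m)), δ)) h1 h2).mfderiv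
  refine (DFunLike.congr_fun h3 w).trans ?_
  let B : EuclideanSpace ℝ (Fin m) × EuclideanSpace ℝ (Fin n) → EuclideanSpace ℝ (Fin (m + n)) :=
    fun z => mfderiv 𝓘(ℝ, EuclideanSpace ℝ (Fin m) × EuclideanSpace ℝ (Fin n)) (𝓡 (m + n))
      Bx.e.symm z ((0 : EuclideanSpace ℝ (Fin m)), w)
  change B _ = B _
  rw [h0]

/-- The fibre metric on vertical vectors, in the coordinates of a box. -/
lemma form_mfderiv_e {a : G} (ha : a ∈ Bx.e.source) {v v' : TangentSpace (𝓡 (m + n)) a}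
    (hv : mfderiv (𝓡 (m + n)) (𝓡 m) 𝒢.s a v = 0)
    (hv' : mfderiv (𝓡 (m + n)) (𝓡 m) 𝒢.s a v' = 0) :
    Bx.form g a
      (mfderiv (𝓡 (m + n)) 𝓘(ℝ, EuclideanSpace ℝ (Fin m) × EuclideanSpace ℝ (Fin n)) Bx.e a v :
        EuclideanSpace ℝ (Fin m) × EuclideanSpace ℝ (Fin n)).2
      (mfderiv (𝓡 (m + n)) 𝓘(ℝ, EuclideanSpace ℝ (Fin m) × EuclideanSpace ℝ (Fin n)) Bx.e a v' :
        EuclideanSpace ℝ (Fin m) × EuclideanSpace ℝ (Fin n)).2 = 𝒢.gS g a v v' := by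
  rw [Bx.form_eq g ha]
  let B : G → EuclideanSpace ℝ (Fin (m + n)) → EuclideanSpace ℝ (Fin (m + n)) → ℝ :=
    fun p v w => 𝒢.gS g p v w
  have h1 : ∀ v : TangentSpace (𝓡 (m + n)) a, mfderiv (𝓡 (m + n)) (𝓡 m) 𝒢.s a v = 0 →
      (mfderiv (𝓡 n) (𝓡 (m + n)) (Bx.param a) 0 ((mfderiv (𝓡 (m + n))
      𝓘(ℝ, EuclideanSpace ℝ (Fin m) × EuclideanSpace ℝ (Fin n)) Bx.e a v :
      EuclideanSpace ℝ (Fin m) × EuclideanSpace ℝ (Fin n)).2) :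
      EuclideanSpace ℝ (Fin (m + n))) = v := by
    intro v hv
    refine (Bx.mfderiv_param ha _).trans (Eq.trans ?_ (Bx.mfderiv_symm_mfderiv_e ha v))
    rw [← Bx.fst_mfderiv_e ha v hv]
    rfl
  change B (Bx.param a 0) _ _ = B a v v'
  rw [Bx.param_zero ha]
  exact congrArg₂ _ (h1 v hv) (h1 v' hv')

end Form

end SourceBox

end BoxMetric

end FibreMetric

/-! ### Gradient bounds, curves in the fibres and their lengths. -/

section Curves

variable {m n : ℕ} {G M : Type u}
  [TopologicalSpace G] [ChartedSpace (EuclideanSpace ℝ (Fin (m + n))) G]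
  [TopologicalSpace M] [ChartedSpace (EuclideanSpace ℝ (Fin m)) M]
  {𝒢 : LieGroupoid m n G M}
  [IsManifold (𝓡 (m + n)) ∞ G] (g : AmbientMetric m n G)

/-- The differential of a real valued function on `G`. -/
def differentialAt (h : G → ℝ) (a : G) (v : TangentSpace (𝓡 (m + n)) a) : ℝ :=
  mfderiv (𝓡 (m + n)) 𝓘(ℝ, ℝ) h a v

section Gradient

variable [IsManifold (𝓡 m) ∞ M]

/-- In box coordinates a vertical vector has only its second component, whose Euclidean norm is
controlled by the fibre metric through the lower bound c of `form_bounds`; the derivative of `h` in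
the box is bounded near the centre. -/
lemma exists_abs_mfderiv_le_nhds {h : G → ℝ} (hh : ContMDiff (𝓡 (m + n)) 𝓘(ℝ, ℝ) ∞ h) (a₀ : G) :
    ∃ C : ℝ, ∀ᶠ a in 𝓝 a₀, ∀ v : TangentSpace (𝓡 (m + n)) a,
      mfderiv (𝓡 (m + n)) (𝓡 m) 𝒢.s a v = 0 →
      |differentialAt h a v| ≤ C * Real.sqrt (𝒢.gS g a v v) := by
  obtain ⟨Bx⟩ := 𝒢.nonempty_sourceBox a₀
  obtain ⟨c, C, hc, -, hb⟩ := Bx.form_bounds g Bx.mem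
  set f : EuclideanSpace ℝ (Fin m) × EuclideanSpace ℝ (Fin n) → ℝ := h ∘ Bx.e.symm with hf
  have hfs : ContDiffOn ℝ ∞ f Bx.e.target :=
    contMDiffOn_iff_contDiffOn.1 (hh.comp_contMDiffOn Bx.smooth_symm)
  have hcont : ContinuousAt (fun a => ‖fderiv ℝ f (Bx.e a)‖) a₀ := by
    have h1 : ContinuousAt (fderiv ℝ f) (Bx.e a₀) :=
      (hfs.continuousOn_fderiv_of_isOpen Bx.e.open_target (by simp)).continuousAt
        (Bx.e.open_target.mem_nhds (Bx.e.map_source Bx.mem))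
    exact (ContinuousAt.comp (f := Bx.e) h1 (Bx.e.continuousAt Bx.mem)).norm
  set B := ‖fderiv ℝ f (Bx.e a₀)‖ + 1 with hB
  have hBpos : 0 < B := by positivity
  refine ⟨B / Real.sqrt c, ?_⟩
  filter_upwards [hb, Bx.e.open_source.mem_nhds Bx.mem, hcont.eventually_lt_const
    (lt_add_one ‖fderiv ℝ f (Bx.e a₀)‖)] with a ha has haB v hv
  let w : EuclideanSpace ℝ (Fin m) × EuclideanSpace ℝ (Fin n) :=
    mfderiv (𝓡 (m + n)) 𝓘(ℝ, EuclideanSpace ℝ (Fin m) × EuclideanSpace ℝ (Fin n)) Bx.e a v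
  have hw1 : w.1 = 0 := Bx.fst_mfderiv_e has v hv
  have hnorm : ‖w‖ = ‖w.2‖ := by
    rw [Prod.norm_def, hw1, norm_zero, max_eq_right (norm_nonneg _)]
  have hd : differentialAt h a v = fderiv ℝ f (Bx.e a) w := by
    have h1 : HasMFDerivAt (𝓡 (m + n)) 𝓘(ℝ, ℝ) (f ∘ Bx.e) a _ :=
      HasMFDerivAt.comp a (((hfs.contDiffAt (Bx.e.open_target.mem_nhds (Bx.e.map_source
        has))).differentiableAt (by simp)).hasFDerivAt.hasMFDerivAt)
        (Bx.mdifferentiableAt_e has).hasMFDerivAt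
    have h2 := h1.congr_of_eventuallyEq (f₁ := h) (Filter.eventuallyEq_of_mem
      (Bx.e.open_source.mem_nhds has) fun b hb => by
        simp only [hf, Function.comp_apply, Bx.e.left_inv hb])
    exact DFunLike.congr_fun h2.mfderiv v
  have h3 : c * ‖w.2‖ ^ 2 ≤ 𝒢.gS g a v v := by
    rw [← Bx.form_mfderiv_e g has hv hv]
    exact (ha _).1
  have h4 : Real.sqrt c * ‖w.2‖ ≤ Real.sqrt (𝒢.gS g a v v) := by
    refine Real.le_sqrt_of_sq_le ?_
    rw [mul_pow, Real.sq_sqrt hc.le]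
    exact h3
  rw [hd]
  calc |fderiv ℝ f (Bx.e a) w| ≤ ‖fderiv ℝ f (Bx.e a)‖ * ‖w‖ := (fderiv ℝ f (Bx.e a)).le_opNorm w
    _ ≤ B * ‖w.2‖ := by rw [hnorm]; exact mul_le_mul_of_nonneg_right haB.le (norm_nonneg _)
    _ = B / Real.sqrt c * (Real.sqrt c * ‖w.2‖) := by
      have : Real.sqrt c ≠ 0 := (Real.sqrt_pos.2 hc).ne'
      field_simp
    _ ≤ B / Real.sqrt c * Real.sqrt (𝒢.gS g a v v) :=
      mul_le_mul_of_nonneg_left h4 (by positivity)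

/-- The fibrewise gradient of a compactly supported function is bounded. -/
lemma exists_abs_mfderiv_le {h : G → ℝ} (hh : ContMDiff (𝓡 (m + n)) 𝓘(ℝ, ℝ) ∞ h)
    (hc : HasCompactSupport h) :
    ∃ C : ℝ, 0 < C ∧ ∀ (a : G) (v : TangentSpace (𝓡 (m + n)) a),
      mfderiv (𝓡 (m + n)) (𝓡 m) 𝒢.s a v = 0 →
      |differentialAt h a v| ≤ C * Real.sqrt (𝒢.gS g a v v) := by
  have key : ∃ C : ℝ, ∀ a ∈ tsupport h, ∀ v : TangentSpace (𝓡 (m + n)) a,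
      mfderiv (𝓡 (m + n)) (𝓡 m) 𝒢.s a v = 0 →
      |differentialAt h a v| ≤ C * Real.sqrt (𝒢.gS g a v v) := by
    refine hc.isCompact.induction_on (p := fun A => ∃ C : ℝ, ∀ a ∈ A,
      ∀ v : TangentSpace (𝓡 (m + n)) a, mfderiv (𝓡 (m + n)) (𝓡 m) 𝒢.s a v = 0 →
      |differentialAt h a v| ≤ C * Real.sqrt (𝒢.gS g a v v))
      ⟨0, by simp⟩ ?_ ?_ ?_
    · rintro A A' hA ⟨C, hC⟩
      exact ⟨C, fun a ha => hC a (hA ha)⟩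
    · rintro A A' ⟨C, hC⟩ ⟨C', hC'⟩
      refine ⟨max C C', fun a ha v hv => ?_⟩
      rcases ha with ha | ha
      · exact (hC a ha v hv).trans
          (mul_le_mul_of_nonneg_right (le_max_left _ _) (Real.sqrt_nonneg _))
      · exact (hC' a ha v hv).trans
          (mul_le_mul_of_nonneg_right (le_max_right _ _) (Real.sqrt_nonneg _))
    · intro a _
      obtain ⟨C, hC⟩ := exists_abs_mfderiv_le_nhds (𝒢 := 𝒢) g hh a
      exact ⟨_, mem_nhdsWithin_of_mem_nhds hC, C, fun b hb => hb⟩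
  obtain ⟨C, hC⟩ := key
  refine ⟨max C 1, by positivity, fun a v hv => ?_⟩
  by_cases ha : a ∈ tsupport h
  · exact (hC a ha v hv).trans (mul_le_mul_of_nonneg_right (le_max_left _ _) (Real.sqrt_nonneg _))
  · have h1 : h =ᶠ[𝓝 a] fun _ => 0 := notMem_tsupport_iff_eventuallyEq.1 ha
    have h2 : differentialAt h a v = 0 :=
      DFunLike.congr_fun ((hasMFDerivAt_const (I := 𝓡 (m + n)) (I' := 𝓘(ℝ, ℝ)) (0 : ℝ)
        a).congr_of_eventuallyEq h1).mfderiv v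
    rw [h2, abs_zero]
    positivity

end Gradient

variable (𝒢) in
/-- The speed of a curve in a fibre. -/
def speed (γ : ℝ → G) (τ : ℝ) : ℝ≥0∞ :=
  ENNReal.ofReal (Real.sqrt
      (𝒢.gS g (γ τ) (mfderivWithin 𝓘(ℝ, ℝ) (𝓡 (m + n)) γ (Icc 0 1) τ (1 : ℝ))
        (mfderivWithin 𝓘(ℝ, ℝ) (𝓡 (m + n)) γ (Icc 0 1) τ (1 : ℝ))))

variable (𝒢) in
/-- `γ` is a `C¹` curve on `[0, 1]` in the fibre over `x`. -/
def IsFiberCurve (x : M) (γ : ℝ → G) : Prop :=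
  ContMDiffOn 𝓘(ℝ, ℝ) (𝓡 (m + n)) 1 γ (Icc 0 1) ∧ ∀ τ ∈ Icc (0 : ℝ) 1, 𝒢.s (γ τ) = x

variable {g} {x : M} {γ : ℝ → G}

lemma fiberEDist_le {a b : G} (hγ : 𝒢.IsFiberCurve (𝒢.s a) γ) (h0 : γ 0 = a) (h1 : γ 1 = b) :
    𝒢.fiberEDist g a b ≤ ∫⁻ τ in Icc (0 : ℝ) 1, 𝒢.speed g γ τ :=
  iInf₂_le (f := fun (γ : ℝ → G) (_ : ContMDiffOn 𝓘(ℝ, ℝ) (𝓡 (m + n)) 1 γ (Icc 0 1) ∧ γ 0 = a ∧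
      γ 1 = b ∧ ∀ τ ∈ Icc (0 : ℝ) 1, γ τ ∈ 𝒢.fiber (𝒢.s a)) =>
      ∫⁻ τ in Icc (0 : ℝ) 1, 𝒢.speed g γ τ) γ ⟨hγ.1, h0, h1, hγ.2⟩

lemma exists_curve_of_fiberEDist_lt {a b : G} {r : ℝ≥0∞} (h : 𝒢.fiberEDist g a b < r) :
    ∃ γ, 𝒢.IsFiberCurve (𝒢.s a) γ ∧ γ 0 = a ∧ γ 1 = b ∧
      ∫⁻ τ in Icc (0 : ℝ) 1, 𝒢.speed g γ τ < r := by
  rw [fiberEDist] at h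
  simp only [iInf_lt_iff] at h
  obtain ⟨γ, ⟨h1, h2, h3, h4⟩, h5⟩ := h
  exact ⟨γ, ⟨h1, h4⟩, h2, h3, h5⟩

lemma uniqueDiffWithinAt_Icc_zero_one {τ : ℝ} (hτ : τ ∈ Icc (0 : ℝ) 1) :
    UniqueDiffWithinAt ℝ (Icc (0 : ℝ) 1) τ := uniqueDiffOn_Icc zero_lt_one τ hτ

namespace IsFiberCurve

lemma mdifferentiableWithinAt (hγ : 𝒢.IsFiberCurve x γ) {τ : ℝ} (hτ : τ ∈ Icc (0 : ℝ) 1) :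
    MDifferentiableWithinAt 𝓘(ℝ, ℝ) (𝓡 (m + n)) γ (Icc 0 1) τ :=
  (hγ.1 τ hτ).mdifferentiableWithinAt (by simp)

lemma mul_right (hγ : 𝒢.IsFiberCurve x γ) {b : G} (hb : 𝒢.t b = x) :
    𝒢.IsFiberCurve (𝒢.s b) (fun τ => 𝒢.mul (γ τ) b) := by
  refine ⟨?_, fun τ hτ => 𝒢.s_mul _ _ ((hγ.2 τ hτ).trans hb.symm)⟩
  exact ((𝒢.contMDiffOn_mul_right b).of_le (by exact_mod_cast le_top)).comp hγ.1
    (fun τ hτ => (hγ.2 τ hτ).trans hb.symm)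

lemma speed_mul_right (hγ : 𝒢.IsFiberCurve x γ) {b : G} (hb : 𝒢.t b = x) {τ : ℝ}
    (hτ : τ ∈ Icc (0 : ℝ) 1) : 𝒢.speed g (fun τ => 𝒢.mul (γ τ) b) τ = 𝒢.speed g γ τ := by
  rw [speed, speed]
  congr 2
  exact gS_mul_right (ψ := γ) g (hγ.mdifferentiableWithinAt hτ) hγ.2 hτ
    (uniqueDiffWithinAt_Icc_zero_one hτ) hb 1 1

lemma vertical (hγ : 𝒢.IsFiberCurve x γ) {τ : ℝ} (hτ : τ ∈ Icc (0 : ℝ) 1) :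
    mfderiv (𝓡 (m + n)) (𝓡 m) 𝒢.s (γ τ)
      (mfderivWithin 𝓘(ℝ, ℝ) (𝓡 (m + n)) γ (Icc 0 1) τ (1 : ℝ)) = 0 := by
  have h1 := HasMFDerivAt.comp_hasMFDerivWithinAt (g := 𝒢.s) (f := γ) τ
    ((𝒢.smooth_s (γ τ)).mdifferentiableAt (by simp)).hasMFDerivAt
    (hγ.mdifferentiableWithinAt hτ).hasMFDerivWithinAt
  have h2 := HasMFDerivWithinAt.congr_mono
    (hasMFDerivWithinAt_const (I := 𝓘(ℝ, ℝ)) (I' := 𝓡 m) x (s := Icc (0 : ℝ) 1) τ)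
    (f₁ := 𝒢.s ∘ γ) hγ.2 (hγ.2 τ hτ) Subset.rfl
  have hu := (uniqueDiffWithinAt_Icc_zero_one hτ).uniqueMDiffWithinAt
  exact DFunLike.congr_fun ((h1.mfderivWithin hu).symm.trans (h2.mfderivWithin hu)) (1 : ℝ)

lemma hasDerivWithinAt_comp (hγ : 𝒢.IsFiberCurve x γ) {h : G → ℝ}
    (hh : ContMDiff (𝓡 (m + n)) 𝓘(ℝ, ℝ) ∞ h) {τ : ℝ} (hτ : τ ∈ Icc (0 : ℝ) 1) :
    HasDerivWithinAt (h ∘ γ) (differentialAt h (γ τ)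
      (mfderivWithin 𝓘(ℝ, ℝ) (𝓡 (m + n)) γ (Icc 0 1) τ (1 : ℝ))) (Icc 0 1) τ := by
  have h1 := HasMFDerivAt.comp_hasMFDerivWithinAt (g := h) (f := γ) τ
    ((hh (γ τ)).mdifferentiableAt (by simp)).hasMFDerivAt
    (hγ.mdifferentiableWithinAt hτ).hasMFDerivWithinAt
  exact HasFDerivWithinAt.hasDerivWithinAt (f' := show ℝ →L[ℝ] ℝ from
    (mfderiv (𝓡 (m + n)) 𝓘(ℝ, ℝ) h (γ τ)).comp
      (mfderivWithin 𝓘(ℝ, ℝ) (𝓡 (m + n)) γ (Icc 0 1) τ)) h1.hasFDerivWithinAt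

/-- The velocity is vertical, so the gradient bound applies along the curve; integrate the
derivative of `h ∘ γ`. -/
lemma enorm_sub_le [IsManifold (𝓡 m) ∞ M] (hγ : 𝒢.IsFiberCurve x γ) {h : G → ℝ}
    (hh : ContMDiff (𝓡 (m + n)) 𝓘(ℝ, ℝ) ∞ h) {C : ℝ} (hC0 : 0 < C)
    (hC : ∀ (a : G) (v : TangentSpace (𝓡 (m + n)) a),
      mfderiv (𝓡 (m + n)) (𝓡 m) 𝒢.s a v = 0 →
      |differentialAt h a v| ≤ C * Real.sqrt (𝒢.gS g a v v))
    {τ₀ τ₁ : ℝ} (h0 : 0 ≤ τ₀) (h01 : τ₀ ≤ τ₁) (h1 : τ₁ ≤ 1) :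
    ‖h (γ τ₁) - h (γ τ₀)‖ₑ ≤ ENNReal.ofReal C * ∫⁻ τ in Icc τ₀ τ₁, 𝒢.speed g γ τ := by
  rcases h01.eq_or_lt with rfl | hlt
  · simp
  have hsub : Icc τ₀ τ₁ ⊆ Icc (0 : ℝ) 1 := Icc_subset_Icc h0 h1
  have hcd : ContDiffOn ℝ 1 (h ∘ γ) (Icc τ₀ τ₁) := by
    rw [← contMDiffOn_iff_contDiffOn]
    exact ((hh.of_le (by exact_mod_cast le_top)).comp_contMDiffOn hγ.1).mono hsub
  refine (enorm_sub_le_lintegral_derivWithin_Icc_of_contDiffOn_Icc hcd h01).trans ?_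
  rw [← lintegral_const_mul' _ _ ENNReal.ofReal_ne_top]
  refine setLIntegral_mono' measurableSet_Icc fun τ hτ => ?_
  rw [((hγ.hasDerivWithinAt_comp hh (hsub hτ)).mono hsub).derivWithin
    (uniqueDiffOn_Icc hlt τ hτ), speed, ← ENNReal.ofReal_mul hC0.le, Real.enorm_eq_ofReal_abs]
  exact ENNReal.ofReal_le_ofReal (hC _ _ (hγ.vertical (hsub hτ)))

end IsFiberCurve

/-! ### Relative compactness of balls around the units. -/

section Proper

variable (𝒢) in
/-- Products of at most `N + 1` elements of `K`. -/
def powSet (K : Set G) : ℕ → Set G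
  | 0 => K
  | N + 1 => powSet K N ∪
      (fun p : G × G => 𝒢.mul p.1 p.2) '' ((powSet K N ×ˢ K) ∩ {p | 𝒢.s p.1 = 𝒢.t p.2})

omit [IsManifold (𝓡 (m + n)) ∞ G] in
lemma isCompact_powSet [T2Space M] {K : Set G} (hK : IsCompact K) (N : ℕ) :
    IsCompact (𝒢.powSet K N) := by
  induction N with
  | zero => exact hK
  | succ N ih =>
    refine ih.union (((ih.prod hK).inter_right 𝒢.isClosed_composable).image_of_continuousOn ?_)
    exact 𝒢.continuousOn_mul.mono inter_subset_right

omit [IsManifold (𝓡 (m + n)) ∞ G] in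
lemma subset_powSet (K : Set G) (N : ℕ) : K ⊆ 𝒢.powSet K N := by
  induction N with
  | zero => exact Subset.rfl
  | succ N ih => exact ih.trans subset_union_left

lemma exists_bump [T2Space G] [SecondCountableTopology G] {K : Set G} (hK : IsCompact K) :
    ∃ h : G → ℝ, ContMDiff (𝓡 (m + n)) 𝓘(ℝ, ℝ) ∞ h ∧ HasCompactSupport h ∧ (∀ a ∈ K, h a = 1) ∧
      ∀ a, h a ∈ Icc (0 : ℝ) 1 := by
  have : LocallyCompactSpace G := Manifold.locallyCompact_of_finiteDimensional (𝓡 (m + n))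
  obtain ⟨K', hK', hKK'⟩ := exists_compact_superset hK
  obtain ⟨f, h1, h2, h3⟩ := exists_contMDiffMap_one_nhds_of_subset_interior (n := (⊤ : ℕ∞))
    (𝓡 (m + n)) hK.isClosed hKK'
  refine ⟨f, f.contMDiff, HasCompactSupport.intro hK' h2, fun a ha => h1.self_of_nhdsSet a ha, h3⟩

variable [IsManifold (𝓡 m) ∞ M]

/-- The translated curve γ(τ)γ(τ₀)⁻¹ starts at a unit, where `h` is 1. If `h` does not stay positive
up to the endpoint, it takes the value 1/2 at some τ₁, and by right invariance this costs length at
least 1/(2C). The rest of the curve, translated afresh from τ₁, has a budget smaller by one unit,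
and γ(1)γ(τ₀)⁻¹ is the product of γ(1)γ(τ₁)⁻¹, handled by induction, with γ(τ₁)γ(τ₀)⁻¹ in the
support. -/
lemma IsFiberCurve.div_mem_powSet (hγ : 𝒢.IsFiberCurve x γ) {h : G → ℝ}
    (hh : ContMDiff (𝓡 (m + n)) 𝓘(ℝ, ℝ) ∞ h) (hu : ∀ y, h (𝒢.unit y) = 1) {C : ℝ} (hC0 : 0 < C)
    (hC : ∀ (a : G) (v : TangentSpace (𝓡 (m + n)) a),
      mfderiv (𝓡 (m + n)) (𝓡 m) 𝒢.s a v = 0 →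
      |differentialAt h a v| ≤ C * Real.sqrt (𝒢.gS g a v v)) (N : ℕ) :
    ∀ τ₀ ∈ Icc (0 : ℝ) 1, ∫⁻ τ in Icc τ₀ 1, 𝒢.speed g γ τ <
      (N + 1 : ℕ) * ENNReal.ofReal (1 / (2 * C)) →
      𝒢.mul (γ 1) (𝒢.inv (γ τ₀)) ∈ 𝒢.powSet (tsupport h) N := by
  have h1mem : (1 : ℝ) ∈ Icc (0 : ℝ) 1 := ⟨zero_le_one, le_rfl⟩
  have hstart : ∀ τ₀ ∈ Icc (0 : ℝ) 1, h (𝒢.mul (γ τ₀) (𝒢.inv (γ τ₀))) = 1 := fun τ₀ _ => by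
    rw [𝒢.mul_inv, hu]
  -- a drop of `h` by one half along the translated curve costs a definite length
  have hdrop : ∀ τ₀ ∈ Icc (0 : ℝ) 1, ∀ τ₁ ∈ Icc τ₀ 1,
      h (𝒢.mul (γ τ₁) (𝒢.inv (γ τ₀))) ≤ 1 / 2 →
      ENNReal.ofReal (1 / (2 * C)) ≤ ∫⁻ τ in Icc τ₀ τ₁, 𝒢.speed g γ τ := by
    intro τ₀ hτ₀ τ₁ hτ₁ hle
    have hb : 𝒢.t (𝒢.inv (γ τ₀)) = x := (𝒢.t_inv _).trans (hγ.2 τ₀ hτ₀)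
    have h2 := (hγ.mul_right hb).enorm_sub_le (g := g) hh hC0 hC hτ₀.1 hτ₁.1 hτ₁.2
    rw [hstart τ₀ hτ₀] at h2
    have h3 : ENNReal.ofReal (1 / 2) ≤ ‖h (𝒢.mul (γ τ₁) (𝒢.inv (γ τ₀))) - 1‖ₑ := by
      rw [Real.enorm_eq_ofReal_abs]
      refine ENNReal.ofReal_le_ofReal ?_
      rw [abs_sub_comm]
      exact le_trans (by linarith) (le_abs_self _)
    have h4 : ∫⁻ τ in Icc τ₀ τ₁, 𝒢.speed g (fun τ => 𝒢.mul (γ τ) (𝒢.inv (γ τ₀))) τ =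
        ∫⁻ τ in Icc τ₀ τ₁, 𝒢.speed g γ τ :=
      setLIntegral_congr_fun measurableSet_Icc fun τ hτ =>
        hγ.speed_mul_right hb ⟨hτ₀.1.trans hτ.1, hτ.2.trans hτ₁.2⟩
    rw [h4] at h2
    have h5 : ENNReal.ofReal (1 / (2 * C)) = ENNReal.ofReal (1 / 2) / ENNReal.ofReal C := by
      rw [← ENNReal.ofReal_div_of_pos hC0]
      congr 1
      field_simp
    rw [h5]
    exact ENNReal.div_le_of_le_mul' (h3.trans h2)
  induction N with
  | zero =>
    intro τ₀ hτ₀ hlt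
    refine subset_tsupport _ ?_
    rw [Function.mem_support]
    intro h0
    refine absurd (hdrop τ₀ hτ₀ 1 ⟨hτ₀.2, le_rfl⟩ (by rw [h0]; norm_num)) (not_le.2 ?_)
    simpa using hlt
  | succ N ih =>
    intro τ₀ hτ₀ hlt
    by_cases hpos : 0 < h (𝒢.mul (γ 1) (𝒢.inv (γ τ₀)))
    · exact subset_powSet _ _ (subset_tsupport _ (Function.mem_support.2 hpos.ne'))
    have hb : 𝒢.t (𝒢.inv (γ τ₀)) = x := (𝒢.t_inv _).trans (hγ.2 τ₀ hτ₀)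
    have hcont : ContinuousOn (fun τ => h (𝒢.mul (γ τ) (𝒢.inv (γ τ₀)))) (Icc τ₀ 1) :=
      (hh.continuous.comp_continuousOn (hγ.mul_right hb).1.continuousOn).mono
        (Icc_subset_Icc_left hτ₀.1)
    -- The value 1/2 is low enough to have cost a definite length and still nonzero, so that the
    -- point reached lies in the support.
    obtain ⟨τ₁, hτ₁, hval⟩ : (1 / 2 : ℝ) ∈ (fun τ => h (𝒢.mul (γ τ) (𝒢.inv (γ τ₀)))) '' Icc τ₀ 1 :=
      intermediate_value_Icc' hτ₀.2 hcont
        ⟨(not_lt.1 hpos).trans (by norm_num), by rw [hstart τ₀ hτ₀]; norm_num⟩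
    simp only at hval
    have hτ₁' : τ₁ ∈ Icc (0 : ℝ) 1 := ⟨hτ₀.1.trans hτ₁.1, hτ₁.2⟩
    have hK : 𝒢.mul (γ τ₁) (𝒢.inv (γ τ₀)) ∈ tsupport h :=
      subset_tsupport _ (Function.mem_support.2 (by rw [hval]; norm_num))
    have hcost := hdrop τ₀ hτ₀ τ₁ hτ₁ hval.le
    have hsplit : ∫⁻ τ in Icc τ₀ 1, 𝒢.speed g γ τ =
        (∫⁻ τ in Icc τ₀ τ₁, 𝒢.speed g γ τ) + ∫⁻ τ in Icc τ₁ 1, 𝒢.speed g γ τ := by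
      rw [← Icc_union_Ioc_eq_Icc hτ₁.1 hτ₁.2, lintegral_union measurableSet_Ioc,
        restrict_Ioc_eq_restrict_Icc]
      exact disjoint_left.2 fun τ h1 h2 => (h2.1.trans_le h1.2).false
    have hrest : ∫⁻ τ in Icc τ₁ 1, 𝒢.speed g γ τ <
        (N + 1 : ℕ) * ENNReal.ofReal (1 / (2 * C)) := by
      have h6 : ENNReal.ofReal (1 / (2 * C)) + ∫⁻ τ in Icc τ₁ 1, 𝒢.speed g γ τ <
          ENNReal.ofReal (1 / (2 * C)) + (N + 1 : ℕ) * ENNReal.ofReal (1 / (2 * C)) := by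
        refine lt_of_le_of_lt (add_le_add_left hcost _) ?_
        rw [← hsplit]
        refine hlt.trans_eq ?_
        push_cast
        ring
      exact (ENNReal.add_lt_add_iff_left ENNReal.ofReal_ne_top).1 h6
    have hs1 : 𝒢.s (γ 1) = 𝒢.s (γ τ₁) := (hγ.2 1 h1mem).trans (hγ.2 τ₁ hτ₁').symm
    have hs2 : 𝒢.s (γ τ₁) = 𝒢.s (γ τ₀) := (hγ.2 τ₁ hτ₁').trans (hγ.2 τ₀ hτ₀).symm
    refine Or.inr ⟨(𝒢.mul (γ 1) (𝒢.inv (γ τ₁)), 𝒢.mul (γ τ₁) (𝒢.inv (γ τ₀))),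
      ⟨⟨ih τ₁ hτ₁' hrest, hK⟩, ?_⟩, div_mul_div hs1 hs2⟩
    exact (s_div hs1).trans (t_div hs2).symm

variable (𝒢 g) in
/-- The balls around the units are relatively compact. -/
theorem exists_isCompact_ball [T2Space G] [SecondCountableTopology G] [T2Space M] [CompactSpace M]
    (R : ℝ) : ∃ K : Set G, IsCompact K ∧
      ∀ a : G, 𝒢.fiberEDist g (𝒢.unit (𝒢.s a)) a < ENNReal.ofReal R → a ∈ K := by
  obtain ⟨h, hh, hcpt, hu, -⟩ := exists_bump (m := m) (n := n)
    (isCompact_range 𝒢.continuous_unit)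
  obtain ⟨C, hC0, hC⟩ := exists_abs_mfderiv_le (𝒢 := 𝒢) g hh hcpt
  -- With this N, the budget (N + 1)/(2C) is at least R.
  obtain ⟨N, hN⟩ := exists_nat_ge (R * (2 * C))
  refine ⟨𝒢.powSet (tsupport h) N, isCompact_powSet hcpt N, fun a ha => ?_⟩
  obtain ⟨γ, hγ, h0, h1, hlen⟩ := exists_curve_of_fiberEDist_lt ha
  have h2 := hγ.div_mem_powSet (g := g) hh (fun y => hu _ ⟨y, rfl⟩) hC0 hC N 0
    ⟨le_rfl, zero_le_one⟩ (hlen.trans_le ?_)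
  · rwa [h0, h1, div_unit] at h2
  · rw [← ENNReal.ofReal_natCast, ← ENNReal.ofReal_mul (Nat.cast_nonneg _)]
    refine ENNReal.ofReal_le_ofReal ?_
    rw [mul_one_div, le_div_iff₀ (by positivity)]
    push_cast
    linarith

end Proper

end Curves

/-! ### Symmetry, finiteness and local boundedness of the fibre distance. -/

section Distance

variable {m n : ℕ} {G M : Type u}
  [TopologicalSpace G] [ChartedSpace (EuclideanSpace ℝ (Fin (m + n))) G]
  [TopologicalSpace M] [ChartedSpace (EuclideanSpace ℝ (Fin m)) M]
  {𝒢 : LieGroupoid m n G M}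
  [IsManifold (𝓡 (m + n)) ∞ G] {g : AmbientMetric m n G}

/-- Reverse the curve: the metric is quadratic in the velocity, and τ ↦ 1 - τ preserves Lebesgue
measure on the unit interval. -/
lemma fiberEDist_comm_le {a b : G} (h : 𝒢.s a = 𝒢.s b) :
    𝒢.fiberEDist g a b ≤ 𝒢.fiberEDist g b a := by
  refine le_of_forall_gt fun r hr => ?_
  obtain ⟨γ, hγ, h0, h1, hlen⟩ := exists_curve_of_fiberEDist_lt hr
  have hmaps : MapsTo (fun τ : ℝ => 1 - τ) (Icc 0 1) (Icc 0 1) := fun τ hτ =>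
    ⟨by linarith [hτ.2], by linarith [hτ.1]⟩
  have hsub : ContMDiff 𝓘(ℝ, ℝ) 𝓘(ℝ, ℝ) 1 (fun τ : ℝ => 1 - τ) :=
    (contDiff_const.sub contDiff_id).contMDiff
  have hγ' : 𝒢.IsFiberCurve (𝒢.s a) (fun τ => γ (1 - τ)) := by
    refine ⟨hγ.1.comp hsub.contMDiffOn hmaps, fun τ hτ => (hγ.2 _ (hmaps hτ)).trans h.symm⟩
  refine (fiberEDist_le hγ' (by simpa using h1) (by simpa using h0)).trans_lt
    (lt_of_eq_of_lt ?_ hlen)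
  have hspeed : ∀ τ ∈ Icc (0 : ℝ) 1, 𝒢.speed g (fun τ => γ (1 - τ)) τ = 𝒢.speed g γ (1 - τ) := by
    intro τ hτ
    have hd : HasMFDerivWithinAt 𝓘(ℝ, ℝ) 𝓘(ℝ, ℝ) (fun τ : ℝ => 1 - τ) (Icc 0 1) τ
        (-(ContinuousLinearMap.id ℝ ℝ)) :=
      (((hasFDerivAt_id τ).const_sub 1).hasMFDerivAt).hasMFDerivWithinAt
    have hc := (HasMFDerivWithinAt.comp (g := γ) (f := fun τ : ℝ => 1 - τ) τ
      (hγ.mdifferentiableWithinAt (hmaps hτ)).hasMFDerivWithinAt hd hmaps).mfderivWithin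
      (uniqueDiffWithinAt_Icc_zero_one hτ).uniqueMDiffWithinAt
    have hv : mfderivWithin 𝓘(ℝ, ℝ) (𝓡 (m + n)) (fun τ => γ (1 - τ)) (Icc 0 1) τ (1 : ℝ) =
        (-1 : ℝ) • mfderivWithin 𝓘(ℝ, ℝ) (𝓡 (m + n)) γ (Icc 0 1) (1 - τ) (1 : ℝ) := by
      refine (DFunLike.congr_fun hc (1 : ℝ)).trans ?_
      refine Eq.trans ?_ (map_smul (mfderivWithin 𝓘(ℝ, ℝ) (𝓡 (m + n)) γ (Icc 0 1) (1 - τ))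
        (-1 : ℝ) (1 : ℝ))
      refine congrArg (mfderivWithin 𝓘(ℝ, ℝ) (𝓡 (m + n)) γ (Icc 0 1) (1 - τ)) ?_
      change -(1 : ℝ) = (-1 : ℝ) • (1 : ℝ)
      simp
    rw [speed, speed, hv, gS_smul_smul]
    simp
  rw [setLIntegral_congr_fun measurableSet_Icc hspeed]
  have hpre : (fun τ : ℝ => 1 - τ) ⁻¹' Icc 0 1 = Icc 0 1 := by
    ext τ
    simp only [mem_preimage, mem_Icc]
    constructor <;> rintro ⟨h1, h2⟩ <;> constructor <;> linarith
  have := (Measure.measurePreserving_sub_left (volume : Measure ℝ) 1).setLIntegral_comp_preimage_emb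
    (MeasurableEquiv.subLeft (1 : ℝ)).measurableEmbedding (𝒢.speed g γ) (Icc 0 1)
  rwa [hpre] at this

lemma fiberDist_comm {a b : G} (h : 𝒢.s a = 𝒢.s b) : 𝒢.fiberDist g a b = 𝒢.fiberDist g b a := by
  rw [fiberDist, fiberDist,
    le_antisymm (fiberEDist_comm_le (g := g) h) (fiberEDist_comm_le (g := g) h.symm)]

variable (𝒢 g) in
/-- `a` and `b` are joined by a `C¹` curve in their fibre, constant near its ends and with squared
speed at most `R`. -/
def BoundedJoined (R : ℝ) (a b : G) : Prop :=
  ∃ γ : ℝ → G, ContMDiff 𝓘(ℝ, ℝ) (𝓡 (m + n)) 1 γ ∧ 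
    (∃ κ > (0 : ℝ), (∀ τ ≤ κ, γ τ = a) ∧ ∀ τ, 1 - κ ≤ τ → γ τ = b) ∧ (∀ τ, 𝒢.s (γ τ) = 𝒢.s a) ∧
    ∀ τ ∈ Icc (0 : ℝ) 1, 𝒢.gS g (γ τ) (mfderiv 𝓘(ℝ, ℝ) (𝓡 (m + n)) γ τ (1 : ℝ))
      (mfderiv 𝓘(ℝ, ℝ) (𝓡 (m + n)) γ τ (1 : ℝ)) ≤ R

lemma BoundedJoined.fiberEDist_le {R : ℝ} {a b : G} (h : 𝒢.BoundedJoined g R a b) :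
    𝒢.fiberEDist g a b ≤ ENNReal.ofReal (Real.sqrt R) := by
  obtain ⟨γ, h1, ⟨κ, hκ, h2, h3⟩, h4, h5⟩ := h
  refine (LieGroupoid.fiberEDist_le ⟨h1.contMDiffOn, fun τ _ => h4 τ⟩ (h2 0 hκ.le)
    (h3 1 (by linarith))).trans ?_
  calc ∫⁻ τ in Icc (0 : ℝ) 1, 𝒢.speed g γ τ
      ≤ ∫⁻ _ in Icc (0 : ℝ) 1, ENNReal.ofReal (Real.sqrt R) := by
        refine setLIntegral_mono' measurableSet_Icc fun τ hτ => ?_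
        rw [speed, mfderivWithin_eq_mfderiv
          (uniqueDiffWithinAt_Icc_zero_one hτ).uniqueMDiffWithinAt
          ((h1 τ).mdifferentiableAt (by simp))]
        exact ENNReal.ofReal_le_ofReal (Real.sqrt_le_sqrt (h5 τ hτ))
    _ = ENNReal.ofReal (Real.sqrt R) := by simp

lemma gS_mfderiv_comp_affine {γ : ℝ → G} {k c τ : ℝ}
    (hγ : MDifferentiableAt 𝓘(ℝ, ℝ) (𝓡 (m + n)) γ (k * τ + c)) :
    𝒢.gS g (γ (k * τ + c))
      (mfderiv 𝓘(ℝ, ℝ) (𝓡 (m + n)) (fun τ => γ (k * τ + c)) τ (1 : ℝ))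
      (mfderiv 𝓘(ℝ, ℝ) (𝓡 (m + n)) (fun τ => γ (k * τ + c)) τ (1 : ℝ)) =
    k ^ 2 * 𝒢.gS g (γ (k * τ + c)) (mfderiv 𝓘(ℝ, ℝ) (𝓡 (m + n)) γ (k * τ + c) (1 : ℝ))
      (mfderiv 𝓘(ℝ, ℝ) (𝓡 (m + n)) γ (k * τ + c) (1 : ℝ)) := by
  have hd : HasMFDerivAt 𝓘(ℝ, ℝ) 𝓘(ℝ, ℝ) (fun τ : ℝ => k * τ + c) τ
      (k • ContinuousLinearMap.id ℝ ℝ) :=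
    HasFDerivAt.hasMFDerivAt (((hasFDerivAt_id τ).const_mul k).add_const c)
  have hc := (HasMFDerivAt.comp (g := γ) (f := fun τ : ℝ => k * τ + c) τ
    hγ.hasMFDerivAt hd).mfderiv
  have hv : mfderiv 𝓘(ℝ, ℝ) (𝓡 (m + n)) (fun τ => γ (k * τ + c)) τ (1 : ℝ) =
      k • mfderiv 𝓘(ℝ, ℝ) (𝓡 (m + n)) γ (k * τ + c) (1 : ℝ) := by
    refine (DFunLike.congr_fun hc (1 : ℝ)).trans ?_
    exact map_smul (mfderiv 𝓘(ℝ, ℝ) (𝓡 (m + n)) γ (k * τ + c)) k (1 : ℝ)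
  exact (congrArg₂ (𝒢.gS g (γ (k * τ + c))) hv hv).trans (gS_smul_smul g _ _ k)

lemma gS_mfderiv_congr {γ γ' : ℝ → G} {τ : ℝ} (h : γ =ᶠ[𝓝 τ] γ') :
    𝒢.gS g (γ τ) (mfderiv 𝓘(ℝ, ℝ) (𝓡 (m + n)) γ τ (1 : ℝ))
      (mfderiv 𝓘(ℝ, ℝ) (𝓡 (m + n)) γ τ (1 : ℝ)) =
    𝒢.gS g (γ' τ) (mfderiv 𝓘(ℝ, ℝ) (𝓡 (m + n)) γ' τ (1 : ℝ))
      (mfderiv 𝓘(ℝ, ℝ) (𝓡 (m + n)) γ' τ (1 : ℝ)) := by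
  let B : G → EuclideanSpace ℝ (Fin (m + n)) → EuclideanSpace ℝ (Fin (m + n)) → ℝ :=
    fun p v w => 𝒢.gS g p v w
  have h1 : (mfderiv 𝓘(ℝ, ℝ) (𝓡 (m + n)) γ τ (1 : ℝ) : EuclideanSpace ℝ (Fin (m + n))) =
      mfderiv 𝓘(ℝ, ℝ) (𝓡 (m + n)) γ' τ (1 : ℝ) :=
    DFunLike.congr_fun (h.mfderiv_eq (I := 𝓘(ℝ, ℝ)) (I' := 𝓡 (m + n))) (1 : ℝ)
  change B (γ τ) _ _ = B (γ' τ) _ _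
  rw [h.self_of_nhds]
  exact congrArg₂ _ h1 h1

/-- Run both curves at double speed, which multiplies squared speeds by 2². Constancy near the ends
is what keeps the concatenation C¹. -/
lemma BoundedJoined.trans {R R' : ℝ} {a b c : G} (h : 𝒢.BoundedJoined g R a b)
    (h' : 𝒢.BoundedJoined g R' b c) : 𝒢.BoundedJoined g (2 ^ 2 * max R R') a c := by
  obtain ⟨γ, h1, ⟨κ, hκ, h2, h3⟩, h4, h5⟩ := h
  obtain ⟨γ', h1', ⟨κ', hκ', h2', h3'⟩, h4', h5'⟩ := h'
  have hab : 𝒢.s b = 𝒢.s a := by rw [← h3 1 (by linarith), h4]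
  set η : ℝ → G := fun τ => if τ ≤ 1 / 2 then γ (2 * τ + 0) else γ' (2 * τ + -1) with hη
  -- Around 1/2 both curves rest at `b`, so the two formulas for `η` hold on overlapping open
  -- intervals.
  have hleft : ∀ τ < 1 / 2 + κ' / 2, η τ = γ (2 * τ + 0) := by
    intro τ hτ
    simp only [hη]
    split_ifs with hs
    · rfl
    · rw [h2' _ (by linarith), h3 _ (by linarith)]
  have hright : ∀ τ, 1 / 2 - κ / 2 < τ → η τ = γ' (2 * τ + -1) := by
    intro τ hτ
    simp only [hη]
    split_ifs with hs
    · rw [h2' _ (by linarith), h3 _ (by linarith)]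
    · rfl
  have hleft' : ∀ τ < 1 / 2 + κ' / 2, η =ᶠ[𝓝 τ] fun τ => γ (2 * τ + 0) := fun τ hτ =>
    Filter.eventuallyEq_of_mem (Iio_mem_nhds hτ) fun σ hσ => hleft σ hσ
  have hright' : ∀ τ, 1 / 2 - κ / 2 < τ → η =ᶠ[𝓝 τ] fun τ => γ' (2 * τ + -1) := fun τ hτ =>
    Filter.eventuallyEq_of_mem (Ioi_mem_nhds hτ) fun σ hσ => hright σ hσ
  have haff : ∀ c : ℝ, ContMDiff 𝓘(ℝ, ℝ) 𝓘(ℝ, ℝ) 1 (fun τ : ℝ => 2 * τ + c) := fun c =>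
    ((contDiff_const.mul contDiff_id).add contDiff_const).contMDiff
  refine ⟨η, ?_, ?_, ?_, ?_⟩
  · intro τ
    rcases lt_or_ge τ (1 / 2 + κ' / 2) with hτ | hτ
    · exact ((h1.comp (haff 0)) τ).congr_of_eventuallyEq (hleft' τ hτ)
    · exact ((h1'.comp (haff (-1))) τ).congr_of_eventuallyEq (hright' τ (by linarith))
  · refine ⟨min (1 / 2) (min κ κ' / 2), by positivity, fun τ hτ => ?_, fun τ hτ => ?_⟩
    · have e1 := hτ.trans (min_le_left _ _)
      have e2 := hτ.trans (min_le_right _ _)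
      have e3 := min_le_left κ κ'
      rw [hleft τ (by linarith), h2 _ (by linarith)]
    · have e1 := min_le_left (1 / 2) (min κ κ' / 2)
      have e2 := min_le_right (1 / 2) (min κ κ' / 2)
      have e3 := min_le_right κ κ'
      rw [hright τ (by linarith), h3' _ (by linarith)]
  · intro τ
    simp only [hη]
    split_ifs
    · exact h4 _
    · exact (h4' _).trans hab
  · intro τ hτ
    rcases le_or_gt τ (1 / 2) with hs | hs
    · rw [gS_mfderiv_congr (hleft' τ (by linarith)),
        gS_mfderiv_comp_affine (γ := γ) ((h1 _).mdifferentiableAt (by simp))]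
      refine mul_le_mul_of_nonneg_left ((h5 _ ⟨?_, ?_⟩).trans (le_max_left _ _)) (by positivity)
      · linarith [hτ.1]
      · linarith
    · rw [gS_mfderiv_congr (hright' τ (by linarith)),
        gS_mfderiv_comp_affine (γ := γ') ((h1' _).mdifferentiableAt (by simp))]
      refine mul_le_mul_of_nonneg_left ((h5' _ ⟨?_, ?_⟩).trans (le_max_right _ _)) (by positivity)
      · linarith
      · linarith [hτ.2]

section Local

variable [IsManifold (𝓡 m) ∞ M]

lemma mfderiv_s_curve {γ : ℝ → G} {x : M} {τ : ℝ}
    (hγ : MDifferentiableAt 𝓘(ℝ, ℝ) (𝓡 (m + n)) γ τ) (hs : ∀ τ, 𝒢.s (γ τ) = x) :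
    mfderiv (𝓡 (m + n)) (𝓡 m) 𝒢.s (γ τ) (mfderiv 𝓘(ℝ, ℝ) (𝓡 (m + n)) γ τ (1 : ℝ)) = 0 := by
  have h1 := HasMFDerivAt.comp (g := 𝒢.s) (f := γ) τ
    ((𝒢.smooth_s (γ τ)).mdifferentiableAt (by simp)).hasMFDerivAt hγ.hasMFDerivAt
  have h2 := (hasMFDerivAt_const (I := 𝓘(ℝ, ℝ)) (I' := 𝓡 m) x τ).congr_of_eventuallyEq
    (f₁ := 𝒢.s ∘ γ) (Filter.Eventually.of_forall hs)
  exact DFunLike.congr_fun (hasMFDerivAt_unique h1 h2) (1 : ℝ)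

/-- A smooth function which is `0` near `(-∞, 0]` and `1` near `[1, ∞)`. -/
lemma exists_smooth_step : ∃ φ : ℝ → ℝ, ContDiff ℝ ∞ φ ∧ (∀ τ ≤ (1 / 4 : ℝ), φ τ = 0) ∧
    (∀ τ, 1 - (1 / 4 : ℝ) ≤ τ → φ τ = 1) ∧ (∀ τ, φ τ ∈ Icc (0 : ℝ) 1) ∧
    ∃ L : ℝ, ∀ τ ∈ Icc (0 : ℝ) 1, |deriv φ τ| ≤ L := by
  have hs : ContDiff ℝ ∞ (fun τ : ℝ => Real.smoothTransition (2 * τ - 1 / 2)) :=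
    Real.smoothTransition.contDiff.comp ((contDiff_const.mul contDiff_id).sub contDiff_const)
  refine ⟨_, hs, fun τ hτ => Real.smoothTransition.zero_of_nonpos (by linarith),
    fun τ hτ => Real.smoothTransition.one_of_one_le (by linarith),
    fun τ => ⟨Real.smoothTransition.nonneg _, Real.smoothTransition.le_one _⟩, ?_⟩
  obtain ⟨L, hL⟩ := isCompact_Icc.exists_bound_of_continuousOn (s := Icc (0 : ℝ) 1)
    (hs.continuous_deriv (by simp)).continuousOn
  exact ⟨L, hL⟩

variable (g) in
/-- Nearby points of a fibre are joined with bounded speed. -/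
lemma exists_boundedJoined_nhds (a₀ : G) : ∃ R : ℝ, ∃ U ∈ 𝓝 a₀, ∀ a ∈ U, ∀ b ∈ U,
    𝒢.s a = 𝒢.s b → 𝒢.BoundedJoined g R a b := by
  obtain ⟨Bx⟩ := 𝒢.nonempty_sourceBox a₀
  obtain ⟨c, C, -, hC, hb⟩ := Bx.form_bounds g Bx.mem
  obtain ⟨φ, hφ, hφ0, hφ1, hφI, L, hL⟩ := exists_smooth_step
  have hz₀ := Bx.e.map_source Bx.mem
  have hnear : ∀ᶠ z in 𝓝 (Bx.e a₀), z ∈ Bx.e.target ∧ ∀ δ, Bx.form g (Bx.e.symm z) δ δ ≤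
      C * ‖δ‖ ^ 2 := by
    refine (show ∀ᶠ z in 𝓝 (Bx.e a₀), z ∈ Bx.e.target from
      Bx.e.open_target.mem_nhds hz₀).and ?_
    have h1 : Tendsto Bx.e.symm (𝓝 (Bx.e a₀)) (𝓝 a₀) := by
      have := (Bx.e.continuousAt_symm hz₀).tendsto
      rwa [Bx.e.left_inv Bx.mem] at this
    filter_upwards [h1.eventually hb] with z hz δ using (hz δ).2
  obtain ⟨ρ, hρ, hball⟩ := Metric.eventually_nhds_iff_ball.1 hnear
  -- Speed bound for a segment of length at most 2ρ in the box, traversed through a step function of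
  -- slope at most L, with `C` comparing the metrics.
  refine ⟨C * (L * (2 * ρ)) ^ 2, Bx.e.source ∩ Bx.e ⁻¹' Metric.ball (Bx.e a₀) ρ,
    Filter.inter_mem (Bx.e.open_source.mem_nhds Bx.mem)
      ((Bx.e.continuousAt Bx.mem).preimage_mem_nhds (Metric.ball_mem_nhds _ hρ)), ?_⟩
  rintro a ⟨ha, ha'⟩ b ⟨hb, hb'⟩ hab
  have hfst : (Bx.e a).1 = (Bx.e b).1 := (Bx.s_eq_iff ha hb).1 hab
  set Δ := (Bx.e b).2 - (Bx.e a).2 with hΔ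
  have hdiff : Bx.e b = Bx.e a + (0, Δ) := by
    ext1
    · simp [hfst]
    · simp [hΔ]
  -- The segment keeps the first coordinate, hence the source, fixed, and it stays in the ball by
  -- convexity.
  set ζ : ℝ → EuclideanSpace ℝ (Fin m) × EuclideanSpace ℝ (Fin n) :=
    fun τ => Bx.e a + φ τ • ((0 : EuclideanSpace ℝ (Fin m)), Δ) with hζ
  have hζb : ∀ τ, ζ τ ∈ Metric.ball (Bx.e a₀) ρ := by
    intro τ
    have : ζ τ = (1 - φ τ) • Bx.e a + φ τ • Bx.e b := by
      rw [hdiff]; simp only [hζ]; module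
    rw [this]
    exact (convex_ball _ _) ha' hb' (by linarith [(hφI τ).2]) (hφI τ).1 (by ring)
  have hζs : ContDiff ℝ ∞ ζ := contDiff_const.add (hφ.smul contDiff_const)
  have hζt : ∀ τ, ζ τ ∈ Bx.e.target := fun τ => (hball _ (hζb τ)).1
  have hγ : ContMDiff 𝓘(ℝ, ℝ) (𝓡 (m + n)) ∞ (Bx.e.symm ∘ ζ) :=
    Bx.smooth_symm.comp_contMDiff hζs.contMDiff hζt
  have hsγ : ∀ τ, 𝒢.s ((Bx.e.symm ∘ ζ) τ) = 𝒢.s a := by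
    intro τ
    refine (Bx.s_eq_iff (Bx.e.map_target (hζt τ)) ha).2 ?_
    rw [Bx.e.right_inv (hζt τ)]
    simp [hζ]
  refine ⟨Bx.e.symm ∘ ζ, hγ.of_le (by exact_mod_cast le_top), ⟨1 / 4, by norm_num, ?_, ?_⟩,
    hsγ, ?_⟩
  · intro τ hτ
    simp only [Function.comp_apply, hζ, hφ0 τ hτ, zero_smul, add_zero]
    exact Bx.e.left_inv ha
  · intro τ hτ
    simp only [Function.comp_apply, hζ, hφ1 τ hτ, one_smul]
    rw [← hdiff, Bx.e.left_inv hb]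
  · intro τ hτ
    have hmem : (Bx.e.symm ∘ ζ) τ ∈ Bx.e.source := Bx.e.map_target (hζt τ)
    have hmd : MDifferentiableAt 𝓘(ℝ, ℝ) (𝓡 (m + n)) (Bx.e.symm ∘ ζ) τ :=
      (hγ τ).mdifferentiableAt (by simp)
    rw [← Bx.form_mfderiv_e g hmem (mfderiv_s_curve hmd hsγ) (mfderiv_s_curve hmd hsγ)]
    have hw : (mfderiv (𝓡 (m + n)) 𝓘(ℝ, EuclideanSpace ℝ (Fin m) × EuclideanSpace ℝ (Fin n)) Bx.e
        ((Bx.e.symm ∘ ζ) τ) (mfderiv 𝓘(ℝ, ℝ) (𝓡 (m + n)) (Bx.e.symm ∘ ζ) τ (1 : ℝ)) :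
        EuclideanSpace ℝ (Fin m) × EuclideanSpace ℝ (Fin n)) =
        deriv φ τ • ((0 : EuclideanSpace ℝ (Fin m)), Δ) := by
      have h1 := HasMFDerivAt.comp (g := Bx.e) (f := Bx.e.symm ∘ ζ) τ
        (Bx.mdifferentiableAt_e hmem).hasMFDerivAt hmd.hasMFDerivAt
      have h2 : HasDerivAt ζ (deriv φ τ • ((0 : EuclideanSpace ℝ (Fin m)), Δ)) τ :=
        (((hφ.differentiable (by simp)) τ).hasDerivAt.smul_const _).const_add _
      have h3 := h2.hasFDerivAt.hasMFDerivAt.congr_of_eventuallyEq (f₁ := Bx.e ∘ Bx.e.symm ∘ ζ)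
        (Filter.Eventually.of_forall fun τ => Bx.e.right_inv (hζt τ))
      refine (DFunLike.congr_fun (hasMFDerivAt_unique h1 h3) (1 : ℝ)).trans ?_
      exact one_smul ℝ _
    rw [hw]
    refine ((hball _ (hζb τ)).2 _).trans ?_
    refine mul_le_mul_of_nonneg_left ?_ hC.le
    refine pow_le_pow_left₀ (norm_nonneg _) ?_ 2
    have hΔn : ‖Δ‖ ≤ 2 * ρ := by
      have h4 : dist (Bx.e b) (Bx.e a) < ρ + ρ :=
        (dist_triangle_right _ _ (Bx.e a₀)).trans_lt (add_lt_add hb' ha')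
      have h5 : dist (Bx.e b).2 (Bx.e a).2 ≤ dist (Bx.e b) (Bx.e a) := le_max_right _ _
      rw [dist_eq_norm] at h5
      linarith
    have h6 := hL τ hτ
    have h7 : 0 ≤ L := (abs_nonneg _).trans h6
    change ‖deriv φ τ • Δ‖ ≤ _
    rw [norm_smul, Real.norm_eq_abs]
    exact mul_le_mul h6 hΔn (norm_nonneg _) h7

variable (𝒢 g) in
/-- All points near `b` are joined with a uniformly bounded speed to the unit of their fibre. -/
def UnitJoined (b : G) : Prop :=
  ∃ R : ℝ, ∀ᶠ b' in 𝓝 b, 𝒢.BoundedJoined g R (𝒢.unit (𝒢.s b')) b'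

lemma unitJoined_unit (x : M) : 𝒢.UnitJoined g (𝒢.unit x) := by
  obtain ⟨R, U, hU, h⟩ := exists_boundedJoined_nhds (𝒢 := 𝒢) g (𝒢.unit x)
  have hc : ContinuousAt (fun b => 𝒢.unit (𝒢.s b)) (𝒢.unit x) :=
    (𝒢.continuous_unit.comp 𝒢.continuous_s).continuousAt
  have hU' : U ∈ 𝓝 (𝒢.unit (𝒢.s (𝒢.unit x))) := by rwa [𝒢.s_unit]
  refine ⟨R, ?_⟩
  filter_upwards [hU, hc.preimage_mem_nhds hU'] with b hb hb'
  exact h _ hb' _ hb (𝒢.s_unit _)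

/-- For b' near b, the point of the box with the first coordinate of b' and the second of b₁ lies in
the fibre of b' and near b₁. It is joined to the unit with uniform bounds, and to b' inside the box.
This is the closedness half of the connectedness argument. -/
lemma eventually_unitJoined_imp (b : G) :
    ∀ᶠ b₁ in 𝓝 b, 𝒢.s b₁ = 𝒢.s b → 𝒢.UnitJoined g b₁ → 𝒢.UnitJoined g b := by
  obtain ⟨Bx⟩ := 𝒢.nonempty_sourceBox b
  obtain ⟨R, U, hU, h⟩ := exists_boundedJoined_nhds (𝒢 := 𝒢) g b
  filter_upwards [eventually_mem_nhds_iff.2 hU, Bx.e.open_source.mem_nhds Bx.mem] with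
    b₁ hb₁ hb₁s hs ⟨R₁, hR₁⟩
  set z : G → EuclideanSpace ℝ (Fin m) × EuclideanSpace ℝ (Fin n) :=
    fun b' => ((Bx.e b').1, (Bx.e b₁).2) with hz
  have hzb : z b = Bx.e b₁ := by
    ext1
    · exact (Bx.s_eq_iff Bx.mem hb₁s).1 hs.symm
    · rfl
  have hzc : ContinuousAt z b :=
    ((Bx.e.continuousAt Bx.mem).fst).prodMk continuousAt_const
  have hzt : ∀ᶠ b' in 𝓝 b, z b' ∈ Bx.e.target :=
    hzc.preimage_mem_nhds (Bx.e.open_target.mem_nhds (hzb ▸ Bx.e.map_source hb₁s))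
  have hpc : Tendsto (fun b' => Bx.e.symm (z b')) (𝓝 b) (𝓝 b₁) := by
    have h1 : ContinuousAt Bx.e.symm (z b) :=
      Bx.e.continuousAt_symm (hzb ▸ Bx.e.map_source hb₁s)
    have h2 := (ContinuousAt.comp (f := z) h1 hzc).tendsto
    simp only [Function.comp_apply, hzb, Bx.e.left_inv hb₁s] at h2
    exact h2
  refine ⟨2 ^ 2 * max R₁ R, ?_⟩
  filter_upwards [hU, Bx.e.open_source.mem_nhds Bx.mem, hzt, hpc.eventually hR₁,
    hpc.eventually hb₁] with b' hb'U hb's hb't hj hb₁U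
  have hs' : 𝒢.s (Bx.e.symm (z b')) = 𝒢.s b' := by
    refine (Bx.s_eq_iff (Bx.e.map_target hb't) hb's).2 ?_
    rw [Bx.e.right_inv hb't]
  rw [hs'] at hj
  exact hj.trans (h _ hb₁U _ hb'U hs')

/-- Within a connected fibre the property holds at the unit, is open because it concerns
neighbourhoods, and is closed by `eventually_unitJoined_imp`. -/
lemma unitJoined (hconn : 𝒢.SConnected) (b : G) : 𝒢.UnitJoined g b := by
  have hpre : PreconnectedSpace (𝒢.fiber (𝒢.s b)) :=
    Subtype.preconnectedSpace (hconn (𝒢.s b)).isPreconnected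
  set A : Set (𝒢.fiber (𝒢.s b)) := {c | 𝒢.UnitJoined g c.1} with hA
  have hopen : IsOpen A := by
    rw [isOpen_iff_mem_nhds]
    rintro c ⟨R, hR⟩
    have h1 : ∀ᶠ c' in 𝓝 c.1, 𝒢.UnitJoined g c' := by
      filter_upwards [eventually_eventually_nhds.2 hR] with c' hc' using ⟨R, hc'⟩
    exact continuous_subtype_val.continuousAt.eventually h1
  have hclosed : IsClosed A := by
    rw [← isOpen_compl_iff, isOpen_iff_mem_nhds]
    intro c hc
    have h1 : ∀ᶠ c' : 𝒢.fiber (𝒢.s b) in 𝓝 c, 𝒢.s c'.1 = 𝒢.s c.1 → 𝒢.UnitJoined g c'.1 →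
        𝒢.UnitJoined g c.1 :=
      continuous_subtype_val.continuousAt.eventually (eventually_unitJoined_imp c.1)
    filter_upwards [h1] with c' hc' hmem
    exact hc (hc' (c'.2.trans c.2.symm) hmem)
  have huniv := (show IsClopen A from ⟨hclosed, hopen⟩).eq_univ
    ⟨⟨𝒢.unit (𝒢.s b), 𝒢.s_unit _⟩, unitJoined_unit (g := g) _⟩
  exact (huniv ▸ mem_univ _ : (⟨b, rfl⟩ : 𝒢.fiber (𝒢.s b)) ∈ A)

lemma exists_fiberEDist_le_nhds (hconn : 𝒢.SConnected) (b : G) :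
    ∃ R : ℝ, ∀ᶠ b' in 𝓝 b, 𝒢.fiberEDist g (𝒢.unit (𝒢.s b')) b' ≤ ENNReal.ofReal R := by
  obtain ⟨R, hR⟩ := unitJoined (g := g) hconn b
  exact ⟨_, hR.mono fun b' h => h.fiberEDist_le⟩

/-- Excludes the case in which `toReal` would turn an infinite distance into 0 and place far points
in small balls. -/
lemma fiberEDist_ne_top (hconn : 𝒢.SConnected) (b : G) :
    𝒢.fiberEDist g (𝒢.unit (𝒢.s b)) b ≠ (⊤ : ℝ≥0∞) := by
  obtain ⟨R, hR⟩ := exists_fiberEDist_le_nhds (g := g) hconn b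
  exact (hR.self_of_nhds.trans_lt ENNReal.ofReal_lt_top).ne

/-- The distance from the units is locally bounded. -/
lemma exists_fiberDist_le_nhds (hconn : 𝒢.SConnected) (b : G) :
    ∃ R : ℝ, ∀ᶠ b' in 𝓝 b, 𝒢.fiberDist g (𝒢.unit (𝒢.s b')) b' ≤ R := by
  obtain ⟨R, hR⟩ := exists_fiberEDist_le_nhds (g := g) hconn b
  exact ⟨max R 0, hR.mono fun b' h => ENNReal.toReal_le_of_le_ofReal (le_max_right _ _)
    (h.trans (ENNReal.ofReal_le_ofReal (le_max_left _ _)))⟩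

/-- The distance from the units is bounded on compact sets. -/
lemma exists_fiberDist_le_of_isCompact (hconn : 𝒢.SConnected) {K : Set G} (hK : IsCompact K) :
    ∃ R : ℝ, ∀ b ∈ K, 𝒢.fiberDist g (𝒢.unit (𝒢.s b)) b ≤ R := by
  refine hK.induction_on (p := fun A => ∃ R : ℝ, ∀ b ∈ A, 𝒢.fiberDist g (𝒢.unit (𝒢.s b)) b ≤ R)
    ⟨0, by simp⟩ ?_ ?_ ?_
  · rintro A A' hA ⟨C, hC⟩
    exact ⟨C, fun a ha => hC a (hA ha)⟩
  · rintro A A' ⟨C, hC⟩ ⟨C', hC'⟩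
    refine ⟨max C C', fun a ha => ?_⟩
    rcases ha with ha | ha
    · exact (hC a ha).trans (le_max_left _ _)
    · exact (hC' a ha).trans (le_max_right _ _)
  · intro a _
    obtain ⟨C, hC⟩ := exists_fiberDist_le_nhds (g := g) hconn a
    exact ⟨_, mem_nhdsWithin_of_mem_nhds hC, C, fun b hb => hb⟩

variable (g) in
/-- Balls around the units, for the real valued distance, are relatively compact. -/
lemma exists_isCompact_fiberDist_le [T2Space G] [SecondCountableTopology G] [T2Space M]
    [CompactSpace M] (hconn : 𝒢.SConnected) (R : ℝ) : ∃ K : Set G, IsCompact K ∧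
      ∀ a : G, 𝒢.fiberDist g (𝒢.unit (𝒢.s a)) a ≤ R → a ∈ K := by
  obtain ⟨K, hK, h⟩ := exists_isCompact_ball 𝒢 g (R + 1)
  refine ⟨K, hK, fun a ha => h a ?_⟩
  have htop := fiberEDist_ne_top (g := g) hconn a
  rw [← ENNReal.ofReal_toReal htop]
  have h0 : 0 ≤ 𝒢.fiberDist g (𝒢.unit (𝒢.s a)) a := ENNReal.toReal_nonneg
  exact (ENNReal.ofReal_lt_ofReal_iff (by linarith)).2 (lt_of_le_of_lt ha (lt_add_one R))

end Local

end Distance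

/-! ### Fibre volumes: density, right invariance, finiteness, positivity. -/

section Volume

variable {m n : ℕ} {G M : Type u}
  [TopologicalSpace G] [ChartedSpace (EuclideanSpace ℝ (Fin (m + n))) G]
  [TopologicalSpace M] [ChartedSpace (EuclideanSpace ℝ (Fin m)) M]
  {𝒢 : LieGroupoid m n G M}

namespace SourceBox

variable {a₀ : G} (Bx : 𝒢.SourceBox a₀)

lemma mfderiv_e_mfderiv_param {a : G} {δ : EuclideanSpace ℝ (Fin n)} (h : δ ∈ Bx.slice a)
    (w : EuclideanSpace ℝ (Fin n)) :
    (mfderiv (𝓡 (m + n)) 𝓘(ℝ, EuclideanSpace ℝ (Fin m) × EuclideanSpace ℝ (Fin n)) Bx.e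
      (Bx.param a δ) (mfderiv (𝓡 n) (𝓡 (m + n)) (Bx.param a) δ w) :
      EuclideanSpace ℝ (Fin m) × EuclideanSpace ℝ (Fin n)) = (0, w) := by
  have h1 : HasMFDerivAt (𝓡 n) 𝓘(ℝ, EuclideanSpace ℝ (Fin m) × EuclideanSpace ℝ (Fin n))
      (Bx.e ∘ Bx.param a) δ _ :=
    HasMFDerivAt.comp δ (Bx.mdifferentiableAt_e (Bx.e.map_target h.2)).hasMFDerivAt
      (Bx.mdifferentiableAt_param h).hasMFDerivAt
  have h2 : HasMFDerivAt (𝓡 n) 𝓘(ℝ, EuclideanSpace ℝ (Fin m) × EuclideanSpace ℝ (Fin n))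
      (fun δ => Bx.e a + ((0 : EuclideanSpace ℝ (Fin m)), δ)) δ
      (ContinuousLinearMap.inr ℝ (EuclideanSpace ℝ (Fin m)) (EuclideanSpace ℝ (Fin n))) :=
    HasFDerivAt.hasMFDerivAt (((ContinuousLinearMap.inr ℝ (EuclideanSpace ℝ (Fin m))
      (EuclideanSpace ℝ (Fin n))).hasFDerivAt).const_add (Bx.e a))
  have h3 := h2.congr_of_eventuallyEq (f₁ := Bx.e ∘ Bx.param a)
    (Filter.eventuallyEq_of_mem ((Bx.isOpen_slice a).mem_nhds h) fun δ' h' => Bx.e_param h')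
  exact DFunLike.congr_fun (hasMFDerivAt_unique h1 h3) w

lemma mfderiv_s_param {a : G} {δ : EuclideanSpace ℝ (Fin n)} (h : δ ∈ Bx.slice a)
    (w : EuclideanSpace ℝ (Fin n)) :
    mfderiv (𝓡 (m + n)) (𝓡 m) 𝒢.s (Bx.param a δ)
      (mfderiv (𝓡 n) (𝓡 (m + n)) (Bx.param a) δ w) = 0 := by
  have h1 := HasMFDerivAt.comp (g := 𝒢.s) (f := Bx.param a) δ
    ((𝒢.smooth_s _).mdifferentiableAt (by simp)).hasMFDerivAt
    (Bx.mdifferentiableAt_param h).hasMFDerivAt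
  have h2 := (hasMFDerivAt_const (I := 𝓡 n) (I' := 𝓡 m) (𝒢.s a) δ).congr_of_eventuallyEq
    (f₁ := 𝒢.s ∘ Bx.param a) (Filter.eventuallyEq_of_mem ((Bx.isOpen_slice a).mem_nhds h)
      fun δ' h' => Bx.s_param (p := (a, δ')) h')
  exact DFunLike.congr_fun (hasMFDerivAt_unique h1 h2) w

lemma isFiberParam_param {a : G} : 𝒢.IsFiberParam (𝒢.s a) (Bx.slice a) (Bx.param a) := by
  refine ⟨Bx.isOpen_slice a, Bx.contMDiffOn_param_slice a, fun δ h δ' h' heq => ?_,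
    fun δ h => Bx.s_param (p := (a, δ)) h, fun δ h => Bx.injective_mfderiv_param h⟩
  have h1 := congrArg Bx.e heq
  rw [Bx.e_param h, Bx.e_param h'] at h1
  exact congrArg Prod.snd (add_left_cancel h1)

variable [IsManifold (𝓡 (m + n)) ∞ G] (g : AmbientMetric m n G)

lemma form_symm (a : G) (δ δ' : EuclideanSpace ℝ (Fin n)) :
    Bx.form g a δ δ' = Bx.form g a δ' δ := g.symm _ _ _

variable [IsManifold (𝓡 m) ∞ M]

/-- Expresses the density at a moving point of the parametrization through `form` at that point,
which is known to be continuous. -/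
lemma volDensity_param {a : G} {δ : EuclideanSpace ℝ (Fin n)} (h : δ ∈ Bx.slice a) :
    𝒢.volDensity g (Bx.param a) δ = Real.sqrt (Matrix.det (Matrix.of fun i j : Fin n =>
      Bx.form g (Bx.param a δ) (EuclideanSpace.single i 1) (EuclideanSpace.single j 1))) := by
  rw [volDensity]
  congr 3
  ext i j
  refine (Bx.form_mfderiv_e g (a := Bx.param a δ) (Bx.e.map_target h.2)
    (Bx.mfderiv_s_param h _) (Bx.mfderiv_s_param h _)).symm.trans ?_
  have h1 := fun w => congrArg Prod.snd (Bx.mfderiv_e_mfderiv_param h w)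
  exact congrArg₂ (fun v w => Bx.form g (Bx.param a δ) v w) (h1 _) (h1 _)

lemma det_form_pos {a : G} (ha : a ∈ Bx.e.source) :
    0 < Matrix.det (Matrix.of fun i j : Fin n =>
      Bx.form g a (EuclideanSpace.single i 1) (EuclideanSpace.single j 1)) := by
  refine Matrix.PosDef.det_pos (Matrix.PosDef.of_dotProduct_mulVec_pos ?_ fun x hx => ?_)
  · ext i j
    simp [Matrix.conjTranspose_apply, Bx.form_symm g a]
  · have hsum : WithLp.toLp 2 x = ∑ i, x i • EuclideanSpace.single i (1 : ℝ) := by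
      ext j
      simp [Finset.sum_apply, Pi.single_apply]
    have h0 : WithLp.toLp 2 x ≠ 0 := fun h => hx (by simpa using h)
    have h1 := Bx.form_pos g ha _ h0
    rw [hsum] at h1
    simp only [map_sum, map_smul, sum_apply, smul_apply,
      smul_eq_mul] at h1
    simp only [dotProduct, Matrix.mulVec, Matrix.of_apply, star_trivial]
    refine h1.trans_eq ?_
    refine Finset.sum_congr rfl fun i _ => ?_
    rw [Finset.mul_sum, Finset.mul_sum]
    refine Finset.sum_congr rfl fun j _ => ?_
    rw [Bx.form_symm g a (EuclideanSpace.single j 1) (EuclideanSpace.single i 1)]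
    ring

/-- The density of a box parametrization is bounded below near its centre. -/
lemma exists_le_volDensity : ∃ c : ℝ, 0 < c ∧ ∃ V : Set (EuclideanSpace ℝ (Fin n)), IsOpen V ∧
    0 ∈ V ∧ V ⊆ Bx.slice a₀ ∧ ∀ δ ∈ V, c ≤ 𝒢.volDensity g (Bx.param a₀) δ := by
  have h0 := Bx.zero_mem_slice Bx.mem
  set f : EuclideanSpace ℝ (Fin n) → ℝ := fun δ => Real.sqrt (Matrix.det (Matrix.of
    fun i j : Fin n => Bx.form g (Bx.param a₀ δ) (EuclideanSpace.single i 1)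
      (EuclideanSpace.single j 1))) with hf
  have hc : ContinuousAt f 0 := by
    have h1 : ContinuousAt (Bx.param a₀) 0 := (Bx.mdifferentiableAt_param h0).continuousAt
    have h2 : ContinuousAt (fun δ => Bx.form g (Bx.param a₀ δ)) 0 :=
      ContinuousAt.comp (g := Bx.form g) (by
        rw [Bx.param_zero Bx.mem]; exact Bx.continuousAt_form g Bx.mem) h1
    refine Real.continuous_sqrt.continuousAt.comp (f := fun δ => Matrix.det _) ?_
    refine (continuous_id.matrix_det).continuousAt.comp (f := fun δ => Matrix.of _) ?_
    refine continuousAt_pi.2 fun i => continuousAt_pi.2 fun j => ?_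
    exact (h2.clm_apply continuousAt_const).clm_apply continuousAt_const
  have hpos : 0 < f 0 := by
    simp only [hf, Bx.param_zero Bx.mem]
    exact Real.sqrt_pos.2 (Bx.det_form_pos g Bx.mem)
  have hev : ∀ᶠ δ in 𝓝 (0 : EuclideanSpace ℝ (Fin n)), f 0 / 2 < f δ ∧ δ ∈ Bx.slice a₀ :=
    (hc.eventually_const_lt (half_lt_self hpos)).and ((Bx.isOpen_slice a₀).mem_nhds h0)
  obtain ⟨V, hV, hVo, hV0⟩ := eventually_nhds_iff.1 hev
  refine ⟨f 0 / 2, half_pos hpos, V, hVo, hV0, fun δ h => (hV δ h).2, fun δ h => ?_⟩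
  rw [Bx.volDensity_param g (hV δ h).2]
  exact (hV δ h).1.le

end SourceBox

section Params

variable {x : M} {W : Set (EuclideanSpace ℝ (Fin n))} {ψ : EuclideanSpace ℝ (Fin n) → G}

lemma IsFiberParam.mdifferentiableAt (h : 𝒢.IsFiberParam x W ψ) {y : EuclideanSpace ℝ (Fin n)}
    (hy : y ∈ W) : MDifferentiableAt (𝓡 n) (𝓡 (m + n)) ψ y :=
  ((h.2.1 y hy).contMDiffAt (h.1.mem_nhds hy)).mdifferentiableAt (by simp)

/-- Right translation by b⁻¹ undoes the one by b, which gives injectivity of the map and of its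
derivative. -/
lemma IsFiberParam.mul_right (h : 𝒢.IsFiberParam x W ψ) {b : G} (hb : 𝒢.t b = x) :
    𝒢.IsFiberParam (𝒢.s b) W (fun y => 𝒢.mul (ψ y) b) := by
  have hs : ∀ y ∈ W, 𝒢.s (ψ y) = 𝒢.t b := fun y hy => (h.2.2.2.1 y hy).trans hb.symm
  have hsm : ContMDiffOn (𝓡 n) (𝓡 (m + n)) ∞ (fun y => 𝒢.mul (ψ y) b) W :=
    (𝒢.contMDiffOn_mul_right b).comp h.2.1 hs
  refine ⟨h.1, hsm, fun y hy y' hy' heq => ?_, fun y hy => 𝒢.s_mul _ _ (hs y hy), fun y hy => ?_⟩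
  · refine h.2.2.1 hy hy' ?_
    have := congrArg (fun c => 𝒢.mul c (𝒢.inv b)) heq
    simpa only [mul_mul_inv (hs y hy), mul_mul_inv (hs y' hy')] using this
  · have hmd : MDifferentiableAt (𝓡 n) (𝓡 (m + n)) (fun y => 𝒢.mul (ψ y) b) y :=
      ((hsm y hy).contMDiffAt (h.1.mem_nhds hy)).mdifferentiableAt (by simp)
    have hu := h.1.uniqueDiffWithinAt (𝕜 := ℝ) hy
    have hsb : ∀ z ∈ W, 𝒢.s (𝒢.mul (ψ z) b) = 𝒢.t (𝒢.inv b) := fun z hz =>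
      (𝒢.s_mul _ _ (hs z hz)).trans (𝒢.t_inv b).symm
    have hcomp := mfderivWithin_comp (I := 𝓡 n) (I' := 𝓡 (m + n)) (I'' := 𝓡 (m + n)) y
      (g := fun c => 𝒢.mul c (𝒢.inv b)) (u := 𝒢.fiber (𝒢.s (𝒢.mul (ψ y) b)))
      (f := fun z => 𝒢.mul (ψ z) b) (mdifferentiableWithinAt_mul_right (hsb y hy))
      hmd.mdifferentiableWithinAt (fun z hz => (hsb z hz).trans (hsb y hy).symm)
      hu.uniqueMDiffWithinAt
    have heq : mfderivWithin (𝓡 n) (𝓡 (m + n))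
        (fun z => 𝒢.mul (𝒢.mul (ψ z) b) (𝒢.inv b)) W y = mfderivWithin (𝓡 n) (𝓡 (m + n)) ψ W y :=
      mfderivWithin_congr_of_mem (fun z hz => mul_mul_inv (hs z hz)) hy
    have hψ := mfderivWithin_of_isOpen (I := 𝓡 n) (I' := 𝓡 (m + n)) (f := ψ) h.1 hy
    have hb' := mfderivWithin_of_isOpen (I := 𝓡 n) (I' := 𝓡 (m + n))
      (f := fun z => 𝒢.mul (ψ z) b) h.1 hy
    rw [injective_iff_map_eq_zero]
    intro w hw
    have h1 := DFunLike.congr_fun heq w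
    have h2 := DFunLike.congr_fun hcomp w
    have h3 : mfderiv (𝓡 n) (𝓡 (m + n)) ψ y w = 0 := by
      refine (DFunLike.congr_fun hψ w).symm.trans (h1.symm.trans (h2.trans ?_))
      refine (congrArg (mfderivWithin (𝓡 (m + n)) (𝓡 (m + n)) (fun c => 𝒢.mul c (𝒢.inv b))
        (𝒢.fiber (𝒢.s (𝒢.mul (ψ y) b))) (𝒢.mul (ψ y) b)) ((DFunLike.congr_fun hb' w).trans hw)).trans (map_zero _)
    exact h.2.2.2.2 y hy (h3.trans (map_zero _).symm)

variable [IsManifold (𝓡 (m + n)) ∞ G] (g : AmbientMetric m n G)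

lemma IsFiberParam.volDensity_mul_right (h : 𝒢.IsFiberParam x W ψ) {b : G} (hb : 𝒢.t b = x)
    {y : EuclideanSpace ℝ (Fin n)} (hy : y ∈ W) :
    𝒢.volDensity g (fun y => 𝒢.mul (ψ y) b) y = 𝒢.volDensity g ψ y := by
  rw [volDensity, volDensity]
  congr 3
  ext i j
  have h1 := gS_mul_right (ψ := ψ) (S := W) (y := y) g
    (h.mdifferentiableAt hy).mdifferentiableWithinAt h.2.2.2.1 hy (h.1.uniqueDiffWithinAt hy) hb
    (EuclideanSpace.single i (1 : ℝ)) (EuclideanSpace.single j (1 : ℝ))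
  rw [mfderivWithin_of_isOpen h.1 hy, mfderivWithin_of_isOpen h.1 hy] at h1
  exact h1

end Params

section Division

open Classical in
variable (𝒢) in
/-- Division `(a, b) ↦ a b⁻¹`, extended to all pairs. -/
def qdiv : G × G → G :=
  {p : G × G | 𝒢.s p.1 = 𝒢.s p.2}.piecewise (fun p => 𝒢.mul p.1 (𝒢.inv p.2)) Prod.fst

open Classical in
lemma qdiv_of_eq {a b : G} (h : 𝒢.s a = 𝒢.s b) : 𝒢.qdiv (a, b) = 𝒢.mul a (𝒢.inv b) :=
  Set.piecewise_eq_of_mem _ _ _ h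

lemma continuousOn_div : ContinuousOn (fun p : G × G => 𝒢.mul p.1 (𝒢.inv p.2))
    {p : G × G | 𝒢.s p.1 = 𝒢.s p.2} := by
  refine 𝒢.continuousOn_mul.comp (f := fun p : G × G => (p.1, 𝒢.inv p.2))
    (continuous_fst.prodMk (𝒢.continuous_inv.comp continuous_snd)).continuousOn ?_
  intro p hp
  exact Eq.trans hp (𝒢.t_inv p.2).symm

lemma continuousOn_qdiv : ContinuousOn 𝒢.qdiv {p : G × G | 𝒢.s p.1 = 𝒢.s p.2} := by
  exact continuousOn_div.congr fun p hp => qdiv_of_eq hp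

-- The reason for extending division: `mul` is arbitrary off the composable pairs, whereas the
-- extension is continuous on a closed set and on its complement.
open Classical in
lemma measurable_qdiv [SecondCountableTopology G] [MeasurableSpace G] [BorelSpace G]
    [T2Space M] : Measurable 𝒢.qdiv := by
  have hcl : IsClosed {p : G × G | 𝒢.s p.1 = 𝒢.s p.2} :=
    isClosed_eq (𝒢.continuous_s.comp continuous_fst) (𝒢.continuous_s.comp continuous_snd)
  exact continuousOn_div.measurable_piecewise continuous_fst.continuousOn hcl.measurableSet

end Division

section Measure

variable [IsManifold (𝓡 (m + n)) ∞ G] (g : AmbientMetric m n G) [MeasurableSpace G] [BorelSpace G]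

lemma le_vol {x : M} {W : Set (EuclideanSpace ℝ (Fin n))} {ψ : EuclideanSpace ℝ (Fin n) → G}
    (h : 𝒢.IsFiberParam x W ψ) :
    ((volume.restrict W).withDensity fun y => ENNReal.ofReal (𝒢.volDensity g ψ y)).map ψ ≤
      𝒢.vol g x :=
  le_iSup_of_le W (le_iSup_of_le ψ (le_iSup_of_le h le_rfl))

lemma vol_le {x : M} {μ : Measure G}
    (h : ∀ (W : Set (EuclideanSpace ℝ (Fin n))) (ψ : EuclideanSpace ℝ (Fin n) → G),
      𝒢.IsFiberParam x W ψ → ((volume.restrict W).withDensity fun y =>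
        ENNReal.ofReal (𝒢.volDensity g ψ y)).map ψ ≤ μ) : 𝒢.vol g x ≤ μ :=
  iSup_le fun W => iSup_le fun ψ => iSup_le fun hψ => h W ψ hψ

lemma IsFiberParam.aemeasurable {x : M} {W : Set (EuclideanSpace ℝ (Fin n))}
    {ψ : EuclideanSpace ℝ (Fin n) → G} (h : 𝒢.IsFiberParam x W ψ)
    (f : EuclideanSpace ℝ (Fin n) → ℝ≥0∞) :
    AEMeasurable ψ ((volume.restrict W).withDensity f) :=
  (h.2.1.continuousOn.aemeasurable h.1.measurableSet).mono_ac
    (withDensity_absolutelyContinuous _ _)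

lemma ae_mem_of_withDensity_restrict {W : Set (EuclideanSpace ℝ (Fin n))} (hW : MeasurableSet W)
    (f : EuclideanSpace ℝ (Fin n) → ℝ≥0∞) :
    ∀ᵐ y ∂((volume.restrict W).withDensity f), y ∈ W :=
  (withDensity_absolutelyContinuous _ _).ae_le (ae_restrict_mem hW)

variable [T2Space M]

lemma measurableSet_fiber (x : M) : MeasurableSet (𝒢.fiber x) := (𝒢.isClosed_fiber x).measurableSet

/-- The volume measure of a fibre is carried by it. -/
lemma ae_mem_fiber (x : M) : ∀ᵐ a ∂(𝒢.vol g x), 𝒢.s a = x := by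
  have hm := measurableSet_fiber (𝒢 := 𝒢) x
  -- A supremum of measures is estimated through upper bounds; this one is carried by the fibre and
  -- dominates every contribution.
  have hle : 𝒢.vol g x ≤ (⊤ : Measure G).restrict (𝒢.fiber x) := by
    refine vol_le g fun W ψ h => ?_
    have hae : ∀ᵐ a ∂(((volume.restrict W).withDensity fun y =>
        ENNReal.ofReal (𝒢.volDensity g ψ y)).map ψ), a ∈ 𝒢.fiber x := by
      refine (ae_map_iff (p := fun a => a ∈ 𝒢.fiber x) (h.aemeasurable _) hm).2 ?_
      filter_upwards [ae_mem_of_withDensity_restrict h.1.measurableSet _] with y hy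
      exact h.2.2.2.1 y hy
    rw [← Measure.restrict_eq_self_of_ae_mem hae]
    exact Measure.restrict_mono le_rfl le_top
  exact (Measure.absolutelyContinuous_of_le hle).ae_le (ae_restrict_mem hm)

variable [SecondCountableTopology G]

lemma measurable_qdiv_left (b : G) : Measurable fun c => 𝒢.qdiv (c, b) :=
  (measurable_qdiv (𝒢 := 𝒢)).comp (measurable_id.prodMk measurable_const)

/-- Translating a parametrization of the fibre over t(b) by b gives one of the fibre over s(b) with
the same density, and division by b carries its contribution back. -/
lemma vol_le_map_qdiv (b : G) :
    𝒢.vol g (𝒢.t b) ≤ (𝒢.vol g (𝒢.s b)).map fun c => 𝒢.qdiv (c, b) := by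
  refine vol_le g fun W ψ h => ?_
  have h' := h.mul_right rfl
  have hmono := Measure.map_mono (le_vol g h') (measurable_qdiv_left (𝒢 := 𝒢) b)
  refine le_trans (le_of_eq ?_) hmono
  have hdens : (volume.restrict W).withDensity
      (fun y => ENNReal.ofReal (𝒢.volDensity g (fun y => 𝒢.mul (ψ y) b) y)) =
      (volume.restrict W).withDensity (fun y => ENNReal.ofReal (𝒢.volDensity g ψ y)) := by
    refine withDensity_congr_ae ?_
    filter_upwards [ae_restrict_mem h.1.measurableSet] with y hy
    rw [h.volDensity_mul_right g rfl hy]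
  rw [hdens, AEMeasurable.map_map_of_aemeasurable (measurable_qdiv_left (𝒢 := 𝒢) b).aemeasurable
    (h'.aemeasurable _)]
  refine Measure.map_congr ?_
  filter_upwards [ae_mem_of_withDensity_restrict h.1.measurableSet _] with y hy
  have hs : 𝒢.s (ψ y) = 𝒢.t b := h.2.2.2.1 y hy
  rw [Function.comp_apply, qdiv_of_eq (𝒢.s_mul _ _ hs), mul_mul_inv hs]

/-- The volume measures are right invariant. -/
theorem map_qdiv_vol (b : G) :
    (𝒢.vol g (𝒢.s b)).map (fun c => 𝒢.qdiv (c, b)) = 𝒢.vol g (𝒢.t b) := by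
  refine le_antisymm ?_ (vol_le_map_qdiv g b)
  -- The reverse inequality is the same statement for b⁻¹, pushed forward by division by b.
  have h1 := vol_le_map_qdiv (𝒢 := 𝒢) g (𝒢.inv b)
  rw [𝒢.t_inv, 𝒢.s_inv] at h1
  refine (Measure.map_mono h1 (measurable_qdiv_left (𝒢 := 𝒢) b)).trans (le_of_eq ?_)
  rw [Measure.map_map (measurable_qdiv_left (𝒢 := 𝒢) b) (measurable_qdiv_left (𝒢 := 𝒢) _)]
  conv_rhs => rw [← Measure.map_id (μ := 𝒢.vol g (𝒢.t b))]
  refine Measure.map_congr ?_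
  filter_upwards [ae_mem_fiber g (𝒢.t b)] with c hc
  have h2 : 𝒢.s c = 𝒢.s (𝒢.inv b) := hc.trans (𝒢.s_inv b).symm
  rw [Function.comp_apply, qdiv_of_eq h2, qdiv_of_eq ((s_div h2).trans (𝒢.t_inv b)), inv_inv,
    mul_mul_inv hc, id]

lemma lintegral_vol_t (b : G) {f : G → ℝ≥0∞} (hf : Measurable f) :
    ∫⁻ c, f (𝒢.qdiv (c, b)) ∂(𝒢.vol g (𝒢.s b)) = ∫⁻ c, f c ∂(𝒢.vol g (𝒢.t b)) := by
  rw [← map_qdiv_vol g b, lintegral_map hf (measurable_qdiv_left (𝒢 := 𝒢) b)]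

section Growth

variable {g} [IsManifold (𝓡 m) ∞ M]

-- A Chebyshev estimate: on the ball of radius R the weight exp(-d) is at least exp(-R), and growth
-- with exponent 1 bounds its integral uniformly in the fibre.
omit [T2Space M] [SecondCountableTopology G] [IsManifold (𝓡 m) ∞ M] in
lemma exists_vol_le [T2Space M] (hgrowth : 𝒢.SubexponentialGrowth g) : ∃ C : ℝ≥0∞, C ≠ ⊤ ∧
    ∀ (x : M) (A : Set G), MeasurableSet A → ∀ R : ℝ,
      (∀ a ∈ A, 𝒢.s a = x → 𝒢.fiberDist g (𝒢.unit x) a ≤ R) →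
      𝒢.vol g x A ≤ ENNReal.ofReal (Real.exp R) * C := by
  obtain ⟨C, hC⟩ := hgrowth 1 one_pos
  refine ⟨ENNReal.ofReal C, ENNReal.ofReal_ne_top, fun x A hA R hR => ?_⟩
  calc 𝒢.vol g x A = ∫⁻ _ in A, 1 ∂(𝒢.vol g x) := by simp
    _ ≤ ∫⁻ a in A, ENNReal.ofReal (Real.exp R) *
          ENNReal.ofReal (Real.exp (-1 * 𝒢.fiberDist g (𝒢.unit x) a)) ∂(𝒢.vol g x) := by
        refine lintegral_mono_ae ?_
        filter_upwards [ae_restrict_mem hA, ae_restrict_of_ae (ae_mem_fiber g x)] with a ha hs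
        rw [← ENNReal.ofReal_mul (Real.exp_nonneg _), ← Real.exp_add, ← ENNReal.ofReal_one]
        refine ENNReal.ofReal_le_ofReal (Real.one_le_exp ?_)
        linarith [hR a ha hs]
    _ ≤ ∫⁻ a, ENNReal.ofReal (Real.exp R) *
          ENNReal.ofReal (Real.exp (-1 * 𝒢.fiberDist g (𝒢.unit x) a)) ∂(𝒢.vol g x) :=
        setLIntegral_le_lintegral _ _
    _ = ENNReal.ofReal (Real.exp R) *
          ∫⁻ a, ENNReal.ofReal (Real.exp (-1 * 𝒢.fiberDist g (𝒢.unit x) a)) ∂(𝒢.vol g x) :=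
        lintegral_const_mul' _ _ ENNReal.ofReal_ne_top
    _ ≤ ENNReal.ofReal (Real.exp R) * ENNReal.ofReal C := by gcongr; exact hC x

-- The supremum over parametrizations is not visibly finite; finiteness near a point comes from the
-- growth hypothesis together with local boundedness of the distance.
omit [SecondCountableTopology G] in
lemma isLocallyFiniteMeasure_vol (hconn : 𝒢.SConnected) (hgrowth : 𝒢.SubexponentialGrowth g)
    (x : M) : IsLocallyFiniteMeasure (𝒢.vol g x) := by
  obtain ⟨C, hC, h⟩ := exists_vol_le (𝒢 := 𝒢) hgrowth
  refine ⟨fun a => ?_⟩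
  obtain ⟨R, hR⟩ := exists_fiberDist_le_nhds (g := g) hconn a
  obtain ⟨U, hU, hUo, haU⟩ := eventually_nhds_iff.1 hR
  refine ⟨U, hUo.mem_nhds haU, (h x U hUo.measurableSet R ?_).trans_lt
    (ENNReal.mul_lt_top ENNReal.ofReal_lt_top hC.lt_top)⟩
  intro b hb hs
  rw [← hs]
  exact hU b hb

omit [SecondCountableTopology G] in
/-- Compact sets have uniformly bounded volume in all fibres. -/
lemma exists_vol_le_of_isCompact [T2Space G] (hconn : 𝒢.SConnected)
    (hgrowth : 𝒢.SubexponentialGrowth g) {K : Set G} (hK : IsCompact K) :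
    ∃ C : ℝ≥0∞, C ≠ ⊤ ∧ ∀ x, 𝒢.vol g x K ≤ C := by
  obtain ⟨C, hC, h⟩ := exists_vol_le (𝒢 := 𝒢) hgrowth
  obtain ⟨R, hR⟩ := exists_fiberDist_le_of_isCompact (g := g) hconn hK
  refine ⟨_, ENNReal.mul_ne_top (ENNReal.ofReal_ne_top (r := Real.exp R)) hC, fun x =>
    h x K hK.measurableSet R fun a ha hs => ?_⟩
  rw [← hs]
  exact hR a ha

omit [T2Space M] [SecondCountableTopology G] in
variable (g) in
/-- Open sets meeting a fibre have positive volume in it. -/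
lemma vol_pos {U : Set G} (hU : IsOpen U) {a : G} (ha : a ∈ U) : 0 < 𝒢.vol g (𝒢.s a) U := by
  obtain ⟨Bx⟩ := 𝒢.nonempty_sourceBox a
  obtain ⟨c, hc, V, hVo, hV0, hVs, hcV⟩ := Bx.exists_le_volDensity g
  have hp := Bx.isFiberParam_param (a := a)
  refine lt_of_lt_of_le ?_ (le_vol g hp U)
  rw [Measure.map_apply_of_aemeasurable (hp.aemeasurable _) hU.measurableSet]
  have hVU : IsOpen (V ∩ Bx.param a ⁻¹' U) :=
    (hp.2.1.continuousOn.mono hVs).isOpen_inter_preimage hVo hU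
  have h0 : (0 : EuclideanSpace ℝ (Fin n)) ∈ V ∩ Bx.param a ⁻¹' U :=
    ⟨hV0, by rw [mem_preimage, Bx.param_zero Bx.mem]; exact ha⟩
  refine lt_of_lt_of_le ?_ (measure_mono (inter_subset_right (s := V)))
  rw [withDensity_apply _ hVU.measurableSet, Measure.restrict_restrict hVU.measurableSet,
    inter_eq_self_of_subset_left (inter_subset_left.trans hVs)]
  have hvol : 0 < volume (V ∩ Bx.param a ⁻¹' U) := hVU.measure_pos _ ⟨0, h0⟩
  calc (0 : ℝ≥0∞) < ENNReal.ofReal c * volume (V ∩ Bx.param a ⁻¹' U) :=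
        ENNReal.mul_pos (ENNReal.ofReal_pos.2 hc).ne' hvol.ne'
    _ = ∫⁻ _ in V ∩ Bx.param a ⁻¹' U, ENNReal.ofReal c := by simp
    _ ≤ _ := setLIntegral_mono' hVU.measurableSet fun δ h =>
        ENNReal.ofReal_le_ofReal (hcV δ h.1)

end Growth

end Measure

end Volume

/-! ### Continuity of sections and orthonormal frames of the bundle. -/

section Frames

variable {m : ℕ} {M : Type u} [TopologicalSpace M] [ChartedSpace (EuclideanSpace ℝ (Fin m)) M]
  {F : Type v} [NormedAddCommGroup F] [NormedSpace ℂ F]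
  {E : M → Type u} [∀ x, NormedAddCommGroup (E x)] [∀ x, InnerProductSpace ℂ (E x)]
  [TopologicalSpace (TotalSpace F E)] [FiberBundle F E]

section ConstantSections

variable [VectorBundle ℂ F E]

lemma smoothSecAt_symmL (p : M) (v : F) :
    SmoothSecAt F m (fun q => (trivializationAt F E p).symmL ℂ q v) p := by
  refine (contMDiffAt_section _).2 ?_
  refine contMDiffAt_const (c := v) |>.congr_of_eventuallyEq ?_
  filter_upwards [(trivializationAt F E p).open_baseSet.mem_nhds
    (mem_baseSet_trivializationAt F E p)] with q hq
  rw [Trivialization.symmL_apply (R := ℂ) (trivializationAt F E p) hq v,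
    Trivialization.apply_mk_symm _ hq]

lemma continuousOn_symmL (e : Trivialization F (π F E)) [MemTrivializationAtlas e] (v : F) :
    ContinuousOn (fun q => (⟨q, e.symmL ℂ q v⟩ : TotalSpace F E)) e.baseSet := by
  have h : ContinuousOn (fun q => e.toOpenPartialHomeomorph.symm (q, v)) e.baseSet :=
    e.continuousOn_invFun.comp (f := fun q : M => (q, v)) (by fun_prop)
      fun q hq => e.mem_target.2 hq
  refine h.congr fun q hq => ?_
  rw [Trivialization.symmL_apply (R := ℂ) e hq v, Trivialization.mk_symm _ hq]

lemma symmL_trivialization_snd {e : Trivialization F (π F E)} [MemTrivializationAtlas e] {q : M}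
    (hq : q ∈ e.baseSet) (v : E q) : e.symmL ℂ q (e ⟨q, v⟩).2 = v := by
  have h := e.symmL_continuousLinearMapAt (R := ℂ) hq v
  rwa [Trivialization.continuousLinearMapAt_apply_of_mem _ _ hq] at h

end ConstantSections

section Continuity

variable {X : Type*} [TopologicalSpace X] {f : X → M} {σ τ : ∀ x, E (f x)} {s : Set X} {x₀ : X}

lemma continuousWithinAt_finset_sum_section [VectorBundle ℂ F E] {ι : Type*} (S : Finset ι)
    {σ : ι → ∀ x, E (f x)} (hf : ContinuousWithinAt f s x₀)
    (h : ∀ i ∈ S, ContinuousWithinAt (fun x => (⟨f x, σ i x⟩ : TotalSpace F E)) s x₀) :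
    ContinuousWithinAt (fun x => (⟨f x, ∑ i ∈ S, σ i x⟩ : TotalSpace F E)) s x₀ := by
  refine (FiberBundle.continuousWithinAt_totalSpace _ _).2 ⟨hf, ?_⟩
  have hb : f x₀ ∈ (trivializationAt F E (f x₀)).baseSet := mem_baseSet_trivializationAt F E _
  have key : ∀ x, f x ∈ (trivializationAt F E (f x₀)).baseSet →
      (trivializationAt F E (f x₀) ⟨f x, ∑ i ∈ S, σ i x⟩).2 =
        ∑ i ∈ S, (trivializationAt F E (f x₀) ⟨f x, σ i x⟩).2 := fun x hx => by
    simp only [← Trivialization.continuousLinearMapAt_apply_of_mem ℂ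
      (trivializationAt F E (f x₀)) hx, map_sum]
  have h' : ContinuousWithinAt (fun x => ∑ i ∈ S, (trivializationAt F E (f x₀) ⟨f x, σ i x⟩).2)
      s x₀ := tendsto_finsetSum S fun i hi =>
    ((FiberBundle.continuousWithinAt_totalSpace _ _).1 (h i hi)).2
  refine h'.congr_of_eventuallyEq ?_ (key x₀ hb)
  filter_upwards [hf ((trivializationAt F E (f x₀)).open_baseSet.mem_nhds hb)] with x hx
  exact key x hx

lemma continuousWithinAt_smul_section [VectorBundle ℂ F E] {c : X → ℂ}
    (hc : ContinuousWithinAt c s x₀)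
    (h : ContinuousWithinAt (fun x => (⟨f x, σ x⟩ : TotalSpace F E)) s x₀) :
    ContinuousWithinAt (fun x => (⟨f x, c x • σ x⟩ : TotalSpace F E)) s x₀ := by
  obtain ⟨hf, h⟩ := (FiberBundle.continuousWithinAt_totalSpace _ _).1 h
  refine (FiberBundle.continuousWithinAt_totalSpace _ _).2 ⟨hf, ?_⟩
  have hb : f x₀ ∈ (trivializationAt F E (f x₀)).baseSet := mem_baseSet_trivializationAt F E _
  have key : ∀ x, f x ∈ (trivializationAt F E (f x₀)).baseSet →
      (trivializationAt F E (f x₀) ⟨f x, c x • σ x⟩).2 =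
        c x • (trivializationAt F E (f x₀) ⟨f x, σ x⟩).2 := fun x hx => by
    simp only [← Trivialization.continuousLinearMapAt_apply_of_mem ℂ
      (trivializationAt F E (f x₀)) hx, map_smul]
  refine (hc.smul h).congr_of_eventuallyEq ?_ (key x₀ hb)
  filter_upwards [hf ((trivializationAt F E (f x₀)).open_baseSet.mem_nhds hb)] with x hx
  exact key x hx

lemma continuousWithinAt_sub_section [VectorBundle ℂ F E]
    (h : ContinuousWithinAt (fun x => (⟨f x, σ x⟩ : TotalSpace F E)) s x₀)
    (h' : ContinuousWithinAt (fun x => (⟨f x, τ x⟩ : TotalSpace F E)) s x₀) :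
    ContinuousWithinAt (fun x => (⟨f x, σ x - τ x⟩ : TotalSpace F E)) s x₀ := by
  obtain ⟨hf, h⟩ := (FiberBundle.continuousWithinAt_totalSpace _ _).1 h
  obtain ⟨-, h'⟩ := (FiberBundle.continuousWithinAt_totalSpace _ _).1 h'
  refine (FiberBundle.continuousWithinAt_totalSpace _ _).2 ⟨hf, ?_⟩
  have hb : f x₀ ∈ (trivializationAt F E (f x₀)).baseSet := mem_baseSet_trivializationAt F E _
  have key : ∀ x, f x ∈ (trivializationAt F E (f x₀)).baseSet →
      (trivializationAt F E (f x₀) ⟨f x, σ x - τ x⟩).2 =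
        (trivializationAt F E (f x₀) ⟨f x, σ x⟩).2 -
          (trivializationAt F E (f x₀) ⟨f x, τ x⟩).2 := fun x hx => by
    simp only [← Trivialization.continuousLinearMapAt_apply_of_mem ℂ
      (trivializationAt F E (f x₀)) hx, map_sub]
  refine (h.sub h').congr_of_eventuallyEq ?_ (key x₀ hb)
  filter_upwards [hf ((trivializationAt F E (f x₀)).open_baseSet.mem_nhds hb)] with x hx
  exact key x hx

variable [VectorBundle ℂ F E] [FiniteDimensional ℂ F] (hE : SmoothHermitian F E m)
include hE

/-- `SmoothHermitian` concerns sections over `M`, while σ and τ are sections along f. Expanding both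
in a frame constant in a trivialization leaves inner products of frame sections, to which it
applies. -/
lemma continuousWithinAt_inner_section
    (h : ContinuousWithinAt (fun x => (⟨f x, σ x⟩ : TotalSpace F E)) s x₀)
    (h' : ContinuousWithinAt (fun x => (⟨f x, τ x⟩ : TotalSpace F E)) s x₀) :
    ContinuousWithinAt (fun x => (inner ℂ (σ x) (τ x) : ℂ)) s x₀ := by
  obtain ⟨hf, h⟩ := (FiberBundle.continuousWithinAt_totalSpace _ _).1 h
  obtain ⟨-, h'⟩ := (FiberBundle.continuousWithinAt_totalSpace _ _).1 h'
  change ContinuousWithinAt f s x₀ at hf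
  set e := trivializationAt F E (f x₀) with he
  have hb : f x₀ ∈ e.baseSet := mem_baseSet_trivializationAt F E _
  set β := Module.finBasis ℂ F
  have hrepr : ∀ x, f x ∈ e.baseSet → ∀ v : E (f x), v =
      ∑ i, β.repr (e ⟨f x, v⟩).2 i • e.symmL ℂ (f x) (β i) := fun x hx v => by
    conv_lhs => rw [← symmL_trivialization_snd hx v, ← β.sum_repr (e ⟨f x, v⟩).2]
    simp only [map_sum, map_smul]
  have key : ∀ x, f x ∈ e.baseSet → (inner ℂ (σ x) (τ x) : ℂ) =
      ∑ i, ∑ j, (starRingEnd ℂ (β.repr (e ⟨f x, σ x⟩).2 i) * β.repr (e ⟨f x, τ x⟩).2 j) *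
        inner ℂ (e.symmL ℂ (f x) (β i)) (e.symmL ℂ (f x) (β j)) := fun x hx => by
    conv_lhs => rw [hrepr x hx (σ x), hrepr x hx (τ x)]
    rw [sum_inner]
    refine Finset.sum_congr rfl fun i _ => ?_
    rw [inner_sum]
    refine Finset.sum_congr rfl fun j _ => ?_
    rw [inner_smul_left, inner_smul_right]
    ring
  have hcoord : ∀ i, Continuous fun v : F => β.repr v i := fun i =>
    (β.coord i).continuous_of_finiteDimensional
  have hcont : ContinuousWithinAt (fun x => ∑ i, ∑ j,
      (starRingEnd ℂ (β.repr (e ⟨f x, σ x⟩).2 i) * β.repr (e ⟨f x, τ x⟩).2 j) *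
        inner ℂ (e.symmL ℂ (f x) (β i)) (e.symmL ℂ (f x) (β j))) s x₀ := by
    refine tendsto_finsetSum _ fun i _ => tendsto_finsetSum _ fun j _ => ?_
    refine ContinuousWithinAt.mul (ContinuousWithinAt.mul ?_ ?_) ?_
    · exact (Complex.continuous_conj.comp (hcoord i)).continuousAt.comp_continuousWithinAt h
    · exact (hcoord j).continuousAt.comp_continuousWithinAt h'
    · exact (hE _ _ _ (smoothSecAt_symmL (f x₀) (β i))
        (smoothSecAt_symmL (f x₀) (β j))).continuousAt.comp_continuousWithinAt hf
  refine hcont.congr_of_eventuallyEq ?_ (key x₀ hb)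
  filter_upwards [hf (e.open_baseSet.mem_nhds hb)] with x hx
  exact key x hx

lemma continuousWithinAt_norm_section
    (h : ContinuousWithinAt (fun x => (⟨f x, σ x⟩ : TotalSpace F E)) s x₀) :
    ContinuousWithinAt (fun x => ‖σ x‖) s x₀ := by
  have h1 := continuousWithinAt_inner_section hE h h
  have h2 := (Real.continuous_sqrt.comp Complex.continuous_re).continuousAt.comp_continuousWithinAt
    h1
  exact h2.congr (fun x _ => norm_eq_sqrt_re_inner (𝕜 := ℂ) _) (norm_eq_sqrt_re_inner (𝕜 := ℂ) _)

end Continuity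

section GramSchmidt

variable [VectorBundle ℂ F E] [FiniteDimensional ℂ F]

lemma finiteDimensional_fiber (F : Type v) [NormedAddCommGroup F] [NormedSpace ℂ F]
    [TopologicalSpace (TotalSpace F E)] [FiberBundle F E]
    [VectorBundle ℂ F E] [FiniteDimensional ℂ F] (q : M) : FiniteDimensional ℂ (E q) :=
  ((trivializationAt F E q).continuousLinearEquivAt ℂ q
    (mem_baseSet_trivializationAt F E q)).symm.toLinearEquiv.finiteDimensional

lemma finrank_fiber (F : Type v) [NormedAddCommGroup F] [NormedSpace ℂ F]
    [TopologicalSpace (TotalSpace F E)] [FiberBundle F E]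
    [VectorBundle ℂ F E] (q : M) : Module.finrank ℂ (E q) = Module.finrank ℂ F :=
  ((trivializationAt F E q).continuousLinearEquivAt ℂ q
    (mem_baseSet_trivializationAt F E q)).toLinearEquiv.finrank_eq

/-- Over the base set of a trivialization there is a continuous orthonormal frame. -/
lemma exists_orthonormalFrame (hE : SmoothHermitian F E m) (e : Trivialization F (π F E))
    [MemTrivializationAtlas e] :
    ∃ b : ∀ q, OrthonormalBasis (Fin (Module.finrank ℂ F)) ℂ (E q),
      ∀ i, ContinuousOn (fun q => (⟨q, b q i⟩ : TotalSpace F E)) e.baseSet := by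
  set β := Module.finBasis ℂ F
  have hfd : ∀ q, FiniteDimensional ℂ (E q) := finiteDimensional_fiber F
  set ς : ∀ q : M, Fin (Module.finrank ℂ F) → E q := fun q i => e.symmL ℂ q (β i) with hς
  have hcard : ∀ q, Module.finrank ℂ (E q) = Fintype.card (Fin (Module.finrank ℂ F)) := fun q => by
    rw [Fintype.card_fin]; exact finrank_fiber F q
  have hli : ∀ q ∈ e.baseSet, LinearIndependent ℂ (ς q) := fun q hq => by
    have h := β.linearIndependent.map' (e.continuousLinearEquivAt ℂ q hq).symm.toLinearMap
      (LinearEquiv.ker _)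
    have h' : ς q = (e.continuousLinearEquivAt ℂ q hq).symm.toLinearMap ∘ β := by
      funext i
      exact (DFunLike.congr_fun (Trivialization.symm_continuousLinearEquivAt_eq' e hq) (β i)).symm
    rw [h']
    exact h
  -- Strong induction along the Gram–Schmidt recursion; its denominators do not vanish because the
  -- frame is independent over the base set.
  have hgs : ∀ i, ContinuousOn (fun q => (⟨q, InnerProductSpace.gramSchmidt ℂ (ς q) i⟩ :
      TotalSpace F E)) e.baseSet := by
    intro i
    induction i using WellFoundedLT.induction with
    | ind i ih =>
      intro q hq
      have heq : ∀ q, InnerProductSpace.gramSchmidt ℂ (ς q) i = ς q i - ∑ j ∈ Finset.Iio i,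
          (inner ℂ (InnerProductSpace.gramSchmidt ℂ (ς q) j) (ς q i) /
            ((‖InnerProductSpace.gramSchmidt ℂ (ς q) j‖ ^ 2 : ℝ) : ℂ)) •
              InnerProductSpace.gramSchmidt ℂ (ς q) j := fun q => by
        have h := InnerProductSpace.gramSchmidt_def'' ℂ (ς q) i
        rw [eq_sub_iff_add_eq]
        push_cast
        exact h.symm
      simp only [heq]
      refine continuousWithinAt_sub_section (f := id) (continuousOn_symmL e (β i) q hq)
        (continuousWithinAt_finset_sum_section (f := id) _ continuousWithinAt_id fun j hj => ?_)
      have hj' := ih j (Finset.mem_Iio.1 hj) q hq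
      refine continuousWithinAt_smul_section (f := id) (ContinuousWithinAt.div
        (continuousWithinAt_inner_section (f := id) hE hj' (continuousOn_symmL e (β i) q hq))
        (Complex.continuous_ofReal.continuousAt.comp_continuousWithinAt
          ((continuousWithinAt_norm_section (f := id) hE hj').pow 2)) ?_) hj'
      have := InnerProductSpace.gramSchmidt_ne_zero j (hli q hq)
      simpa using this
  refine ⟨fun q => InnerProductSpace.gramSchmidtOrthonormalBasis (hcard q) (ς q), fun i => ?_⟩
  have hne : ∀ q ∈ e.baseSet, InnerProductSpace.gramSchmidt ℂ (ς q) i ≠ 0 := fun q hq =>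
    InnerProductSpace.gramSchmidt_ne_zero i (hli q hq)
  have heq : ∀ q ∈ e.baseSet, InnerProductSpace.gramSchmidtOrthonormalBasis (hcard q) (ς q) i =
      ((‖InnerProductSpace.gramSchmidt ℂ (ς q) i‖⁻¹ : ℝ) : ℂ) •
        InnerProductSpace.gramSchmidt ℂ (ς q) i := fun q hq => by
    rw [InnerProductSpace.gramSchmidtOrthonormalBasis_apply, InnerProductSpace.gramSchmidtNormed]
    · push_cast; rfl
    · simp [InnerProductSpace.gramSchmidtNormed, hne q hq]
  refine ContinuousOn.congr (f := fun q => (⟨q,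
    ((‖InnerProductSpace.gramSchmidt ℂ (ς q) i‖⁻¹ : ℝ) : ℂ) •
        InnerProductSpace.gramSchmidt ℂ (ς q) i⟩ : TotalSpace F E)) (fun q hq => ?_)
    fun q hq => by rw [heq q hq]
  refine continuousWithinAt_smul_section (f := id) ?_ (hgs i q hq)
  refine Complex.continuous_ofReal.continuousAt.comp_continuousWithinAt ?_
  exact (continuousWithinAt_norm_section (f := id) hE (hgs i q hq)).inv₀ (norm_ne_zero_iff.2 (hne q hq))

/-- A global orthonormal frame of `E`, continuous on the pieces of a finite Borel cover. -/
structure PiecewiseFrame (F : Type v) [NormedAddCommGroup F] [NormedSpace ℂ F]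
    (E : M → Type u) [∀ x, NormedAddCommGroup (E x)] [∀ x, InnerProductSpace ℂ (E x)]
    [TopologicalSpace (TotalSpace F E)] where
  /-- the frame -/
  basis : ∀ q, OrthonormalBasis (Fin (Module.finrank ℂ F)) ℂ (E q)
  /-- the number of pieces -/
  N : ℕ
  /-- the pieces -/
  piece : Fin N → Set M
  measurable_piece : ∀ i, MeasurableSet[borel M] (piece i)
  cover : ∀ q, ∃ i, q ∈ piece i
  continuousOn : ∀ i l, ContinuousOn (fun q => (⟨q, basis q l⟩ : TotalSpace F E)) (piece i)

/-- A global continuous frame need not exist. Cover `M` by finitely many trivializing open sets and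
use at each point the frame of the first set containing it; the pieces are differences of open sets.
-/
lemma nonempty_piecewiseFrame [CompactSpace M] (hE : SmoothHermitian F E m) :
    Nonempty (PiecewiseFrame F E) := by
  choose b hb using fun p : M => exists_orthonormalFrame hE (trivializationAt F E p)
  obtain ⟨T, hT⟩ := CompactSpace.elim_nhds_subcover
    (fun p : M => (trivializationAt F E p).baseSet) fun p =>
      (trivializationAt F E p).open_baseSet.mem_nhds (mem_baseSet_trivializationAt F E p)
  set c : Fin T.card → M := fun i => T.equivFin.symm i with hc
  have hcov : ∀ q, ∃ i, q ∈ (trivializationAt F E (c i)).baseSet := fun q => by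
    have hq : q ∈ (⊤ : Set M) := mem_univ q
    rw [← hT, mem_iUnion₂] at hq
    obtain ⟨p, hp, hq⟩ := hq
    exact ⟨T.equivFin ⟨p, hp⟩, by simpa [hc] using hq⟩
  have hmin : ∀ q, ∃ i, q ∈ (trivializationAt F E (c i)).baseSet ∧
      ∀ j < i, q ∉ (trivializationAt F E (c j)).baseSet := fun q => by
    obtain ⟨i, hi, hmin⟩ := WellFounded.has_min (wellFounded_lt (α := Fin T.card))
      {i | q ∈ (trivializationAt F E (c i)).baseSet} (hcov q)
    exact ⟨i, hi, fun j hj h => hmin j h hj⟩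
  choose idx hidx hidx' using hmin
  let _ : MeasurableSpace M := borel M
  have _ : BorelSpace M := ⟨rfl⟩
  refine ⟨⟨fun q => b (c (idx q)) q, T.card, fun i => {q | idx q = i}, fun i => ?_,
    fun q => ⟨idx q, rfl⟩, fun i l => ?_⟩⟩
  · have : {q | idx q = i} = (trivializationAt F E (c i)).baseSet \
        ⋃ j : {j // j < i}, (trivializationAt F E (c j)).baseSet := by
      ext q
      simp only [mem_ofPred_eq, Set.mem_sdiff, mem_iUnion, not_exists]
      refine ⟨fun h => ⟨h ▸ hidx q, fun j => hidx' q j (h ▸ j.2)⟩, fun h => ?_⟩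
      rcases lt_trichotomy (idx q) i with hlt | heq | hgt
      · exact absurd (hidx q) (h.2 ⟨_, hlt⟩)
      · exact heq
      · exact absurd h.1 (hidx' q i hgt)
    rw [this]
    exact (trivializationAt F E (c i)).open_baseSet.measurableSet.diff
      (isOpen_iUnion fun j : {j // j < i} => (trivializationAt F E (c j)).open_baseSet).measurableSet
  · have hsub : {q | idx q = i} ⊆ (trivializationAt F E (c i)).baseSet := fun q hq => by
      have : idx q = i := hq
      exact this ▸ hidx q
    refine ((hb (c i) l).mono hsub).congr fun q hq => ?_
    have : idx q = i := hq
    rw [this]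

end GramSchmidt

end Frames

lemma measurable_of_continuousOn_cover {X Y ι : Type*} [TopologicalSpace X] [MeasurableSpace X]
    [OpensMeasurableSpace X] [TopologicalSpace Y] [MeasurableSpace Y] [BorelSpace Y] [Countable ι]
    {f : X → Y} (S : ι → Set X) (hS : ∀ i, MeasurableSet (S i)) (hcov : ∀ x, ∃ i, x ∈ S i)
    (hf : ∀ i, ContinuousOn f (S i)) : Measurable f := by
  refine measurable_of_isOpen fun U hU => ?_
  have : f ⁻¹' U = ⋃ i, f ⁻¹' U ∩ S i := by
    rw [← inter_iUnion, iUnion_eq_univ_iff.2 hcov, inter_univ]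
  rw [this]
  refine MeasurableSet.iUnion fun i => ?_
  obtain ⟨u, hu, h⟩ := continuousOn_iff'.1 (hf i) U hU
  rw [h]
  exact hu.measurableSet.inter (hS i)

/-! ### Kernels and sections in frame coordinates. -/

section Matrix

variable {m n : ℕ} {G M : Type u}
  [TopologicalSpace G] [ChartedSpace (EuclideanSpace ℝ (Fin (m + n))) G]
  [TopologicalSpace M] [ChartedSpace (EuclideanSpace ℝ (Fin m)) M]
  {𝒢 : LieGroupoid m n G M} {k : ℕ}
  {F : Type v} [NormedAddCommGroup F] [NormedSpace ℂ F]
  {E : M → Type u} [∀ x, NormedAddCommGroup (E x)] [∀ x, InnerProductSpace ℂ (E x)]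

/-- A linear map between Hilbert spaces, expressed in orthonormal bases. -/
def clmMatrix {H H' : Type*} [NormedAddCommGroup H] [InnerProductSpace ℂ H]
    [NormedAddCommGroup H'] [InnerProductSpace ℂ H'] (b : OrthonormalBasis (Fin k) ℂ H)
    (b' : OrthonormalBasis (Fin k) ℂ H') (T : H →L[ℂ] H') :
    EuclideanSpace ℂ (Fin k) →L[ℂ] EuclideanSpace ℂ (Fin k) :=
  b'.repr.toContinuousLinearEquiv.toContinuousLinearMap ∘L T ∘L
    b.repr.symm.toContinuousLinearEquiv.toContinuousLinearMap

lemma norm_clmMatrix {H H' : Type*} [NormedAddCommGroup H] [InnerProductSpace ℂ H]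
    [NormedAddCommGroup H'] [InnerProductSpace ℂ H'] (b : OrthonormalBasis (Fin k) ℂ H)
    (b' : OrthonormalBasis (Fin k) ℂ H') (T : H →L[ℂ] H') : ‖clmMatrix b b' T‖ = ‖T‖ := by
  refine (LinearIsometry.norm_toContinuousLinearMap_comp b'.repr.toLinearIsometry
    (g := T ∘L b.repr.symm.toContinuousLinearEquiv.toContinuousLinearMap)).trans ?_
  exact ContinuousLinearMap.opNorm_comp_linearIsometryEquiv T b.repr.symm

lemma clmMatrix_apply {H H' : Type*} [NormedAddCommGroup H] [InnerProductSpace ℂ H]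
    [NormedAddCommGroup H'] [InnerProductSpace ℂ H'] (b : OrthonormalBasis (Fin k) ℂ H)
    (b' : OrthonormalBasis (Fin k) ℂ H') (T : H →L[ℂ] H') (v : EuclideanSpace ℂ (Fin k)) :
    clmMatrix b b' T v = b'.repr (T (b.repr.symm v)) := rfl

variable [TopologicalSpace (TotalSpace F E)] [FiberBundle F E] [VectorBundle ℂ F E]
  [FiniteDimensional ℂ F] (hE : SmoothHermitian F E m)
include hE

lemma continuousWithinAt_repr {X : Type*} [TopologicalSpace X] {f : X → M} {σ : ∀ x, E (f x)}
    {s : Set X} {x₀ : X} {b : ∀ q, OrthonormalBasis (Fin k) ℂ (E q)}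
    (hb : ∀ i, ContinuousWithinAt (fun x => (⟨f x, b (f x) i⟩ : TotalSpace F E)) s x₀)
    (h : ContinuousWithinAt (fun x => (⟨f x, σ x⟩ : TotalSpace F E)) s x₀) :
    ContinuousWithinAt (fun x => (b (f x)).repr (σ x)) s x₀ := by
  refine (PiLp.continuousLinearEquiv 2 ℂ
    (fun _ : Fin k => ℂ)).toHomeomorph.isInducing.continuousWithinAt_iff.2 ?_
  refine continuousWithinAt_pi.2 fun i => ?_
  refine (continuousWithinAt_inner_section hE (hb i) h).congr (fun x _ => ?_) ?_ <;>
  exact OrthonormalBasis.repr_apply_apply _ _ _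

lemma Kernel.Smooth.continuousWithinAt_clmMatrix {κ : 𝒢.Kernel E} (hκ : κ.Smooth F)
    {b b' : ∀ q, OrthonormalBasis (Fin k) ℂ (E q)} {S : Set G} {a₀ : G}
    (hb : ∀ i, ContinuousWithinAt (fun a => (⟨𝒢.s a, b (𝒢.s a) i⟩ : TotalSpace F E)) S a₀)
    (hb' : ∀ i, ContinuousWithinAt (fun a => (⟨𝒢.t a, b' (𝒢.t a) i⟩ : TotalSpace F E)) S a₀) :
    ContinuousWithinAt (fun a => clmMatrix (b (𝒢.s a)) (b' (𝒢.t a)) (κ a)) S a₀ := by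
  refine continuousWithinAt_clm_apply.2 fun y => ?_
  simp only [clmMatrix_apply]
  refine continuousWithinAt_repr hE hb' ?_
  refine ContinuousWithinAt.clm_apply_of_inCoordinates (b₁ := 𝒢.s)
    (hκ a₀).continuousAt.continuousWithinAt ?_ 𝒢.continuous_t.continuousWithinAt
  have h : ∀ a, (b (𝒢.s a)).repr.symm y = ∑ i, y i • b (𝒢.s a) i := fun a =>
    ((b (𝒢.s a)).sum_repr_symm y).symm
  simp only [h]
  exact continuousWithinAt_finset_sum_section _ 𝒢.continuous_s.continuousWithinAt fun i _ =>
    continuousWithinAt_smul_section continuousWithinAt_const (hb i)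

/-- In local orthonormal frames around s(a₀) and t(a₀), the norm of κ(a) is that of a matrix
depending continuously on a. -/
lemma Kernel.Smooth.continuous_norm {κ : 𝒢.Kernel E} (hκ : κ.Smooth F) :
    Continuous fun a => ‖κ a‖ := by
  refine continuous_iff_continuousAt.2 fun a₀ => ?_
  obtain ⟨b, hb⟩ := exists_orthonormalFrame hE (trivializationAt F E (𝒢.s a₀))
  obtain ⟨b', hb'⟩ := exists_orthonormalFrame hE (trivializationAt F E (𝒢.t a₀))
  have hs : ∀ p : M, p ∈ (trivializationAt F E p).baseSet := mem_baseSet_trivializationAt F E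
  have h := (hκ.continuousWithinAt_clmMatrix hE (S := univ) (a₀ := a₀) (b := b) (b' := b')
    (fun i => (ContinuousAt.comp (g := fun q => (⟨q, b q i⟩ : TotalSpace F E))
      ((hb i).continuousAt ((trivializationAt F E _).open_baseSet.mem_nhds (hs _)))
      𝒢.continuous_s.continuousAt).continuousWithinAt)
    (fun i => (ContinuousAt.comp (g := fun q => (⟨q, b' q i⟩ : TotalSpace F E))
      ((hb' i).continuousAt ((trivializationAt F E _).open_baseSet.mem_nhds (hs _)))
      𝒢.continuous_t.continuousAt).continuousWithinAt)).norm
  simpa only [norm_clmMatrix, continuousWithinAt_univ] using h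

omit hE in
/-- A kernel expressed in a global frame. -/
def PiecewiseFrame.mat (Φ : PiecewiseFrame F E) (κ : 𝒢.Kernel E) (a : G) :
    EuclideanSpace ℂ (Fin (Module.finrank ℂ F)) →L[ℂ] EuclideanSpace ℂ (Fin (Module.finrank ℂ F)) :=
  clmMatrix (Φ.basis (𝒢.s a)) (Φ.basis (𝒢.t a)) (κ a)

variable [MeasurableSpace G] [BorelSpace G]

omit [ChartedSpace (EuclideanSpace ℝ (Fin m)) M] [FiberBundle F E] [VectorBundle ℂ F E]
  [FiniteDimensional ℂ F] hE in
lemma PiecewiseFrame.measurableSet_preimage (Φ : PiecewiseFrame F E) {f : G → M}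
    (hf : Continuous f) (i : Fin Φ.N) : MeasurableSet (f ⁻¹' Φ.piece i) := by
  let _ : MeasurableSpace M := borel M
  have _ : BorelSpace M := ⟨rfl⟩
  exact hf.measurable (Φ.measurable_piece i)

lemma PiecewiseFrame.measurable_mat (Φ : PiecewiseFrame F E) {κ : 𝒢.Kernel E} (hκ : κ.Smooth F) :
    Measurable (Φ.mat κ) := by
  refine measurable_of_continuousOn_cover
    (fun i : Fin Φ.N × Fin Φ.N => 𝒢.s ⁻¹' Φ.piece i.1 ∩ 𝒢.t ⁻¹' Φ.piece i.2)
    (fun i => (Φ.measurableSet_preimage 𝒢.continuous_s _).inter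
      (Φ.measurableSet_preimage 𝒢.continuous_t _)) (fun a => ?_) fun i a ha => ?_
  · obtain ⟨i, hi⟩ := Φ.cover (𝒢.s a)
    obtain ⟨j, hj⟩ := Φ.cover (𝒢.t a)
    exact ⟨(i, j), hi, hj⟩
  · exact hκ.continuousWithinAt_clmMatrix hE
      (fun l => (Φ.continuousOn i.1 l _ ha.1).comp 𝒢.continuous_s.continuousWithinAt
        fun _ h => h.1)
      (fun l => (Φ.continuousOn i.2 l _ ha.2).comp 𝒢.continuous_t.continuousWithinAt
        fun _ h => h.2)

/-- The indicator admits sections continuous only over `O`, such as the test section of the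
injectivity argument, which is built in a single trivialization. -/
lemma PiecewiseFrame.measurable_indicator_repr (Φ : PiecewiseFrame F E) {w : ∀ b : G, E (𝒢.t b)}
    {O : Set G} (hO : MeasurableSet O)
    (hw : ContinuousOn (fun b => (⟨𝒢.t b, w b⟩ : TotalSpace F E)) O) :
    Measurable (O.indicator fun b => (Φ.basis (𝒢.t b)).repr (w b)) := by
  refine measurable_of_continuousOn_cover
    (fun i : Option (Fin Φ.N) => i.elim Oᶜ fun i => 𝒢.t ⁻¹' Φ.piece i ∩ O)
    (fun i => ?_) (fun a => ?_) fun i a ha => ?_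
  · cases i with
    | none => exact hO.compl
    | some i => exact (Φ.measurableSet_preimage 𝒢.continuous_t _).inter hO
  · by_cases h : a ∈ O
    · obtain ⟨i, hi⟩ := Φ.cover (𝒢.t a)
      exact ⟨some i, hi, h⟩
    · exact ⟨none, h⟩
  · cases i with
    | none =>
      exact (continuousWithinAt_const (b := (0 : EuclideanSpace ℂ _))).congr
        (fun b hb => indicator_of_notMem hb _) (indicator_of_notMem ha _)
    | some i =>
      refine ContinuousWithinAt.congr (f := fun b => (Φ.basis (𝒢.t b)).repr (w b)) ?_
        (fun b hb => indicator_of_mem hb.2 _) (indicator_of_mem ha.2 _)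
      exact continuousWithinAt_repr hE (fun l => (Φ.continuousOn i l _ ha.1).comp
        𝒢.continuous_t.continuousWithinAt fun _ h => h.1) ((hw a ha.2).mono inter_subset_right)

lemma PiecewiseFrame.measurable_repr (Φ : PiecewiseFrame F E) {w : ∀ b : G, E (𝒢.t b)}
    (hw : Continuous fun b => (⟨𝒢.t b, w b⟩ : TotalSpace F E)) :
    Measurable fun b => (Φ.basis (𝒢.t b)).repr (w b) := by
  simpa using Φ.measurable_indicator_repr hE MeasurableSet.univ hw.continuousOn

end Matrix

/-! ### The Schur test and the calculus of integral operators on L². -/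

section Schur

open scoped NNReal

/-- Cauchy–Schwarz for κφ = κ^(1/2) · (κ^(1/2) φ). -/
lemma sq_lintegral_mul_le {X : Type*} [MeasurableSpace X] {μ : Measure X} {κ φ : X → ℝ≥0∞}
    (hκ : Measurable κ) (hφ : Measurable φ) :
    (∫⁻ b, κ b * φ b ∂μ) ^ 2 ≤ (∫⁻ b, κ b ∂μ) * ∫⁻ b, κ b * φ b ^ 2 ∂μ := by
  have h2 : Real.HolderConjugate 2 2 := ⟨by norm_num, by norm_num, by norm_num⟩
  have h := ENNReal.lintegral_mul_le_Lp_mul_Lq μ h2 (f := fun b => κ b ^ (1 / 2 : ℝ))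
    (g := fun b => κ b ^ (1 / 2 : ℝ) * φ b) (hκ.pow_const _).aemeasurable
    ((hκ.pow_const _).mul hφ).aemeasurable
  have hsq : ∀ t : ℝ≥0∞, t ^ (1 / 2 : ℝ) * t ^ (1 / 2 : ℝ) = t := fun t => by
    rw [← ENNReal.rpow_add_of_nonneg _ _ (by norm_num) (by norm_num)]
    norm_num
  have hsq' : ∀ t : ℝ≥0∞, (t ^ (1 / 2 : ℝ)) ^ 2 = t := fun t => by rw [sq, hsq]
  have e1 : ∀ b, ((fun b => κ b ^ (1 / 2 : ℝ)) * fun b => κ b ^ (1 / 2 : ℝ) * φ b) b =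
      κ b * φ b := fun b => by
    rw [Pi.mul_apply, ← _root_.mul_assoc, hsq]
  simp only [e1, ENNReal.rpow_two, mul_pow, hsq'] at h
  calc _ ≤ _ := pow_le_pow_left' h 2
    _ = _ := by rw [mul_pow, hsq', hsq']

variable {X : Type*} [MeasurableSpace X] {μ : Measure X}
  {V : Type*} [NormedAddCommGroup V] [InnerProductSpace ℂ V] [CompleteSpace V]

/-- An operator-valued kernel whose rows and columns are integrable with integrals at most `C`. -/
structure IsSchurKernel (μ : Measure X) (k : X → X → V →L[ℂ] V) (C : ℝ≥0) : Prop where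
  meas : StronglyMeasurable (Function.uncurry k)
  row : ∀ᵐ a ∂μ, ∫⁻ b, ‖k a b‖ₑ ∂μ ≤ C
  col : ∀ᵐ b ∂μ, ∫⁻ a, ‖k a b‖ₑ ∂μ ≤ C

namespace IsSchurKernel

variable {k k₁ k₂ k₃ : X → X → V →L[ℂ] V} {C C₁ C₂ C₃ : ℝ≥0}

lemma measurable_enorm (h : IsSchurKernel μ k C) : Measurable fun p : X × X => ‖k p.1 p.2‖ₑ :=
  h.meas.enorm

lemma measurable_enorm_left (h : IsSchurKernel μ k C) (a : X) : Measurable fun b => ‖k a b‖ₑ :=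
  Measurable.comp (g := fun p : X × X => ‖k p.1 p.2‖ₑ) (f := fun b => (a, b)) h.measurable_enorm
    (measurable_const.prodMk measurable_id)

lemma measurable_enorm_right (h : IsSchurKernel μ k C) (b : X) : Measurable fun a => ‖k a b‖ₑ :=
  Measurable.comp (g := fun p : X × X => ‖k p.1 p.2‖ₑ) (f := fun a => (a, b)) h.measurable_enorm
    (measurable_id.prodMk measurable_const)

lemma stronglyMeasurable_apply (h : IsSchurKernel μ k C) {w : X → V} (hw : StronglyMeasurable w) :
    StronglyMeasurable fun p : X × X => k p.1 p.2 (w p.2) :=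
  isBoundedBilinearMap_apply.continuous.comp_stronglyMeasurable
    (h.meas.prodMk (hw.comp_measurable measurable_snd))

variable [SFinite μ]

/-- The Schur test. Weighted Cauchy–Schwarz in each row costs one factor C; after Tonelli, the
column bound gives the other. -/
lemma lintegral_sq_le (h : IsSchurKernel μ k C) {φ : X → ℝ≥0∞} (hφ : Measurable φ) :
    ∫⁻ a, (∫⁻ b, ‖k a b‖ₑ * φ b ∂μ) ^ 2 ∂μ ≤ C ^ 2 * ∫⁻ b, φ b ^ 2 ∂μ := by
  have hm : Measurable (Function.uncurry fun a b => ‖k a b‖ₑ * φ b ^ 2) :=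
    h.measurable_enorm.mul ((hφ.comp measurable_snd).pow_const 2)
  calc ∫⁻ a, (∫⁻ b, ‖k a b‖ₑ * φ b ∂μ) ^ 2 ∂μ
      ≤ ∫⁻ a, C * ∫⁻ b, ‖k a b‖ₑ * φ b ^ 2 ∂μ ∂μ := by
        refine lintegral_mono_ae ?_
        filter_upwards [h.row] with a ha
        exact (sq_lintegral_mul_le (h.measurable_enorm_left a) hφ).trans (by gcongr)
    _ = C * ∫⁻ b, ∫⁻ a, ‖k a b‖ₑ * φ b ^ 2 ∂μ ∂μ := by
        rw [lintegral_const_mul' _ _ ENNReal.coe_ne_top, lintegral_lintegral_swap hm.aemeasurable]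
    _ ≤ C * ∫⁻ b, C * φ b ^ 2 ∂μ := by
        gcongr 1
        refine lintegral_mono_ae ?_
        filter_upwards [h.col] with b hb
        rw [lintegral_mul_const _ (h.measurable_enorm_right b)]
        gcongr
    _ = C ^ 2 * ∫⁻ b, φ b ^ 2 ∂μ := by
        rw [lintegral_const_mul' _ _ ENNReal.coe_ne_top, ← _root_.mul_assoc, sq]

lemma measurable_lintegral (h : IsSchurKernel μ k C) {φ : X → ℝ≥0∞} (hφ : Measurable φ) :
    Measurable fun a => ∫⁻ b, ‖k a b‖ₑ * φ b ∂μ :=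
  (h.measurable_enorm.mul (hφ.comp measurable_snd)).lintegral_prod_right'

lemma ae_lintegral_lt_top (h : IsSchurKernel μ k C) {φ : X → ℝ≥0∞} (hφ : Measurable φ)
    (hφ2 : ∫⁻ b, φ b ^ 2 ∂μ ≠ ⊤) : ∀ᵐ a ∂μ, ∫⁻ b, ‖k a b‖ₑ * φ b ∂μ < ⊤ := by
  have h1 : ∫⁻ a, (∫⁻ b, ‖k a b‖ₑ * φ b ∂μ) ^ 2 ∂μ ≠ ⊤ :=
    ne_top_of_le_ne_top (ENNReal.mul_ne_top (by simp) hφ2) (h.lintegral_sq_le hφ)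
  filter_upwards [ae_lt_top ((h.measurable_lintegral hφ).pow_const 2) h1] with a ha
  by_contra hc
  rw [not_lt, top_le_iff] at hc
  simp [hc] at ha

end IsSchurKernel

lemma lintegral_enorm_sq_eq {f : X → V} : ∫⁻ b, ‖f b‖ₑ ^ 2 ∂μ = eLpNorm f 2 μ ^ 2 := by
  rw [eLpNorm_eq_lintegral_rpow_enorm_toReal (by norm_num) (by norm_num)]
  simp only [ENNReal.toReal_ofNat, ENNReal.rpow_two]
  rw [← ENNReal.rpow_natCast, ← ENNReal.rpow_mul]
  norm_num

lemma lintegral_enorm_sq_ne_top (w : Lp V 2 μ) : ∫⁻ b, ‖w b‖ₑ ^ 2 ∂μ ≠ ⊤ := by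
  rw [lintegral_enorm_sq_eq]
  exact ENNReal.pow_ne_top (Lp.eLpNorm_ne_top w)

namespace IsSchurKernel

variable {k k₁ k₂ k₃ : X → X → V →L[ℂ] V} {C C₁ C₂ C₃ : ℝ≥0} [SFinite μ]

lemma measurable_enorm_Lp (w : Lp V 2 μ) : Measurable fun b => ‖w b‖ₑ :=
  (Lp.stronglyMeasurable w).enorm

lemma ae_integrable (h : IsSchurKernel μ k C) (w : Lp V 2 μ) :
    ∀ᵐ a ∂μ, Integrable (fun b => k a b (w b)) μ := by
  filter_upwards [h.ae_lintegral_lt_top (measurable_enorm_Lp w)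
    (lintegral_enorm_sq_ne_top w)] with a ha
  refine ⟨((h.stronglyMeasurable_apply (Lp.stronglyMeasurable w)).comp_measurable
    (measurable_const.prodMk measurable_id)).aestronglyMeasurable, lt_of_le_of_lt ?_ ha⟩
  exact lintegral_mono fun b => (k a b).le_opENorm _

lemma eLpNorm_integral_le (h : IsSchurKernel μ k C) (w : Lp V 2 μ) :
    eLpNorm (fun a => ∫ b, k a b (w b) ∂μ) 2 μ ≤ C * eLpNorm w 2 μ := by
  have h1 : eLpNorm (fun a => ∫ b, k a b (w b) ∂μ) 2 μ ^ 2 ≤ (C * eLpNorm w 2 μ) ^ 2 := by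
    rw [← lintegral_enorm_sq_eq, mul_pow, ← lintegral_enorm_sq_eq]
    refine (lintegral_mono fun a => ?_).trans (h.lintegral_sq_le (measurable_enorm_Lp w))
    gcongr
    exact (enorm_integral_le_lintegral_enorm _).trans
      (lintegral_mono fun b => (k a b).le_opENorm _)
  exact (ENNReal.pow_le_pow_left_iff two_ne_zero).1 h1

lemma memLp_integral (h : IsSchurKernel μ k C) (w : Lp V 2 μ) :
    MemLp (fun a => ∫ b, k a b (w b) ∂μ) 2 μ :=
  ⟨(h.stronglyMeasurable_apply (Lp.stronglyMeasurable w)).integral_prod_right'.aestronglyMeasurable,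
    (h.eLpNorm_integral_le w).trans_lt
      (ENNReal.mul_lt_top ENNReal.coe_lt_top (Lp.eLpNorm_lt_top w))⟩

/-- The bounded operator on `L²` with a given Schur kernel. -/
def op (h : IsSchurKernel μ k C) : Lp V 2 μ →L[ℂ] Lp V 2 μ :=
  LinearMap.mkContinuous
    { toFun := fun w => (h.memLp_integral w).toLp
      map_add' := fun w w' => by
        refine Lp.ext ?_
        filter_upwards [(h.memLp_integral (w + w')).coeFn_toLp, Lp.coeFn_add
          (h.memLp_integral w).toLp (h.memLp_integral w').toLp, (h.memLp_integral w).coeFn_toLp,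
          (h.memLp_integral w').coeFn_toLp, h.ae_integrable w, h.ae_integrable w'] with
          a h1 h2 h3 h4 h5 h6
        rw [h1, h2, Pi.add_apply, h3, h4, ← integral_add h5 h6]
        refine integral_congr_ae ?_
        filter_upwards [Lp.coeFn_add w w'] with b hb
        rw [hb, Pi.add_apply, map_add]
      map_smul' := fun c w => by
        refine Lp.ext ?_
        filter_upwards [(h.memLp_integral (c • w)).coeFn_toLp, Lp.coeFn_smul c
          (h.memLp_integral w).toLp, (h.memLp_integral w).coeFn_toLp] with a h1 h2 h3
        rw [h1, RingHom.id_apply, h2, Pi.smul_apply, h3, ← integral_smul]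
        refine integral_congr_ae ?_
        filter_upwards [Lp.coeFn_smul c w] with b hb
        rw [hb, Pi.smul_apply, map_smul] }
    C fun w => by
      have h1 := h.eLpNorm_integral_le w
      change ‖(h.memLp_integral w).toLp‖ ≤ C * ‖w‖
      rw [Lp.norm_toLp, Lp.norm_def]
      have h2 := ENNReal.toReal_mono (ENNReal.mul_ne_top ENNReal.coe_ne_top (Lp.eLpNorm_ne_top w)) h1
      rwa [ENNReal.toReal_mul, ENNReal.coe_toReal] at h2

lemma op_apply (h : IsSchurKernel μ k C) (w : Lp V 2 μ) :
    h.op w =ᵐ[μ] fun a => ∫ b, k a b (w b) ∂μ :=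
  (h.memLp_integral w).coeFn_toLp

lemma norm_op_le (h : IsSchurKernel μ k C) : ‖h.op‖ ≤ C :=
  LinearMap.mkContinuous_norm_le _ C.2 _

lemma op_add (h₁ : IsSchurKernel μ k₁ C₁) (h₂ : IsSchurKernel μ k₂ C₂)
    (h₃ : IsSchurKernel μ k₃ C₃) (heq : ∀ a b, k₃ a b = k₁ a b + k₂ a b) :
    h₃.op = h₁.op + h₂.op := by
  ext1 w
  refine Lp.ext ?_
  filter_upwards [h₁.op_apply w, h₂.op_apply w, h₃.op_apply w, Lp.coeFn_add (h₁.op w) (h₂.op w),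
    h₁.ae_integrable w, h₂.ae_integrable w] with a e1 e2 e3 e4 i1 i2
  rw [e3, add_apply, e4, Pi.add_apply, e1, e2, ← integral_add i1 i2]
  simp only [heq, add_apply]

lemma op_smul (c : ℂ) (h₁ : IsSchurKernel μ k₁ C₁) (h₂ : IsSchurKernel μ k₂ C₂)
    (heq : ∀ a b, k₂ a b = c • k₁ a b) : h₂.op = c • h₁.op := by
  ext1 w
  refine Lp.ext ?_
  filter_upwards [h₁.op_apply w, h₂.op_apply w, Lp.coeFn_smul c (h₁.op w)] with a e1 e2 e4
  rw [e2, smul_apply, e4, Pi.smul_apply, e1, ← integral_smul]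
  simp only [heq, smul_apply]

/-- Fubini in (b, c) for fixed a. The function ψ(b) = ∫ ‖k₂(b, c)‖ ‖w(c)‖ is square integrable by
the Schur test, so for almost every a its integral against ‖k₁(a, ·)‖ is finite, and that is the
absolute integrability required. -/
lemma op_comp (h₁ : IsSchurKernel μ k₁ C₁) (h₂ : IsSchurKernel μ k₂ C₂)
    (h₃ : IsSchurKernel μ k₃ C₃)
    (heq : ∀ᵐ a ∂μ, ∀ᵐ c ∂μ, k₃ a c = ∫ b, k₁ a b ∘L k₂ b c ∂μ) :
    h₃.op = h₁.op ∘L h₂.op := by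
  ext1 w
  refine Lp.ext ?_
  set ψ : X → ℝ≥0∞ := fun b => ∫⁻ c, ‖k₂ b c‖ₑ * ‖w c‖ₑ ∂μ with hψ
  have hψm : Measurable ψ := h₂.measurable_lintegral (measurable_enorm_Lp w)
  have hψ2 : ∫⁻ b, ψ b ^ 2 ∂μ ≠ ⊤ :=
    ne_top_of_le_ne_top (ENNReal.mul_ne_top (by simp) (lintegral_enorm_sq_ne_top w))
      (h₂.lintegral_sq_le (measurable_enorm_Lp w))
  filter_upwards [h₃.op_apply w, h₁.op_apply (h₂.op w), heq, h₁.ae_lintegral_lt_top hψm hψ2]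
    with a e3 e1 ha hfin
  have hk1 : StronglyMeasurable fun b => k₁ a b :=
    h₁.meas.comp_measurable (measurable_const.prodMk measurable_id)
  have hcomp : StronglyMeasurable fun p : X × X => k₁ a p.1 ∘L k₂ p.1 p.2 :=
    (ContinuousLinearMap.compL ℂ V V V).continuous₂.comp_stronglyMeasurable
      ((hk1.comp_measurable measurable_fst).prodMk h₂.meas)
  have hΨm : Measurable fun p : X × X => ‖k₁ a p.1‖ₑ * (‖k₂ p.1 p.2‖ₑ * ‖w p.2‖ₑ) :=
    ((h₁.measurable_enorm_left a).comp measurable_fst).mul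
      (h₂.measurable_enorm.mul ((measurable_enorm_Lp w).comp measurable_snd))
  have hΨ : ∫⁻ p : X × X, ‖k₁ a p.1‖ₑ * (‖k₂ p.1 p.2‖ₑ * ‖w p.2‖ₑ) ∂(μ.prod μ) < ⊤ := by
    rw [lintegral_prod _ hΨm.aemeasurable]
    refine lt_of_le_of_lt (le_of_eq (lintegral_congr fun b => ?_)) hfin
    have hm : Measurable fun c => ‖k₂ b c‖ₑ * ‖w c‖ₑ :=
      (h₂.measurable_enorm_left b).mul (measurable_enorm_Lp w)
    exact lintegral_const_mul (‖k₁ a b‖ₑ) hm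
  have hint : Integrable (fun p : X × X => k₁ a p.1 (k₂ p.1 p.2 (w p.2))) (μ.prod μ) :=
    ⟨(isBoundedBilinearMap_apply.continuous.comp_stronglyMeasurable
      ((hk1.comp_measurable measurable_fst).prodMk
        (h₂.stronglyMeasurable_apply (Lp.stronglyMeasurable w)))).aestronglyMeasurable,
      lt_of_le_of_lt (lintegral_mono fun p => ((k₁ a p.1).le_opENorm _).trans
        (mul_le_mul_right ((k₂ p.1 p.2).le_opENorm _) _)) hΨ⟩
  have hcol : ∀ᵐ c ∂μ, ∫⁻ b, ‖k₁ a b‖ₑ * (‖k₂ b c‖ₑ * ‖w c‖ₑ) ∂μ < ⊤ := by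
    rw [lintegral_prod_symm _ hΨm.aemeasurable] at hΨ
    exact ae_lt_top hΨm.lintegral_prod_left' hΨ.ne
  rw [e3, ContinuousLinearMap.comp_apply, e1]
  calc ∫ c, k₃ a c (w c) ∂μ = ∫ c, ∫ b, k₁ a b (k₂ b c (w c)) ∂μ ∂μ := by
        refine integral_congr_ae ?_
        filter_upwards [ha, hcol] with c hc hci
        simp only [hc]
        -- Integrability of b ↦ k₁(a, b)k₂(b, c) is extracted by dividing by ‖w(c)‖; where w(c) = 0
        -- both sides vanish.
        by_cases hw : w c = 0
        · simp [hw]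
        · have hi : Integrable (fun b => k₁ a b ∘L k₂ b c) μ := by
            refine ⟨(hcomp.comp_measurable (f := fun p : X × X => _) (g := fun b => (b, c))
              (measurable_id.prodMk measurable_const)).aestronglyMeasurable, ?_⟩
            simp only [← _root_.mul_assoc] at hci
            have hm : Measurable fun b => ‖k₁ a b‖ₑ * ‖k₂ b c‖ₑ :=
              (h₁.measurable_enorm_left a).mul (h₂.measurable_enorm_right c)
            rw [lintegral_mul_const _ hm] at hci
            refine lt_of_le_of_lt (lintegral_mono fun b => ?_)
              (ENNReal.lt_top_of_mul_ne_top_left hci.ne (enorm_ne_zero.2 hw))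
            exact ContinuousLinearMap.opENorm_comp_le _ _
          exact ContinuousLinearMap.integral_apply hi (w c)
    _ = ∫ b, ∫ c, k₁ a b (k₂ b c (w c)) ∂μ ∂μ := (integral_integral_swap hint).symm
    _ = ∫ b, k₁ a b (h₂.op w b) ∂μ := by
        refine integral_congr_ae ?_
        filter_upwards [h₂.op_apply w, h₂.ae_integrable w] with b hb hbi
        rw [hb]
        exact (k₁ a b).integral_comp_comm hbi

/-- Fubini for the double integral of ⟨k₁(b, a)w(a), v(b)⟩, which is absolutely integrable because
ψ‖v‖ ≤ ψ² + ‖v‖² with ψ square integrable by the Schur test. -/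
lemma op_adjoint (h₁ : IsSchurKernel μ k₁ C₁) (h₂ : IsSchurKernel μ k₂ C₂)
    (heq : ∀ᵐ a ∂μ, ∀ᵐ b ∂μ, ∀ v w, inner ℂ w (k₂ a b v) = inner ℂ (k₁ b a w) v) :
    h₂.op = ContinuousLinearMap.adjoint h₁.op := by
  have hmain : ∀ v w : Lp V 2 μ, inner ℂ w (h₂.op v) = inner ℂ (h₁.op w) v := fun v w => by
    set ψ : X → ℝ≥0∞ := fun b => ∫⁻ a, ‖k₁ b a‖ₑ * ‖w a‖ₑ ∂μ with hψ
    have hψm : Measurable ψ := h₁.measurable_lintegral (measurable_enorm_Lp w)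
    have hint : Integrable (fun p : X × X => (inner ℂ (k₁ p.1 p.2 (w p.2)) (v p.1) : ℂ))
        (μ.prod μ) := by
      refine ⟨((h₁.stronglyMeasurable_apply (Lp.stronglyMeasurable w)).inner
        ((Lp.stronglyMeasurable v).comp_measurable measurable_fst)).aestronglyMeasurable, ?_⟩
      calc ∫⁻ p : X × X, ‖(inner ℂ (k₁ p.1 p.2 (w p.2)) (v p.1) : ℂ)‖ₑ ∂(μ.prod μ)
          ≤ ∫⁻ p : X × X, ‖k₁ p.1 p.2‖ₑ * ‖w p.2‖ₑ * ‖v p.1‖ₑ ∂(μ.prod μ) := by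
            refine lintegral_mono fun p => ?_
            refine le_trans ?_ (mul_le_mul_left ((k₁ p.1 p.2).le_opENorm _) _)
            simp only [enorm_eq_nnnorm, ← ENNReal.coe_mul]
            exact ENNReal.coe_le_coe.2 (nnnorm_inner_le_nnnorm _ _)
        _ = ∫⁻ b, ψ b * ‖v b‖ₑ ∂μ := by
            have hm : Measurable fun p : X × X => ‖k₁ p.1 p.2‖ₑ * ‖w p.2‖ₑ * ‖v p.1‖ₑ :=
              (h₁.measurable_enorm.mul ((measurable_enorm_Lp w).comp measurable_snd)).mul
                ((measurable_enorm_Lp v).comp measurable_fst)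
            rw [lintegral_prod _ hm.aemeasurable]
            refine lintegral_congr fun b => ?_
            have hm' : Measurable fun a => ‖k₁ b a‖ₑ * ‖w a‖ₑ :=
              (h₁.measurable_enorm_left b).mul (measurable_enorm_Lp w)
            exact lintegral_mul_const (‖v b‖ₑ) hm'
        _ ≤ ∫⁻ b, ψ b ^ 2 + ‖v b‖ₑ ^ 2 ∂μ := by
            refine lintegral_mono fun b => ?_
            rcases le_total (ψ b) ‖v b‖ₑ with h | h
            · exact (mul_le_mul_left h _).trans ((sq _).symm.le.trans le_add_self)
            · exact (mul_le_mul_right h _).trans ((sq _).symm.le.trans le_self_add)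
        _ = ∫⁻ b, ψ b ^ 2 ∂μ + ∫⁻ b, ‖v b‖ₑ ^ 2 ∂μ := lintegral_add_left (hψm.pow_const 2) _
        _ < ⊤ := ENNReal.add_lt_top.2 ⟨(h₁.lintegral_sq_le (measurable_enorm_Lp w)).trans_lt
            (ENNReal.mul_lt_top (by simp) (lintegral_enorm_sq_ne_top w).lt_top),
            (lintegral_enorm_sq_ne_top v).lt_top⟩
    calc inner ℂ w (h₂.op v) = ∫ a, ∫ b, (inner ℂ (k₁ b a (w a)) (v b) : ℂ) ∂μ ∂μ := by
          rw [L2.inner_def]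
          refine integral_congr_ae ?_
          filter_upwards [h₂.op_apply v, h₂.ae_integrable v, heq] with a e1 i1 ha
          rw [e1, ← integral_inner i1]
          refine integral_congr_ae ?_
          filter_upwards [ha] with b hb
          exact hb _ _
      _ = ∫ b, ∫ a, (inner ℂ (k₁ b a (w a)) (v b) : ℂ) ∂μ ∂μ := (integral_integral_swap hint).symm
      _ = inner ℂ (h₁.op w) v := by
          rw [L2.inner_def]
          refine integral_congr_ae ?_
          filter_upwards [h₁.op_apply w, h₁.ae_integrable w] with b e1 i1
          rw [e1, ← inner_conj_symm, ← integral_inner i1, ← integral_conj]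
          simp only [inner_conj_symm]
  rw [ContinuousLinearMap.eq_adjoint_iff]
  intro v w
  rw [← inner_conj_symm, hmain, inner_conj_symm]

end IsSchurKernel

end Schur

/-! ### The regular representations in frame coordinates. -/

section Regular

variable {m n : ℕ} {G M : Type u}
  [TopologicalSpace G] [ChartedSpace (EuclideanSpace ℝ (Fin (m + n))) G]
  [TopologicalSpace M] [ChartedSpace (EuclideanSpace ℝ (Fin m)) M]
  {𝒢 : LieGroupoid m n G M}

lemma s_qdiv {a b : G} (h : 𝒢.s a = 𝒢.s b) : 𝒢.s (𝒢.qdiv (a, b)) = 𝒢.t b := by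
  rw [qdiv_of_eq h, s_div h]

lemma t_qdiv {a b : G} (h : 𝒢.s a = 𝒢.s b) : 𝒢.t (𝒢.qdiv (a, b)) = 𝒢.t a := by
  rw [qdiv_of_eq h, t_div h]

lemma inv_qdiv {a b : G} (h : 𝒢.s a = 𝒢.s b) : 𝒢.inv (𝒢.qdiv (a, b)) = 𝒢.qdiv (b, a) := by
  rw [qdiv_of_eq h, qdiv_of_eq h.symm, inv_div h]

lemma qdiv_qdiv {a b c : G} (h : 𝒢.s a = 𝒢.s c) (h' : 𝒢.s b = 𝒢.s c) :
    𝒢.qdiv (𝒢.qdiv (a, c), 𝒢.qdiv (b, c)) = 𝒢.qdiv (a, b) := by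
  rw [qdiv_of_eq ((s_qdiv h).trans (s_qdiv h').symm), qdiv_of_eq h, qdiv_of_eq h',
    qdiv_of_eq (h.trans h'.symm)]
  exact mul_div_mul (h.trans (𝒢.t_inv c).symm) (h'.trans (𝒢.t_inv c).symm)

/-- If `ψ` is continuous at `a₀` with positive real part there, then `ψ(a b⁻¹)` has real part
bounded below for `a` near `a₀` and `b` near the unit. -/
lemma exists_nhds_re_qdiv_pos {ψ : G → ℂ} {a₀ : G} (hψ : ContinuousAt ψ a₀)
    (hpos : 0 < (ψ a₀).re) : ∃ U ∈ 𝓝 a₀, ∃ V ∈ 𝓝 (𝒢.unit (𝒢.s a₀)), ∃ r : ℝ, 0 < r ∧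
      ∀ a ∈ U, ∀ b ∈ V, 𝒢.s a = 𝒢.s b → r < (ψ (𝒢.qdiv (a, b))).re := by
  have hs : 𝒢.s a₀ = 𝒢.s (𝒢.unit (𝒢.s a₀)) := (𝒢.s_unit _).symm
  have h0 : 𝒢.qdiv (a₀, 𝒢.unit (𝒢.s a₀)) = a₀ := by rw [qdiv_of_eq hs, div_unit]
  have hc : ContinuousWithinAt (fun p : G × G => (ψ (𝒢.qdiv p)).re)
      {p | 𝒢.s p.1 = 𝒢.s p.2} (a₀, 𝒢.unit (𝒢.s a₀)) := by
    refine (Complex.continuous_re.continuousAt.comp_continuousWithinAt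
      (ContinuousAt.comp_continuousWithinAt (g := ψ) ?_ (continuousOn_qdiv _ hs)))
    rwa [h0]
  have hev := hc.tendsto.eventually_const_lt (u := (ψ a₀).re / 2) (by rw [h0]; linarith)
  rw [eventually_nhdsWithin_iff, nhds_prod_eq, eventually_prod_iff] at hev
  obtain ⟨p, hp, q, hq, h⟩ := hev
  exact ⟨_, hp, _, hq, _, half_pos hpos, fun a ha b hb hab => h ha hb hab⟩

variable {F : Type v} [NormedAddCommGroup F] [NormedSpace ℂ F]
  {E : M → Type u} [∀ x, NormedAddCommGroup (E x)] [∀ x, InnerProductSpace ℂ (E x)]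

lemma Kernel.norm_at (κ : 𝒢.Kernel E) (a : G) {p q : M} (hp : 𝒢.s a = p) (hq : 𝒢.t a = q) :
    ‖κ.at a hp hq‖ = ‖κ a‖ := by
  subst hp hq
  rfl

lemma Kernel.norm_atInv (κ : 𝒢.Kernel E) (a : G) : ‖κ.atInv a‖ = ‖κ (𝒢.inv a)‖ :=
  κ.norm_at _ _ _

section MatrixAlgebra

variable {k : ℕ} {H H' H'' : Type*} [NormedAddCommGroup H] [InnerProductSpace ℂ H]
  [NormedAddCommGroup H'] [InnerProductSpace ℂ H'] [NormedAddCommGroup H'']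
  [InnerProductSpace ℂ H''] (b : OrthonormalBasis (Fin k) ℂ H) (b' : OrthonormalBasis (Fin k) ℂ H')
  (b'' : OrthonormalBasis (Fin k) ℂ H'')

lemma clmMatrix_comp (T : H' →L[ℂ] H'') (S : H →L[ℂ] H') :
    clmMatrix b b'' (T ∘L S) = clmMatrix b' b'' T ∘L clmMatrix b b' S := by
  ext1 v
  simp [clmMatrix_apply]

lemma clmMatrix_add (T S : H →L[ℂ] H') :
    clmMatrix b b' (T + S) = clmMatrix b b' T + clmMatrix b b' S := by
  ext1 v
  simp [clmMatrix_apply]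

lemma clmMatrix_smul (c : ℂ) (T : H →L[ℂ] H') :
    clmMatrix b b' (c • T) = c • clmMatrix b b' T := by
  ext1 v
  simp [clmMatrix_apply]

lemma clmMatrix_integral {X : Type*} [MeasurableSpace X] {μ : Measure X} (T : X → H →L[ℂ] H') :
    clmMatrix b b' (∫ x, T x ∂μ) = ∫ x, clmMatrix b b' (T x) ∂μ :=
  ((b.repr.toContinuousLinearEquiv.arrowCongr
    b'.repr.toContinuousLinearEquiv).integral_comp_comm T).symm

end MatrixAlgebra

variable [TopologicalSpace (TotalSpace F E)] (Φ : PiecewiseFrame F E)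

lemma PiecewiseFrame.clmMatrix_at (κ : 𝒢.Kernel E) (a : G) {p q : M} (hp : 𝒢.s a = p)
    (hq : 𝒢.t a = q) : clmMatrix (Φ.basis p) (Φ.basis q) (κ.at a hp hq) = Φ.mat κ a := by
  subst hp hq
  rfl

lemma PiecewiseFrame.clmMatrix_atDiv (κ : 𝒢.Kernel E) {a b : G} (h : 𝒢.s a = 𝒢.s b) :
    clmMatrix (Φ.basis (𝒢.t b)) (Φ.basis (𝒢.t a)) (κ.atDiv a b h) = Φ.mat κ (𝒢.qdiv (a, b)) := by
  rw [qdiv_of_eq h]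
  exact Φ.clmMatrix_at κ _ _ _

/-- The integral kernel of the regular representation, in a global frame. -/
def PiecewiseFrame.regKernel (κ : 𝒢.Kernel E) (a b : G) :
    EuclideanSpace ℂ (Fin (Module.finrank ℂ F)) →L[ℂ] EuclideanSpace ℂ (Fin (Module.finrank ℂ F)) :=
  Φ.mat κ (𝒢.qdiv (a, b))

lemma PiecewiseFrame.norm_mat (κ : 𝒢.Kernel E) (a : G) : ‖Φ.mat κ a‖ = ‖κ a‖ :=
  norm_clmMatrix _ _ _

variable [FiberBundle F E] [VectorBundle ℂ F E] [FiniteDimensional ℂ F]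
  [IsManifold (𝓡 (m + n)) ∞ G] (g : AmbientMetric m n G)
  [MeasurableSpace G] [BorelSpace G] [SecondCountableTopology G] [T2Space M]

open scoped NNReal

/-- By right invariance, the integral of |κ(ab⁻¹)| over a is that of |κ| over the fibre of t(b).
Writing ab⁻¹ = (ba⁻¹)⁻¹, the integral over b is that of |κ(c⁻¹)| over the fibre of t(a). These are
the two terms of the 1-norm. -/
lemma isSchurKernel (hE : SmoothHermitian F E m) {κ : 𝒢.Kernel E} (hκ : κ.Smooth F) {C : ℝ≥0}
    (hC : κ.l1Norm g ≤ C) (x : M) : IsSchurKernel (𝒢.vol g x) (Φ.regKernel κ) C := by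
  have hm : Measurable (Φ.mat κ) := Φ.measurable_mat hE hκ
  have hle : ∀ y, max (∫⁻ a, ‖κ a‖ₑ ∂(𝒢.vol g y)) (∫⁻ a, ‖κ.atInv a‖ₑ ∂(𝒢.vol g y)) ≤ C :=
    fun y => (le_iSup (fun y => max (∫⁻ a, ‖κ a‖ₑ ∂(𝒢.vol g y))
      (∫⁻ a, ‖κ.atInv a‖ₑ ∂(𝒢.vol g y))) y).trans hC
  refine ⟨(hm.comp (measurable_qdiv (𝒢 := 𝒢))).stronglyMeasurable, ?_, ?_⟩
  · filter_upwards [ae_mem_fiber (𝒢 := 𝒢) g x] with a ha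
    have h1 := lintegral_vol_t (𝒢 := 𝒢) g a (f := fun c => ‖Φ.mat κ (𝒢.inv c)‖ₑ)
      (hm.comp 𝒢.continuous_inv.measurable).enorm
    rw [ha] at h1
    calc ∫⁻ b, ‖Φ.regKernel κ a b‖ₑ ∂(𝒢.vol g x)
        = ∫⁻ b, ‖Φ.mat κ (𝒢.inv (𝒢.qdiv (b, a)))‖ₑ ∂(𝒢.vol g x) := by
          refine lintegral_congr_ae ?_
          filter_upwards [ae_mem_fiber (𝒢 := 𝒢) g x] with b hb
          rw [inv_qdiv (hb.trans ha.symm)]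
          rfl
      _ = ∫⁻ c, ‖κ.atInv c‖ₑ ∂(𝒢.vol g (𝒢.t a)) := by
          rw [h1]
          refine lintegral_congr fun c => ?_
          simp only [← ofReal_norm, Φ.norm_mat, κ.norm_atInv]
      _ ≤ C := (le_max_right _ _).trans (hle _)
  · filter_upwards [ae_mem_fiber (𝒢 := 𝒢) g x] with b hb
    have h1 := lintegral_vol_t (𝒢 := 𝒢) g b (f := fun c => ‖Φ.mat κ c‖ₑ) hm.enorm
    rw [hb] at h1
    calc ∫⁻ a, ‖Φ.regKernel κ a b‖ₑ ∂(𝒢.vol g x)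
        = ∫⁻ c, ‖κ c‖ₑ ∂(𝒢.vol g (𝒢.t b)) := by
          refine h1.trans (lintegral_congr fun c => ?_)
          simp only [← ofReal_norm, Φ.norm_mat]
      _ ≤ C := (le_max_left _ _).trans (hle _)

/-- The fibrewise `L²` space, in a global frame. -/
abbrev FiberL2 (F : Type v) [NormedAddCommGroup F] [NormedSpace ℂ F] (𝒢 : LieGroupoid m n G M)
    (g : AmbientMetric m n G) (x : M) : Type u :=
  Lp (EuclideanSpace ℂ (Fin (Module.finrank ℂ F))) 2 (𝒢.vol g x)

section Operators

variable {x : M} [SFinite (𝒢.vol g x)]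

/-- The operator on `L²(G_x)` with reduced kernel `κ`. -/
def PiecewiseFrame.regOp (hE : SmoothHermitian F E m) (x : M) [SFinite (𝒢.vol g x)]
    {κ : 𝒢.Kernel E} (hκ : κ.Smooth F) (hC : κ.l1Norm g ≠ ⊤) :
    FiberL2 F 𝒢 g x →L[ℂ] FiberL2 F 𝒢 g x :=
  (isSchurKernel Φ g hE hκ (ENNReal.coe_toNNReal hC).ge x).op

variable (hE : SmoothHermitian F E m)

lemma PiecewiseFrame.enorm_regOp_le {κ : 𝒢.Kernel E} (hκ : κ.Smooth F) (hC : κ.l1Norm g ≠ ⊤) :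
    ‖Φ.regOp g hE x hκ hC‖ₑ ≤ κ.l1Norm g := by
  have h := (isSchurKernel Φ g hE hκ (ENNReal.coe_toNNReal hC).ge x).norm_op_le
  rw [← ofReal_norm]
  refine (ENNReal.ofReal_le_ofReal h).trans_eq ?_
  rw [ENNReal.ofReal_coe_nnreal, ENNReal.coe_toNNReal hC]

lemma PiecewiseFrame.regOp_apply {κ : 𝒢.Kernel E} (hκ : κ.Smooth F) (hC : κ.l1Norm g ≠ ⊤)
    (w : FiberL2 F 𝒢 g x) : Φ.regOp g hE x hκ hC w =ᵐ[𝒢.vol g x]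
      fun a => ∫ b, Φ.mat κ (𝒢.qdiv (a, b)) (w b) ∂(𝒢.vol g x) :=
  IsSchurKernel.op_apply _ w

lemma PiecewiseFrame.regOp_add {κ₁ κ₂ κ₃ : 𝒢.Kernel E} (h₁ : κ₁.Smooth F) (h₂ : κ₂.Smooth F)
    (h₃ : κ₃.Smooth F) (hC₁ : κ₁.l1Norm g ≠ ⊤) (hC₂ : κ₂.l1Norm g ≠ ⊤) (hC₃ : κ₃.l1Norm g ≠ ⊤)
    (heq : κ₃ = κ₁ + κ₂) :
    Φ.regOp g hE x h₃ hC₃ = Φ.regOp g hE x h₁ hC₁ + Φ.regOp g hE x h₂ hC₂ := by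
  refine IsSchurKernel.op_add _ _ _ fun a b => ?_
  rw [heq]
  exact clmMatrix_add _ _ _ _

lemma PiecewiseFrame.regOp_smul (c : ℂ) {κ₁ κ₂ : 𝒢.Kernel E} (h₁ : κ₁.Smooth F)
    (h₂ : κ₂.Smooth F) (hC₁ : κ₁.l1Norm g ≠ ⊤) (hC₂ : κ₂.l1Norm g ≠ ⊤) (heq : κ₂ = c • κ₁) :
    Φ.regOp g hE x h₂ hC₂ = c • Φ.regOp g hE x h₁ hC₁ := by
  refine IsSchurKernel.op_smul c _ _ fun a b => ?_
  rw [heq]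
  exact clmMatrix_smul _ _ _ _

lemma PiecewiseFrame.mat_conv {f₁ f₂ : 𝒢.Kernel E} (d : G) :
    Φ.mat (Kernel.conv g f₁ f₂) d =
      ∫ b, Φ.mat f₁ (𝒢.qdiv (d, b)) ∘L Φ.mat f₂ b ∂(𝒢.vol g (𝒢.s d)) := by
  rw [PiecewiseFrame.mat, Kernel.conv, clmMatrix_integral]
  refine integral_congr_ae ?_
  filter_upwards [ae_mem_fiber (𝒢 := 𝒢) g (𝒢.s d)] with b hb
  rw [dif_pos hb.symm, clmMatrix_comp _ (Φ.basis (𝒢.t b)), Φ.clmMatrix_atDiv, Φ.clmMatrix_at]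

/-- In the convolution at ac⁻¹, replace b by bc⁻¹, allowed by right invariance; since (ac⁻¹)(bc⁻¹)⁻¹
= ab⁻¹, the integrand becomes f₁(ab⁻¹)f₂(bc⁻¹), the kernel of the composite. -/
lemma PiecewiseFrame.regOp_conv {f₁ f₂ f : 𝒢.Kernel E} (h₁ : f₁.Smooth F) (h₂ : f₂.Smooth F)
    (h : f.Smooth F) (hC₁ : f₁.l1Norm g ≠ ⊤) (hC₂ : f₂.l1Norm g ≠ ⊤) (hC : f.l1Norm g ≠ ⊤)
    (heq : f = Kernel.conv g f₁ f₂) :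
    Φ.regOp g hE x h hC = Φ.regOp g hE x h₁ hC₁ ∘L Φ.regOp g hE x h₂ hC₂ := by
  refine IsSchurKernel.op_comp _ _ _ ?_
  filter_upwards [ae_mem_fiber (𝒢 := 𝒢) g x] with a ha
  filter_upwards [ae_mem_fiber (𝒢 := 𝒢) g x] with c hc
  have hac : 𝒢.s a = 𝒢.s c := ha.trans hc.symm
  have hm₁ := Φ.measurable_mat hE h₁
  have hm₂ := Φ.measurable_mat hE h₂
  have hq : Measurable fun b => 𝒢.qdiv (𝒢.qdiv (a, c), b) :=
    (measurable_qdiv (𝒢 := 𝒢)).comp (measurable_const.prodMk measurable_id)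
  have hm : AEStronglyMeasurable (fun b => Φ.mat f₁ (𝒢.qdiv (𝒢.qdiv (a, c), b)) ∘L Φ.mat f₂ b)
      ((𝒢.vol g (𝒢.s c)).map fun b => 𝒢.qdiv (b, c)) :=
    (isBoundedBilinearMap_comp (𝕜 := ℂ).continuous.comp_stronglyMeasurable
      ((hm₁.comp hq).stronglyMeasurable.prodMk hm₂.stronglyMeasurable)).aestronglyMeasurable
  rw [PiecewiseFrame.regKernel, heq, Φ.mat_conv, s_qdiv hac, ← map_qdiv_vol g c,
    integral_map (measurable_qdiv_left c).aemeasurable hm, hc]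
  refine integral_congr_ae ?_
  filter_upwards [ae_mem_fiber (𝒢 := 𝒢) g x] with b hb
  rw [qdiv_qdiv hac (hb.trans hc.symm)]
  rfl

/-- Since (ab⁻¹)⁻¹ = ba⁻¹, the pointwise adjoint relation at ab⁻¹ is the relation between transposed
kernels; orthonormal frames preserve it. -/
lemma PiecewiseFrame.regOp_star {f κ : 𝒢.Kernel E} (h₁ : κ.Smooth F) (h₂ : f.Smooth F)
    (hC₁ : κ.l1Norm g ≠ ⊤) (hC₂ : f.l1Norm g ≠ ⊤) (hadj : Kernel.IsAdjoint f κ) :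
    Φ.regOp g hE x h₂ hC₂ = ContinuousLinearMap.adjoint (Φ.regOp g hE x h₁ hC₁) := by
  refine IsSchurKernel.op_adjoint _ _ ?_
  filter_upwards [ae_mem_fiber (𝒢 := 𝒢) g x] with a ha
  filter_upwards [ae_mem_fiber (𝒢 := 𝒢) g x] with b hb
  intro v w
  have hab : 𝒢.s a = 𝒢.s b := ha.trans hb.symm
  rw [PiecewiseFrame.regKernel, PiecewiseFrame.regKernel, ← inv_qdiv hab]
  set d := 𝒢.qdiv (a, b)
  rw [← Φ.clmMatrix_at κ (𝒢.inv d) (𝒢.s_inv d) (𝒢.t_inv d), PiecewiseFrame.mat, clmMatrix_apply,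
    clmMatrix_apply, LinearIsometryEquiv.inner_map_eq_flip]
  exact ((Φ.basis (𝒢.t d)).repr.symm.inner_map_eq_flip w
    (f d ((Φ.basis (𝒢.s d)).repr.symm v))).symm.trans (hadj d _ _)

/-- Operators of the regular representation, applied to sections. -/
lemma PiecewiseFrame.repr_apply (κ : 𝒢.Kernel E) (w : ∀ b : G, E (𝒢.t b)) (a : G) :
    (Φ.basis (𝒢.t a)).repr (κ.apply g w a) =
      ∫ b, Φ.mat κ (𝒢.qdiv (a, b)) ((Φ.basis (𝒢.t b)).repr (w b)) ∂(𝒢.vol g (𝒢.s a)) := by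
  rw [Kernel.apply]
  refine ((Φ.basis (𝒢.t a)).repr.toContinuousLinearEquiv.integral_comp_comm _).symm.trans ?_
  refine integral_congr_ae ?_
  filter_upwards [ae_mem_fiber (𝒢 := 𝒢) g (𝒢.s a)] with b hb
  simp only [dif_pos hb.symm, ← Φ.clmMatrix_atDiv κ hb.symm, clmMatrix_apply,
    LinearIsometryEquiv.symm_apply_apply]
  rfl

end Operators

end Regular

/-! ### The 1-norm and exponentially decaying kernels. -/

section Kernels

variable {m n : ℕ} {G M : Type u}
  [TopologicalSpace G] [ChartedSpace (EuclideanSpace ℝ (Fin (m + n))) G]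
  [TopologicalSpace M] [ChartedSpace (EuclideanSpace ℝ (Fin m)) M]
  {𝒢 : LieGroupoid m n G M}
  {F : Type v} [NormedAddCommGroup F] [NormedSpace ℂ F]
  {E : M → Type u} [∀ x, NormedAddCommGroup (E x)] [∀ x, InnerProductSpace ℂ (E x)]
  [TopologicalSpace (TotalSpace F E)] [FiberBundle F E] [VectorBundle ℂ F E]

lemma Kernel.Smooth.sub {κ₁ κ₂ : 𝒢.Kernel E} (h₁ : κ₁.Smooth F) (h₂ : κ₂.Smooth F) :
    (κ₁ - κ₂).Smooth F := fun a₀ => by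
  simp only [ContinuousLinearMap.inCoordinates, Pi.sub_apply, ContinuousLinearMap.sub_comp,
    ContinuousLinearMap.comp_sub]
  exact (h₁ a₀).sub (h₂ a₀)

lemma Kernel.Smooth.real_smul {κ : 𝒢.Kernel E} (hκ : κ.Smooth F) {χ : G → ℝ}
    (hχ : ContMDiff (𝓡 (m + n)) 𝓘(ℝ, ℝ) ∞ χ) :
    Kernel.Smooth F (fun a => (χ a : ℂ) • κ a : 𝒢.Kernel E) := fun a₀ => by
  simp only [ContinuousLinearMap.inCoordinates, ContinuousLinearMap.smul_comp,
    ContinuousLinearMap.comp_smul, Complex.coe_smul]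
  exact (hχ a₀).smul (hκ a₀)

variable [IsManifold (𝓡 (m + n)) ∞ G] (g : AmbientMetric m n G) [MeasurableSpace G]

omit [TopologicalSpace (TotalSpace F E)] in
lemma Kernel.l1Norm_le {κ : 𝒢.Kernel E} {C : ℝ≥0∞}
    (h₁ : ∀ x, ∫⁻ a, ‖κ a‖ₑ ∂(𝒢.vol g x) ≤ C)
    (h₂ : ∀ x, ∫⁻ a, ‖κ (𝒢.inv a)‖ₑ ∂(𝒢.vol g x) ≤ C) : κ.l1Norm g ≤ C := by
  refine iSup_le fun x => max_le (h₁ x) ((lintegral_congr fun a => ?_).trans_le (h₂ x))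
  simp only [← ofReal_norm, κ.norm_atInv]

omit [TopologicalSpace (TotalSpace F E)] in
lemma Kernel.lintegral_le_l1Norm (κ : 𝒢.Kernel E) (x : M) :
    ∫⁻ a, ‖κ a‖ₑ ∂(𝒢.vol g x) ≤ κ.l1Norm g ∧
      ∫⁻ a, ‖κ (𝒢.inv a)‖ₑ ∂(𝒢.vol g x) ≤ κ.l1Norm g := by
  have h := le_iSup (fun x => max (∫⁻ a, ‖κ a‖ₑ ∂(𝒢.vol g x))
    (∫⁻ a, ‖κ.atInv a‖ₑ ∂(𝒢.vol g x))) x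
  refine ⟨(le_max_left _ _).trans h, le_trans (lintegral_congr fun a => ?_).le
    ((le_max_right _ _).trans h)⟩
  simp only [← ofReal_norm, κ.norm_atInv]

variable [BorelSpace G]

lemma lintegral_le_mul_of_eq_zero [T2Space G] {K : Set G} (hK : IsCompact K) {φ : G → ℝ≥0∞}
    {B : ℝ≥0∞} (hB : ∀ a ∈ K, φ a ≤ B) (h0 : ∀ a ∉ K, φ a = 0) (μ : Measure G) :
    ∫⁻ a, φ a ∂μ ≤ B * μ K := by
  calc ∫⁻ a, φ a ∂μ ≤ ∫⁻ a, K.indicator (fun _ => B) a ∂μ := by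
        refine lintegral_mono fun a => ?_
        by_cases ha : a ∈ K
        · rw [indicator_of_mem ha]; exact hB a ha
        · rw [h0 a ha]; exact zero_le
    _ = B * μ K := lintegral_indicator_const hK.measurableSet B

section Norms

variable [FiniteDimensional ℂ F] (hE : SmoothHermitian F E m)
include hE

lemma Kernel.l1Norm_le_add {κ κ₁ κ₂ : 𝒢.Kernel E} (h₁ : κ₁.Smooth F)
    (h : ∀ a, ‖κ a‖ ≤ ‖κ₁ a‖ + ‖κ₂ a‖) : κ.l1Norm g ≤ κ₁.l1Norm g + κ₂.l1Norm g := by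
  have he : ∀ a, ‖κ a‖ₑ ≤ ‖κ₁ a‖ₑ + ‖κ₂ a‖ₑ := fun a => by
    simp only [← ofReal_norm]
    rw [← ENNReal.ofReal_add (norm_nonneg _) (norm_nonneg _)]
    exact ENNReal.ofReal_le_ofReal (h a)
  have hm : Measurable fun a => ‖κ₁ a‖ₑ := by
    simp only [← ofReal_norm]
    exact (h₁.continuous_norm hE).measurable.ennreal_ofReal
  refine Kernel.l1Norm_le g (fun x => ?_) fun x => ?_
  · refine (lintegral_mono he).trans ?_
    rw [lintegral_add_left hm]
    exact add_le_add (κ₁.lintegral_le_l1Norm g x).1 (κ₂.lintegral_le_l1Norm g x).1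
  · refine (lintegral_mono fun a => he _).trans ?_
    have hm' : Measurable fun a => ‖κ₁ (𝒢.inv a)‖ₑ := hm.comp 𝒢.continuous_inv.measurable
    rw [lintegral_add_left hm']
    exact add_le_add (κ₁.lintegral_le_l1Norm g x).2 (κ₂.lintegral_le_l1Norm g x).2

variable {g} [T2Space G] [T2Space M] [IsManifold (𝓡 m) ∞ M]

/-- A bounded function times the volume of its support, which is bounded uniformly over the fibres;
the integral of |f(a⁻¹)| uses the inverted support. -/
lemma CptKernel.l1Norm_ne_top (hconn : 𝒢.SConnected) (hgrowth : 𝒢.SubexponentialGrowth g)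
    (f : CptKernel 𝒢 E F) : f.1.l1Norm g ≠ ⊤ := by
  set K := closure {a | f.1 a ≠ 0} with hKdef
  have hK : IsCompact K := f.2.2
  have hK' : IsCompact (𝒢.inv '' K) := hK.image 𝒢.continuous_inv
  obtain ⟨B, hB⟩ := hK.exists_bound_of_continuousOn (f.2.1.continuous_norm hE).continuousOn
  obtain ⟨C, hC, hvol⟩ := exists_vol_le_of_isCompact (𝒢 := 𝒢) hconn hgrowth hK
  obtain ⟨C', hC', hvol'⟩ := exists_vol_le_of_isCompact (𝒢 := 𝒢) hconn hgrowth hK'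
  have hb : ∀ a ∈ K, ‖f.1 a‖ₑ ≤ ENNReal.ofReal B := fun a ha => by
    rw [← ofReal_norm]
    exact ENNReal.ofReal_le_ofReal (by simpa using hB a ha)
  have h0 : ∀ a ∉ K, ‖f.1 a‖ₑ = 0 := fun a ha => by
    by_contra h
    exact ha (subset_closure fun h' : f.1 a = 0 => h (by rw [← ofReal_norm, h', norm_zero, ENNReal.ofReal_zero]))
  refine ne_top_of_le_ne_top (ENNReal.mul_ne_top (ENNReal.ofReal_ne_top (r := B))
    (ENNReal.add_ne_top.2 ⟨hC, hC'⟩)) (Kernel.l1Norm_le g (fun x => ?_) fun x => ?_)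
  · refine (lintegral_le_mul_of_eq_zero hK hb h0 _).trans ?_
    gcongr
    exact (hvol x).trans le_self_add
  · refine (lintegral_le_mul_of_eq_zero (φ := fun a => ‖f.1 (𝒢.inv a)‖ₑ) hK' (B := ENNReal.ofReal B)
      (fun a ha => ?_) (fun a ha => h0 _ fun h => ha ⟨_, h, inv_inv a⟩) _).trans ?_
    · obtain ⟨b, hb', rfl⟩ := ha
      rw [inv_inv]
      exact hb b hb'
    · gcongr
      exact (hvol' x).trans le_add_self

end Norms

section Decay

/-- `κ(a)` and `κ(a⁻¹)` are bounded by `C exp(-δ d(s(a), a))`. -/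
def Kernel.DecayBound (κ : 𝒢.Kernel E) (C δ : ℝ) : Prop :=
  ∀ a, ‖κ a‖ ≤ C * Real.exp (-δ * 𝒢.fiberDist g (𝒢.unit (𝒢.s a)) a) ∧
    ‖κ (𝒢.inv a)‖ ≤ C * Real.exp (-δ * 𝒢.fiberDist g (𝒢.unit (𝒢.s a)) a)

variable {g}

lemma Kernel.DecayBound.l1Norm_le [T2Space M] {κ : 𝒢.Kernel E} {C δ A : ℝ} (hC : 0 ≤ C)
    (h : κ.DecayBound g C δ) (hA : ∀ x : M,
      ∫⁻ a, ENNReal.ofReal (Real.exp (-δ * 𝒢.fiberDist g (𝒢.unit x) a)) ∂(𝒢.vol g x)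
        ≤ ENNReal.ofReal A) : κ.l1Norm g ≤ ENNReal.ofReal C * ENNReal.ofReal A := by
  have key : ∀ (φ : G → ℝ≥0∞) (x : M), (∀ a, φ a ≤ ENNReal.ofReal
      (C * Real.exp (-δ * 𝒢.fiberDist g (𝒢.unit (𝒢.s a)) a))) →
      ∫⁻ a, φ a ∂(𝒢.vol g x) ≤ ENNReal.ofReal C * ENNReal.ofReal A := fun φ x hφ => by
    refine le_trans (lintegral_mono_ae (g := fun a => ENNReal.ofReal C *
      ENNReal.ofReal (Real.exp (-δ * 𝒢.fiberDist g (𝒢.unit x) a))) ?_) ?_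
    · filter_upwards [ae_mem_fiber (𝒢 := 𝒢) g x] with a ha
      rw [← ENNReal.ofReal_mul hC, ← ha]
      exact hφ a
    · rw [lintegral_const_mul' _ _ ENNReal.ofReal_ne_top]
      gcongr
      exact hA x
  refine Kernel.l1Norm_le g (fun x => key _ x fun a => ?_) fun x => key _ x fun a => ?_
  · rw [← ofReal_norm]
    exact ENNReal.ofReal_le_ofReal (h a).1
  · rw [← ofReal_norm]
    exact ENNReal.ofReal_le_ofReal (h a).2

/-- The empty list of derivatives bounds κ(ab⁻¹). With b a unit this is the estimate for κ(a), and
with a a unit the one for κ(b⁻¹). -/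
lemma exists_decayBound_of_mem_psiEps [IsManifold (𝓡 m) ∞ M] {D : AlgConnection 𝒢 F E} {ε : ℝ}
    {κ : 𝒢.Kernel E} (h : κ ∈ PsiEps g D ε) :
    κ.Smooth F ∧ ∃ C δ : ℝ, 0 ≤ C ∧ ε < δ ∧ κ.DecayBound g C δ := by
  obtain ⟨hs, δ, hδ, hl⟩ := h
  obtain ⟨C, hC⟩ := hl []
  have key : ∀ (a b : G) (h : 𝒢.s a = 𝒢.s b), ‖κ (𝒢.mul a (𝒢.inv b))‖ ≤
      max C 0 * Real.exp (-δ * 𝒢.fiberDist g a b) := fun a b h => by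
    have hn : ‖κ.atDiv a b h‖ = ‖κ (𝒢.mul a (𝒢.inv b))‖ := κ.norm_at _ _ _
    rw [← hn]
    refine ContinuousLinearMap.opNorm_le_bound _ (by positivity) fun v => ?_
    have h1 := hC a b h v
    simp only [AlgConnection.iterDeriv, Kernel.lift, dif_pos h] at h1
    rw [neg_mul, Real.exp_neg, mul_right_comm, ← div_eq_mul_inv, le_div_iff₀ (Real.exp_pos _),
      mul_comm]
    exact h1.trans (by gcongr; exact le_max_left _ _)
  refine ⟨hs, max C 0, δ, le_max_right _ _, hδ, fun a => ⟨?_, ?_⟩⟩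
  · have h1 := key a (𝒢.unit (𝒢.s a)) (𝒢.s_unit _).symm
    rwa [div_unit, fiberDist_comm (𝒢.s_unit _).symm] at h1
  · have h1 := key (𝒢.unit (𝒢.s a)) a (𝒢.s_unit _)
    have h2 := 𝒢.unit_mul (𝒢.inv a)
    rw [𝒢.t_inv] at h2
    rwa [h2] at h1

variable [T2Space G] [SecondCountableTopology G] [T2Space M] [CompactSpace M]
  [IsManifold (𝓡 m) ∞ M]

/-- Split the decay rate in two. One half makes the remainder integrable, uniformly over the fibres,
by the growth hypothesis; the other half makes it small beyond radius R. -/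
lemma Kernel.DecayBound.exists_l1Norm_sub_lt (hconn : 𝒢.SConnected)
    (hgrowth : 𝒢.SubexponentialGrowth g) {κ : 𝒢.Kernel E} (hκ : κ.Smooth F) {C δ : ℝ}
    (hC : 0 ≤ C) (hδ : 0 < δ) (h : κ.DecayBound g C δ) {η : ℝ≥0∞} (hη : 0 < η) :
    ∃ f : CptKernel 𝒢 E F, (κ - f.1).l1Norm g < η := by
  obtain ⟨A, hA⟩ := hgrowth (δ / 2) (half_pos hδ)
  have hlim : Tendsto (fun R : ℝ => ENNReal.ofReal (C * Real.exp (-(δ / 2 * R))) *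
      ENNReal.ofReal A) atTop (𝓝 0) := by
    have h1 : Tendsto (fun R : ℝ => C * Real.exp (-(δ / 2 * R))) atTop (𝓝 (C * 0)) :=
      (Real.tendsto_exp_neg_atTop_nhds_zero.comp
        (tendsto_id.const_mul_atTop (half_pos hδ))).const_mul C
    have h2 := ENNReal.Tendsto.mul_const (b := ENNReal.ofReal A) (ENNReal.tendsto_ofReal h1)
      (Or.inr ENNReal.ofReal_ne_top)
    simpa using h2
  obtain ⟨R, hR⟩ := (hlim.eventually_lt_const hη).exists
  obtain ⟨K, hK, hKR⟩ := exists_isCompact_fiberDist_le (𝒢 := 𝒢) g hconn R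
  -- The inverse of `K` is included because the second half of the decay bound measures κ(a⁻¹) by
  -- the distance of a, so the cut-off must also be 1 at a⁻¹ when a lies in the ball.
  obtain ⟨χ, hχ, hχc, hχ1, hχI⟩ := exists_bump (m := m) (n := n)
    (hK.union (hK.image 𝒢.continuous_inv))
  have hf : (fun a => (χ a : ℂ) • κ a : 𝒢.Kernel E) ∈ CptKernel 𝒢 E F := by
    refine ⟨hκ.real_smul hχ, hχc.isCompact.of_isClosed_subset isClosed_closure
      (closure_mono fun a ha hz => ha ?_)⟩
    simp [hz]
  refine ⟨⟨_, hf⟩, lt_of_le_of_lt (Kernel.DecayBound.l1Norm_le (δ := δ / 2) ?_ ?_ hA) hR⟩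
  · positivity
  have hnorm : ∀ a, ‖(κ - fun a => (χ a : ℂ) • κ a : 𝒢.Kernel E) a‖ = (1 - χ a) * ‖κ a‖ :=
    fun a => by
      have h1 : (κ - fun a => (χ a : ℂ) • κ a : 𝒢.Kernel E) a = ((1 - χ a : ℝ) : ℂ) • κ a := by
        simp [sub_smul]
      rw [h1, norm_smul, Complex.norm_real, Real.norm_of_nonneg (sub_nonneg.2 (hχI a).2)]
  have key : ∀ (a : G) (r t : ℝ), 0 ≤ t → t ≤ 1 → (𝒢.fiberDist g (𝒢.unit (𝒢.s a)) a ≤ R → t = 0) →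
      r ≤ C * Real.exp (-δ * 𝒢.fiberDist g (𝒢.unit (𝒢.s a)) a) →
      t * r ≤ C * Real.exp (-(δ / 2 * R)) *
        Real.exp (-(δ / 2) * 𝒢.fiberDist g (𝒢.unit (𝒢.s a)) a) := fun a r t h0 h1 hz hr => by
    rcases le_or_gt (𝒢.fiberDist g (𝒢.unit (𝒢.s a)) a) R with hle | hgt
    · rw [hz hle, zero_mul]
      positivity
    · have h2 : t * r ≤ C * Real.exp (-δ * 𝒢.fiberDist g (𝒢.unit (𝒢.s a)) a) :=
        (mul_le_mul_of_nonneg_left hr h0).trans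
          (mul_le_of_le_one_left (by positivity) h1)
      refine h2.trans ?_
      rw [_root_.mul_assoc, ← Real.exp_add]
      gcongr
      nlinarith
  intro a
  rw [hnorm, hnorm]
  refine ⟨key a _ _ (sub_nonneg.2 (hχI a).2) (by linarith [(hχI a).1]) (fun hle => ?_) (h a).1,
    key a _ _ (sub_nonneg.2 (hχI _).2) (by linarith [(hχI (𝒢.inv a)).1]) (fun hle => ?_) (h a).2⟩
  · rw [hχ1 a (Or.inl (hKR a hle)), sub_self]
  · rw [hχ1 _ (Or.inr ⟨a, hKR a hle, rfl⟩), sub_self]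

end Decay

end Kernels

/-! ### Classes in the completion and their action in regular representations. -/

section Completion

lemma memLp_two_of_bound {X V : Type*} [MeasurableSpace X] {μ : Measure X} [NormedAddCommGroup V]
    [MeasurableSpace V] [BorelSpace V] [SecondCountableTopology V] {W : X → V} (hW : Measurable W)
    {O : Set X} (hO : MeasurableSet O) (hμ : μ O < ⊤) {B : ℝ} (hB : ∀ b ∈ O, ‖W b‖ ≤ B)
    (h0 : ∀ b ∉ O, W b = 0) : MemLp W 2 μ := by
  have h : O.indicator W = W := indicator_eq_self.2 fun b hb => by
    by_contra hc
    exact hb (h0 b hc)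
  have : IsFiniteMeasure (μ.restrict O) := ⟨by simpa using hμ⟩
  rw [← h, memLp_indicator_iff_restrict hO]
  exact MemLp.of_bound hW.aestronglyMeasurable B (by
    filter_upwards [ae_restrict_mem hO] with b hb
    exact hB b hb)

variable {m n : ℕ} {G M : Type u}
  [TopologicalSpace G] [ChartedSpace (EuclideanSpace ℝ (Fin (m + n))) G]
  [TopologicalSpace M] [ChartedSpace (EuclideanSpace ℝ (Fin m)) M]
  [IsManifold (𝓡 (m + n)) ∞ G] [MeasurableSpace G] [BorelSpace G]
  {𝒢 : LieGroupoid m n G M} {g : AmbientMetric m n G}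
  {F : Type v} [NormedAddCommGroup F] [NormedSpace ℂ F] [FiniteDimensional ℂ F]
  {E : M → Type u} [∀ x, NormedAddCommGroup (E x)] [∀ x, InnerProductSpace ℂ (E x)]
  [TopologicalSpace (TotalSpace F E)] [FiberBundle F E] [VectorBundle ℂ F E]
  (hE : SmoothHermitian F E m)

lemma enorm_sub_le_fullNorm (c : OpFamily 𝒢 g F E) (f : CptKernel 𝒢 E F) (ρ : StarRep 𝒢 g F E) :
    ‖c ρ - ρ.rep f‖ₑ ≤ fullNorm (c - ofCpt 𝒢 g F E f) :=
  le_iSup (fun ρ => ‖(c - ofCpt 𝒢 g F E f) ρ‖ₑ) ρ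

include hE in
/-- A kernel approximated in the `1`-norm by compactly supported kernels has a class in the
completion. -/
lemma exists_opFamily_fullNorm_sub_le {κ : 𝒢.Kernel E} (hκ : κ.Smooth F)
    (happ : ∀ η : ℝ≥0∞, 0 < η → ∃ f : CptKernel 𝒢 E F, (κ - f.1).l1Norm g < η) :
    ∃ c : OpFamily 𝒢 g F E, ∀ f : CptKernel 𝒢 E F,
      fullNorm (c - ofCpt 𝒢 g F E f) ≤ (κ - f.1).l1Norm g := by
  choose f hf using fun k : ℕ => happ ((k + 1 : ℝ≥0∞)⁻¹) (by simp)
  have hu : Tendsto (fun k : ℕ => ((k + 1 : ℝ≥0∞)⁻¹)) atTop (𝓝 0) := by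
    have h := (tendsto_add_atTop_iff_nat 1).2 ENNReal.tendsto_inv_nat_nhds_zero
    simpa using h
  have hdist : ∀ (ρ : StarRep 𝒢 g F E) (f f' : CptKernel 𝒢 E F), ‖ρ.rep f - ρ.rep f'‖ₑ ≤
      (κ - f.1).l1Norm g + (κ - f'.1).l1Norm g := fun ρ f f' => by
    rw [← map_sub]
    refine (ρ.norm_le _).trans (Kernel.l1Norm_le_add g hE (hκ.sub f.2.1) fun a => ?_)
    have h1 : (f - f').1 a = (κ - f'.1) a - (κ - f.1) a := by
      simp
    rw [h1, add_comm]
    exact norm_sub_le _ _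
  have hcauchy : ∀ ρ : StarRep 𝒢 g F E, CauchySeq fun k => ρ.rep (f k) := fun ρ => by
    refine EMetric.cauchySeq_iff_le_tendsto_0.2 ⟨fun k => ((k + 1 : ℝ≥0∞)⁻¹) + (k + 1 : ℝ≥0∞)⁻¹,
      fun i j k hi hj => ?_, by simpa using hu.add hu⟩
    rw [edist_eq_enorm_sub]
    refine (hdist ρ _ _).trans (add_le_add ((hf i).le.trans ?_) ((hf j).le.trans ?_)) <;> gcongr
  choose c hc using fun ρ => cauchySeq_tendsto_of_complete (hcauchy ρ)
  refine ⟨c, fun f' => iSup_le fun ρ => ?_⟩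
  have h1 : Tendsto (fun k => ‖ρ.rep (f k) - ρ.rep f'‖ₑ) atTop (𝓝 ‖c ρ - ρ.rep f'‖ₑ) :=
    (continuous_enorm.tendsto _).comp ((hc ρ).sub_const _)
  -- In the limit over k, the bound on ‖ρ(fₖ) - ρ(f')‖ becomes the 1-norm of κ - f', which does not
  -- depend on ρ; hence the estimate passes to the supremum.
  have h2 : Tendsto (fun k : ℕ => ((k + 1 : ℝ≥0∞)⁻¹) + (κ - f'.1).l1Norm g) atTop
      (𝓝 (0 + (κ - f'.1).l1Norm g)) := hu.add_const _
  rw [zero_add] at h2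
  exact le_of_tendsto_of_tendsto' h1 h2 fun k =>
    (hdist ρ _ _).trans (add_le_add (hf k).le le_rfl)

variable [SecondCountableTopology G] [T2Space M] (Φ : PiecewiseFrame F E)

/-- The regular representation on the `L²`-sections over `G_x`. -/
def PiecewiseFrame.regRep (hfin : ∀ f : CptKernel 𝒢 E F, f.1.l1Norm g ≠ ⊤) (x : M)
    [SFinite (𝒢.vol g x)] : StarRep 𝒢 g F E where
  -- Frame coordinates place this Hilbert space in the universe of `G`, whatever the universe of
  -- `F`.
  H := FiberL2 F 𝒢 g x
  rep :=
    { toFun := fun f => Φ.regOp g hE x f.2.1 (hfin f)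
      map_add' := fun f₁ f₂ => Φ.regOp_add g hE f₁.2.1 f₂.2.1 _ _ _ _ rfl
      map_smul' := fun c f => Φ.regOp_smul g hE c f.2.1 _ _ _ rfl }
  map_conv := fun f₁ f₂ f h => 
    Φ.regOp_conv g hE f₁.2.1 f₂.2.1 f.2.1 (hfin f₁) (hfin f₂) (hfin f) h
  map_star := fun f κ h => Φ.regOp_star g hE κ.2.1 f.2.1 (hfin κ) (hfin f) h
  norm_le := fun f => Φ.enorm_regOp_le g hE f.2.1 (hfin f)

/-- The operator on `L²(G_x)` given by an element of the completion. -/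
def PiecewiseFrame.regPart (hfin : ∀ f : CptKernel 𝒢 E F, f.1.l1Norm g ≠ ⊤)
    (c : OpFamily 𝒢 g F E) (x : M) [SFinite (𝒢.vol g x)] :
    FiberL2 F 𝒢 g x →L[ℂ] FiberL2 F 𝒢 g x :=
  c (Φ.regRep hE hfin x)

lemma PiecewiseFrame.enorm_regPart_sub_le (hfin : ∀ f : CptKernel 𝒢 E F, f.1.l1Norm g ≠ ⊤)
    (c : OpFamily 𝒢 g F E) (x : M) [SFinite (𝒢.vol g x)] (f : CptKernel 𝒢 E F) :
    ‖Φ.regPart hE hfin c x - Φ.regOp g hE x f.2.1 (hfin f)‖ₑ ≤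
      fullNorm (c - ofCpt 𝒢 g F E f) :=
  enorm_sub_le_fullNorm c f (Φ.regRep hE hfin x)

section Class

variable {κ : 𝒢.Kernel E} (hκ : κ.Smooth F) (hC : κ.l1Norm g ≠ ⊤)
  (hfin : ∀ f : CptKernel 𝒢 E F, f.1.l1Norm g ≠ ⊤)
  {c : OpFamily 𝒢 g F E}

lemma PiecewiseFrame.regOp_sub {κ₁ κ₂ : 𝒢.Kernel E} (h₁ : κ₁.Smooth F) (h₂ : κ₂.Smooth F)
    (hC₁ : κ₁.l1Norm g ≠ ⊤) (hC₂ : κ₂.l1Norm g ≠ ⊤) (hC₃ : (κ₁ - κ₂).l1Norm g ≠ ⊤) (x : M)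
    [SFinite (𝒢.vol g x)] : Φ.regOp g hE x (h₁.sub h₂) hC₃ =
      Φ.regOp g hE x h₁ hC₁ - Φ.regOp g hE x h₂ hC₂ :=
  eq_sub_of_add_eq (Φ.regOp_add g hE (h₁.sub h₂) h₂ h₁ hC₃ hC₂ hC₁ (by simp)).symm

/-- The class of `κ` acts in the regular representations as the operator with kernel `κ`. -/
lemma eq_regOp_of_fullNorm_sub_le
    (happ : ∀ η : ℝ≥0∞, 0 < η → ∃ f : CptKernel 𝒢 E F, (κ - f.1).l1Norm g < η)
    (hc : ∀ f : CptKernel 𝒢 E F, fullNorm (c - ofCpt 𝒢 g F E f) ≤ (κ - f.1).l1Norm g) (x : M)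
    [SFinite (𝒢.vol g x)] : Φ.regPart hE hfin c x = Φ.regOp g hE x hκ hC := by
  have h : ∀ η : ℝ≥0∞, 0 < η →
      ‖Φ.regPart hE hfin c x - Φ.regOp g hE x hκ hC‖ₑ ≤ η := fun η hη => by
    -- The operator of `f` is within η/2 of both sides: of the class by the full norm estimate, of
    -- the operator of κ by the Schur bound.
    obtain ⟨f, hf⟩ := happ (η / 2) (ENNReal.half_pos hη.ne')
    have hC' : (κ - f.1).l1Norm g ≠ ⊤ := hf.ne_top
    have h1 := (Φ.enorm_regPart_sub_le hE hfin c x f).trans (hc f)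
    have h2 := Φ.enorm_regOp_le (x := x) g hE (hκ.sub f.2.1) hC'
    rw [Φ.regOp_sub hE hκ f.2.1 hC (hfin f) hC'] at h2
    have h3 : Φ.regPart hE hfin c x - Φ.regOp g hE x hκ hC =
        (Φ.regPart hE hfin c x - Φ.regOp g hE x f.2.1 (hfin f)) -
          (Φ.regOp g hE x hκ hC - Φ.regOp g hE x f.2.1 (hfin f)) := by
      abel
    rw [h3]
    calc _ ≤ _ := enorm_sub_le
      _ ≤ η / 2 + η / 2 := add_le_add (h1.trans hf.le) (h2.trans hf.le)
      _ = η := ENNReal.add_halves η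
  have h0 : ‖Φ.regPart hE hfin c x - Φ.regOp g hE x hκ hC‖ₑ = 0 :=
    le_antisymm (le_of_forall_gt_imp_ge_of_dense fun η hη => h η hη) zero_le
  rw [← ofReal_norm, ENNReal.ofReal_eq_zero] at h0
  exact sub_eq_zero.1 (norm_le_zero_iff.1 h0)

/-- A compactly supported smooth section is bounded on a set of finite volume, hence an L² vector in
the frame, and the full norm dominates the operator norm in the regular representation. -/
lemma actsBy_of_eq_regOp [T2Space G] [∀ x, IsLocallyFiniteMeasure (𝒢.vol g x)]
    (hc : ∀ x, Φ.regPart hE hfin c x = Φ.regOp g hE x hκ hC) : ActsBy c κ := by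
  intro x w hw hcw η hη
  have hwc : Continuous fun b => (⟨𝒢.t b, w b⟩ : TotalSpace F E) := hw.continuous
  set W : G → EuclideanSpace ℂ (Fin (Module.finrank ℂ F)) :=
    fun b => (Φ.basis (𝒢.t b)).repr (w b) with hW
  have hWm : Measurable W := Φ.measurable_repr hE hwc
  have hnorm : Continuous fun b => ‖w b‖ := continuous_iff_continuousAt.2 fun b =>
    (continuousWithinAt_univ _ _).1
      (continuousWithinAt_norm_section hE hwc.continuousAt.continuousWithinAt)
  have hWn : ∀ b, ‖W b‖ = ‖w b‖ := fun b => LinearIsometryEquiv.norm_map _ _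
  obtain ⟨B, hB⟩ := hcw.exists_bound_of_continuousOn hnorm.continuousOn
  have hmem : MemLp W 2 (𝒢.vol g x) := memLp_two_of_bound hWm hcw.measurableSet hcw.measure_lt_top
    (fun b hb => (hWn b).trans_le (by simpa using hB b hb)) fun b hb => by
      have h' : w b = 0 := by
        by_contra h
        exact hb (subset_closure h)
      simp [hW, h']
  obtain ⟨r, hr, hrη⟩ := ENNReal.exists_nnreal_pos_mul_lt
    (a := ‖hmem.toLp‖ₑ ^ 2) (ENNReal.pow_ne_top enorm_ne_top) hη.ne'
  -- The operator norm enters squared; capping at 1 gives min(r, 1)² ≤ r.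
  refine ⟨min r 1, by simp [hr], fun f hf => ?_⟩
  have h1 := (Φ.enorm_regPart_sub_le hE hfin c x f).trans_lt hf
  rw [hc x] at h1
  have happly : ∀ {κ : 𝒢.Kernel E} (hκ : κ.Smooth F) (hC : κ.l1Norm g ≠ ⊤),
      ∀ᵐ a ∂(𝒢.vol g x), Φ.regOp g hE x hκ hC hmem.toLp a =
        (Φ.basis (𝒢.t a)).repr (κ.apply g w a) := fun hκ hC => by
    filter_upwards [Φ.regOp_apply g hE hκ hC hmem.toLp, ae_mem_fiber (𝒢 := 𝒢) g x] with a ha hs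
    rw [ha, Φ.repr_apply, hs]
    refine integral_congr_ae ?_
    filter_upwards [hmem.coeFn_toLp] with b hb
    rw [hb]
  calc ∫⁻ a, ‖Kernel.apply g f.1 w a - Kernel.apply g κ w a‖ₑ ^ 2 ∂(𝒢.vol g x)
      = ∫⁻ a, ‖((Φ.regOp g hE x hκ hC - Φ.regOp g hE x f.2.1 (hfin f)) hmem.toLp) a‖ₑ ^ 2
          ∂(𝒢.vol g x) := by
        refine lintegral_congr_ae ?_
        rw [sub_apply]
        filter_upwards [happly hκ hC, happly f.2.1 (hfin f),
          Lp.coeFn_sub (Φ.regOp g hE x hκ hC hmem.toLp)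
            (Φ.regOp g hE x f.2.1 (hfin f) hmem.toLp)] with a e1 e2 e3
        rw [e3, Pi.sub_apply, e1, e2, ← map_sub, ← ofReal_norm, ← ofReal_norm,
          LinearIsometryEquiv.norm_map, norm_sub_rev]
    _ = ‖(Φ.regOp g hE x hκ hC - Φ.regOp g hE x f.2.1 (hfin f)) hmem.toLp‖ₑ ^ 2 := by
        rw [lintegral_enorm_sq_eq, Lp.enorm_def]
    _ ≤ (min (r : ℝ≥0∞) 1 * ‖hmem.toLp‖ₑ) ^ 2 := by
        gcongr
        exact (ContinuousLinearMap.le_opENorm _ _).trans (by gcongr)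
    _ ≤ r * ‖hmem.toLp‖ₑ ^ 2 := by
        rw [mul_pow, sq (min (r : ℝ≥0∞) 1)]
        gcongr
        calc min (r : ℝ≥0∞) 1 * min (r : ℝ≥0∞) 1 ≤ r * 1 :=
              mul_le_mul' (min_le_left _ _) (min_le_right _ _)
          _ = r := mul_one _
    _ < η := hrη

end Class

end Completion

/-! ### Faithfulness of the regular representations on smooth kernels. -/

section Injectivity

variable {m n : ℕ} {G M : Type u}
  [TopologicalSpace G] [ChartedSpace (EuclideanSpace ℝ (Fin (m + n))) G]
  [TopologicalSpace M] [ChartedSpace (EuclideanSpace ℝ (Fin m)) M]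
  [IsManifold (𝓡 (m + n)) ∞ G] [MeasurableSpace G] [BorelSpace G]
  {𝒢 : LieGroupoid m n G M} {g : AmbientMetric m n G}
  {F : Type v} [NormedAddCommGroup F] [NormedSpace ℂ F] [FiniteDimensional ℂ F]
  {E : M → Type u} [∀ x, NormedAddCommGroup (E x)] [∀ x, InnerProductSpace ℂ (E x)]
  [TopologicalSpace (TotalSpace F E)] [FiberBundle F E] [VectorBundle ℂ F E]
  [SecondCountableTopology G] [T2Space M] [IsManifold (𝓡 m) ∞ M]
  [∀ x, IsLocallyFiniteMeasure (𝒢.vol g x)]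

/-- Suppose κ(a₀)v₀ ≠ 0. Extend v₀ and κ(a₀)v₀ to sections constant in trivializations; the matrix
coefficient ψ of κ between them has positive real part at a₀, so by continuity ψ(ab⁻¹) has real part
above some r > 0 for a near a₀ and b near the unit over s(a₀). Apply the operator to the first
section cut off to a small neighbourhood O of that unit: paired with the second section, the result
has real part at least r vol(O) > 0 at such a. Since it vanishes almost everywhere and
neighbourhoods of a₀ have positive volume, this is a contradiction. -/
lemma eq_zero_of_regOp_eq_zero (hE : SmoothHermitian F E m) (Φ : PiecewiseFrame F E)
    {κ : 𝒢.Kernel E} (hκ : κ.Smooth F) (hC : κ.l1Norm g ≠ ⊤)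
    (h0 : ∀ x, Φ.regOp g hE x hκ hC = 0) : κ = 0 := by
  by_contra hne
  obtain ⟨a₀, ha₀⟩ := Function.ne_iff.1 hne
  set x := 𝒢.s a₀
  obtain ⟨v₀, hv₀⟩ : ∃ v, κ a₀ v ≠ 0 := by
    by_contra! hc
    exact ha₀ (ContinuousLinearMap.ext hc)
  set e := trivializationAt F E x with he
  set e' := trivializationAt F E (𝒢.t a₀) with he'
  have hxe : x ∈ e.baseSet := mem_baseSet_trivializationAt F E x
  have hte : 𝒢.t a₀ ∈ e'.baseSet := mem_baseSet_trivializationAt F E _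
  set v₁ : F := (e ⟨x, v₀⟩).2
  set v₂ : F := (e' ⟨𝒢.t a₀, κ a₀ v₀⟩).2
  set ψ : G → ℂ := fun c =>
    -- At c = a₀ the two sections take the values κ(a₀)v₀ and v₀, so ψ(a₀) = ‖κ(a₀)v₀‖².
    inner ℂ (e'.symmL ℂ (𝒢.t c) v₂) (κ c (e.symmL ℂ (𝒢.s c) v₁)) with hψ
  have hψ0 : ψ a₀ = ((‖κ a₀ v₀‖ ^ 2 : ℝ) : ℂ) := by
    have h1 : e'.symmL ℂ (𝒢.t a₀) v₂ = κ a₀ v₀ := symmL_trivialization_snd hte _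
    have h2 : e.symmL ℂ (𝒢.s a₀) v₁ = v₀ := symmL_trivialization_snd hxe _
    simp only [hψ]
    rw [h1, h2, inner_self_eq_norm_sq_to_K]
    push_cast
    rfl
  have hsec : ∀ (e : Trivialization F (π F E)) [MemTrivializationAtlas e] (v : F) (f : G → M)
      (a : G), Continuous f → f a ∈ e.baseSet →
      ContinuousAt (fun c => (⟨f c, e.symmL ℂ (f c) v⟩ : TotalSpace F E)) a :=
    fun e _ v f a hf ha => ContinuousAt.comp (g := fun q => (⟨q, e.symmL ℂ q v⟩ : TotalSpace F E))
      ((continuousOn_symmL e v).continuousAt (e.open_baseSet.mem_nhds ha)) hf.continuousAt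
  have hψc : ContinuousAt ψ a₀ := by
    refine (continuousWithinAt_univ _ _).1 (continuousWithinAt_inner_section hE
      (hsec e' v₂ 𝒢.t a₀ 𝒢.continuous_t hte).continuousWithinAt
      (ContinuousAt.clm_apply_of_inCoordinates (b₁ := 𝒢.s) (hκ a₀).continuousAt
        (hsec e v₁ 𝒢.s a₀ 𝒢.continuous_s hxe)
        𝒢.continuous_t.continuousAt).continuousWithinAt)
  have hpos : 0 < (ψ a₀).re := by
    rw [hψ0, Complex.ofReal_re]
    exact pow_pos (norm_pos_iff.2 hv₀) 2
  obtain ⟨U, hU, V, hV, r, hr, hUV⟩ := exists_nhds_re_qdiv_pos (𝒢 := 𝒢) hψc hpos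
  have htu : 𝒢.t (𝒢.unit x) ∈ e.baseSet := by rw [𝒢.t_unit]; exact hxe
  set σ : ∀ b : G, E (𝒢.t b) := fun b => e.symmL ℂ (𝒢.t b) v₁ with hσ
  have hσn : ContinuousAt (fun b => ‖σ b‖) (𝒢.unit x) := (continuousWithinAt_univ _ _).1
    (continuousWithinAt_norm_section hE
      (hsec e v₁ 𝒢.t _ 𝒢.continuous_t htu).continuousWithinAt)
  obtain ⟨B, hσB⟩ : ∃ B, ∀ᶠ b in 𝓝 (𝒢.unit x), ‖σ b‖ < B :=
    ⟨_, hσn.eventually_lt_const (lt_add_one _)⟩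
  obtain ⟨T, hT, hTfin⟩ := (𝒢.vol g x).finiteAt_nhds (𝒢.unit x)
  have hbase : ∀ᶠ b in 𝓝 (𝒢.unit x), 𝒢.t b ∈ e.baseSet :=
    𝒢.continuous_t.continuousAt.eventually (e.open_baseSet.mem_nhds htu)
  -- On `O` the test section is bounded and lies in the trivialization, the volume is finite, and
  -- the lower bound on ψ applies.
  obtain ⟨O, hO, hOo, huO⟩ := eventually_nhds_iff.1
    (hσB.and (hbase.and ((eventually_mem_set.2 hT).and (eventually_mem_set.2 hV))))
  have hOfin : 𝒢.vol g x O < ⊤ := (measure_mono fun b hb => (hO b hb).2.2.1).trans_lt hTfin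
  have hOpos : 0 < 𝒢.vol g x O := by
    have := vol_pos (𝒢 := 𝒢) g hOo huO
    rwa [𝒢.s_unit] at this
  set W : G → EuclideanSpace ℂ (Fin (Module.finrank ℂ F)) :=
    O.indicator fun b => (Φ.basis (𝒢.t b)).repr (σ b) with hW
  have hWm : Measurable W := Φ.measurable_indicator_repr hE hOo.measurableSet
    ((continuousOn_symmL e v₁).comp 𝒢.continuous_t.continuousOn fun b hb => (hO b hb).2.1)
  have hmem : MemLp W 2 (𝒢.vol g x) := memLp_two_of_bound hWm hOo.measurableSet hOfin (B := B)
    (fun b hb => by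
      rw [hW, indicator_of_mem hb, LinearIsometryEquiv.norm_map]
      exact (hO b hb).1.le) fun b hb => indicator_of_notMem hb _
  have hop : ∀ᵐ a ∂(𝒢.vol g x), ∫ b, Φ.mat κ (𝒢.qdiv (a, b)) (W b) ∂(𝒢.vol g x) = 0 ∧
      Integrable (fun b => Φ.mat κ (𝒢.qdiv (a, b)) (W b)) (𝒢.vol g x) := by
    have h1 := Φ.regOp_apply g hE hκ hC hmem.toLp
    rw [h0 x, zero_apply] at h1
    have h2 := (isSchurKernel Φ g hE hκ (ENNReal.coe_toNNReal hC).ge x).ae_integrable hmem.toLp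
    filter_upwards [h1, h2, Lp.coeFn_zero (EuclideanSpace ℂ (Fin (Module.finrank ℂ F))) 2
      (𝒢.vol g x)] with a e1 e2 e3
    have hcongr : ∀ᵐ b ∂(𝒢.vol g x), Φ.mat κ (𝒢.qdiv (a, b)) (hmem.toLp W b) =
        Φ.mat κ (𝒢.qdiv (a, b)) (W b) := by
      filter_upwards [hmem.coeFn_toLp] with b hb
      rw [hb]
    refine ⟨?_, e2.congr hcongr⟩
    rw [← integral_congr_ae hcongr, ← e1, e3]
    rfl
  obtain ⟨U', hU'U, hU'o, haU'⟩ := mem_nhds_iff.1 hU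
  have hUpos : 0 < 𝒢.vol g x U' := vol_pos (𝒢 := 𝒢) g hU'o haU'
  -- The vanishing holds only almost everywhere, but a neighbourhood of a₀ has positive volume and
  -- so contains a point where it holds.
  obtain ⟨a, haU, ⟨hint, hintb⟩, hsa⟩ : ∃ a ∈ U', (∫ b, Φ.mat κ (𝒢.qdiv (a, b)) (W b)
      ∂(𝒢.vol g x) = 0 ∧ Integrable (fun b => Φ.mat κ (𝒢.qdiv (a, b)) (W b)) (𝒢.vol g x)) ∧
      𝒢.s a = x := by
    by_contra! hc
    refine hUpos.ne' (measure_mono_null (fun a ha => ?_)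
      (ae_iff.1 (hop.and (ae_mem_fiber (𝒢 := 𝒢) g x))))
    exact fun h => hc a ha h.1 h.2
  set y := (Φ.basis (𝒢.t a)).repr (e'.symmL ℂ (𝒢.t a) v₂) with hy
  have hinner : ∀ᵐ b ∂(𝒢.vol g x), (inner ℂ y (Φ.mat κ (𝒢.qdiv (a, b)) (W b)) : ℂ) =
      O.indicator (fun b => ψ (𝒢.qdiv (a, b))) b := by
    filter_upwards [ae_mem_fiber (𝒢 := 𝒢) g x] with b hb
    by_cases hbO : b ∈ O
    · have hab : 𝒢.s a = 𝒢.s b := hsa.trans hb.symm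
      have hgen : ∀ (d : G) (p q : M) (hp : 𝒢.s d = p) (hq : 𝒢.t d = q),
          (inner ℂ ((Φ.basis q).repr (e'.symmL ℂ q v₂))
            (Φ.mat κ d ((Φ.basis p).repr (e.symmL ℂ p v₁))) : ℂ) = ψ d := by
        rintro d p q rfl rfl
        rw [PiecewiseFrame.mat, clmMatrix_apply, LinearIsometryEquiv.symm_apply_apply,
          LinearIsometryEquiv.inner_map_map]
      rw [hW, indicator_of_mem hbO, indicator_of_mem hbO]
      exact hgen _ _ _ (s_qdiv hab) (t_qdiv hab)
    · rw [hW, indicator_of_notMem hbO, indicator_of_notMem hbO, map_zero, inner_zero_right]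
  have hz : ∫ b, O.indicator (fun b => ψ (𝒢.qdiv (a, b))) b ∂(𝒢.vol g x) = 0 := by
    rw [← integral_congr_ae hinner, integral_inner hintb, hint, inner_zero_right]
  have hψi : IntegrableOn (fun b => ψ (𝒢.qdiv (a, b))) O (𝒢.vol g x) :=
    (integrable_indicator_iff hOo.measurableSet).1 ((hintb.const_inner y).congr hinner)
  rw [integral_indicator hOo.measurableSet] at hz
  have hre : ∫ b in O, (ψ (𝒢.qdiv (a, b))).re ∂(𝒢.vol g x) = 0 := by
    have := integral_re hψi
    simp only [RCLike.re_eq_complex_re] at this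
    rw [this, hz, Complex.zero_re]
  have hge : r * (𝒢.vol g x).real O ≤ ∫ b in O, (ψ (𝒢.qdiv (a, b))).re ∂(𝒢.vol g x) := by
    have h1 : ∫ b in O, r ∂(𝒢.vol g x) ≤ ∫ b in O, (ψ (𝒢.qdiv (a, b))).re ∂(𝒢.vol g x) := by
      refine integral_mono_ae (integrableOn_const hOfin.ne) hψi.re ?_
      filter_upwards [ae_restrict_mem hOo.measurableSet,
        ae_restrict_of_ae (ae_mem_fiber (𝒢 := 𝒢) g x)] with b hb hs
      exact (hUV a (hU'U haU) b (hO b hb).2.2.2 (hsa.trans hs.symm)).le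
    rwa [setIntegral_const, smul_eq_mul, mul_comm] at h1
  have hreal : 0 < (𝒢.vol g x).real O := ENNReal.toReal_pos hOpos.ne' hOfin.ne
  nlinarith

end Injectivity

end LieGroupoid

end

/-! ### Assembly of the map J. -/

theorem mainTheorem9 {m n : ℕ} {G M : Type u}
    [TopologicalSpace G] [T2Space G] [SecondCountableTopology G]
    [ChartedSpace (EuclideanSpace ℝ (Fin (m + n))) G] [IsManifold (𝓡 (m + n)) ∞ G]
    [MeasurableSpace G] [BorelSpace G]
    [TopologicalSpace M] [T2Space M] [CompactSpace M]
    [ChartedSpace (EuclideanSpace ℝ (Fin m)) M] [IsManifold (𝓡 m) ∞ M]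
    (𝒢 : LieGroupoid m n G M) (hconn : 𝒢.SConnected)
    (g : LieGroupoid.AmbientMetric m n G) (hgrowth : 𝒢.SubexponentialGrowth g)
    {F : Type v} [NormedAddCommGroup F] [NormedSpace ℂ F] [FiniteDimensional ℂ F]
    {E : M → Type u} [∀ x, NormedAddCommGroup (E x)] [∀ x, InnerProductSpace ℂ (E x)]
    [TopologicalSpace (TotalSpace F E)] [FiberBundle F E] [VectorBundle ℂ F E]
    [VectorBundle ℝ F E] [ContMDiffVectorBundle ∞ F E (𝓡 m)]
    (hE : LieGroupoid.SmoothHermitian F E m)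
    (D : LieGroupoid.AlgConnection 𝒢 F E) (ε : ℝ) (hε : 0 < ε) :
    ∃ J : LieGroupoid.PsiEps g D ε → LieGroupoid.groupoidCStar 𝒢 g F E,
      Function.Injective J ∧
      ∀ κ : LieGroupoid.PsiEps g D ε,
        LieGroupoid.IsClassOf (κ : 𝒢.Kernel E) (J κ : LieGroupoid.OpFamily 𝒢 g F E) ∧
        LieGroupoid.ActsBy (J κ : LieGroupoid.OpFamily 𝒢 g F E) (κ : 𝒢.Kernel E) := by
  have hfin : ∀ f : LieGroupoid.CptKernel 𝒢 E F, f.1.l1Norm g ≠ ⊤ :=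
    LieGroupoid.CptKernel.l1Norm_ne_top hE hconn hgrowth
  have hlf : ∀ x, IsLocallyFiniteMeasure (𝒢.vol g x) :=
    LieGroupoid.isLocallyFiniteMeasure_vol hconn hgrowth
  obtain ⟨Φ⟩ := LieGroupoid.nonempty_piecewiseFrame (F := F) (E := E) hE
  have hsm : ∀ κ : LieGroupoid.PsiEps g D ε, κ.1.Smooth F := fun κ =>
    (LieGroupoid.exists_decayBound_of_mem_psiEps κ.2).1
  have happ : ∀ (κ : LieGroupoid.PsiEps g D ε) (η : ℝ≥0∞), 0 < η →
      ∃ f : LieGroupoid.CptKernel 𝒢 E F, (κ.1 - f.1).l1Norm g < η := fun κ η hη => by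
    obtain ⟨hs, C, δ, hC, hδ, h⟩ := LieGroupoid.exists_decayBound_of_mem_psiEps κ.2
    exact h.exists_l1Norm_sub_lt hconn hgrowth hs hC (hε.trans hδ) hη
  have hκfin : ∀ κ : LieGroupoid.PsiEps g D ε, κ.1.l1Norm g ≠ ⊤ := fun κ => by
    obtain ⟨hs, C, δ, hC, hδ, h⟩ := LieGroupoid.exists_decayBound_of_mem_psiEps κ.2
    obtain ⟨A, hA⟩ := hgrowth δ (hε.trans hδ)
    exact ne_top_of_le_ne_top (ENNReal.mul_ne_top ENNReal.ofReal_ne_top ENNReal.ofReal_ne_top)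
      (h.l1Norm_le hC hA)
  choose c hc using fun κ : LieGroupoid.PsiEps g D ε =>
    LieGroupoid.exists_opFamily_fullNorm_sub_le hE (hsm κ) (happ κ)
  have hreg : ∀ κ x, Φ.regPart hE hfin (c κ) x = Φ.regOp g hE x (hsm κ) (hκfin κ) := fun κ x =>
    LieGroupoid.eq_regOp_of_fullNorm_sub_le hE Φ (hsm κ) (hκfin κ) hfin (happ κ) (hc κ) x
  refine ⟨fun κ => ⟨c κ, fun η hη => ?_⟩, fun κ₁ κ₂ h => ?_, fun κ => ⟨fun η hη => ?_,
    LieGroupoid.actsBy_of_eq_regOp hE Φ (hsm κ) (hκfin κ) hfin (hreg κ)⟩⟩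
  · obtain ⟨f, hf⟩ := happ κ η hη
    exact ⟨f, (hc κ f).trans_lt hf⟩
  · have hceq : c κ₁ = c κ₂ := congrArg Subtype.val h
    have hsub : (κ₁.1 - κ₂.1).l1Norm g ≠ ⊤ :=
      ne_top_of_le_ne_top (ENNReal.add_ne_top.2 ⟨hκfin κ₁, hκfin κ₂⟩)
        (LieGroupoid.Kernel.l1Norm_le_add g hE (hsm κ₁) fun a => norm_sub_le _ _)
    -- Equal classes have equal images in every regular representation, so all the operators of the
    -- difference kernel vanish.
    have hz := LieGroupoid.eq_zero_of_regOp_eq_zero hE Φ ((hsm κ₁).sub (hsm κ₂)) hsub fun x => by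
      rw [Φ.regOp_sub hE (hsm κ₁) (hsm κ₂) (hκfin κ₁) (hκfin κ₂) hsub x, ← hreg, ← hreg, hceq,
        sub_self]
    exact Subtype.ext (sub_eq_zero.1 hz)
  · obtain ⟨f, hf⟩ := happ κ η hη
    exact ⟨f, hf, (hc κ f).trans_lt hf⟩
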